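/- **Setting.** Let $-\infty<a<b<\infty$ and $J\in\{1,-1\}$. For bounded operators $A,B$ on a complex Hilbert space $H$ put $L(\lambda)=\lambda^2I+\lambda B+A$. Let $\varphi:H\to\mathbb C$ be bounded. Whenever $L(\lambda)$ is boundedly invertible, the characteristic function of the pencil is the scalar $$S_\Delta(\lambda,B)=1-i\,\varphi L(\lambda)^{-1}\varphi^*J .$$ For $v\in L^2(a,b)$ essentially bounded and $b(\cdot)$ real-valued, measurable and essentially bounded on $[a,b]$ (both continued by zero to $\mathbb R$), put $$\zeta(x,\lambda)=\lambda+x+b(x),\qquad \omega(x)=J|v(x)|^2,\qquad d(x,\lambda)=\frac{\zeta(x,\lambda)-\pi\omega(x)}{\zeta(x,\lambda)+\pi\omega(x)} ,$$ and $[\zeta^2-\pi^2\omega^2]^{1/2}=(\zeta+\pi\omega)\exp\{\tfrac12\ln d\}$, where $\ln$ is the principal logarithm. The model pair with data $(v,b(\cdot))$ is the pair of operators on $L^2(a,b)$ $$(\widetilde Xf)(x)=xf(x),\qquad (\widetilde Yf)(x)=-(x+b(x))f(x)+iJv(x)\;\mathrm{p.v.}\!\!\int_a^b\frac{f(t)\overline{v(t)}}{t-x}\,dt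 ,$$ with $\widetilde A=\widetilde Y\widetilde X$, $\widetilde B=-\widetilde X-\widetilde Y$, $\widetilde\varphi f=\int_a^bf(t)\overline{v(t)}\,dt$. We say that $S_\Delta(\lambda,B)$ is given by the closed form (4.20) with data $(v,b(\cdot))$ if $$S_\Delta(\lambda,B)=1+i\int_a^b\frac{\omega(x)}{[\zeta^2(x,\lambda)-\pi^2\omega^2(x)]^{1/2}}\exp\left\{\frac{\lambda-x}{2\pi i}\;\mathrm{p.v.}\!\!\int_{\mathbb R}\frac{\ln d(t,\lambda)}{(t-\lambda)(t-x)}\,dt\right\}\frac{dx}{x-\lambda},\tag{4.20}$$ where $\zeta(x,\lambda)+\pi\omega(x)\ne0$ and $d(x,\lambda)\notin(-\infty,0]$ for almost every $x\in\mathbb R$, the principal value exists for almost every $x\in[a,b]$, and the outer integral converges absolutely. **Theorem 4.1.** (1) For all $v$ and $b(\cdot)$ as above, the formulas for the model pair define bounded self-adjoint operators $\widetilde X,\widetilde Y$ on $L^2(a,b)$ (the principal value exists for almost every $x$), one has $\widetilde A-\widetilde A^*=i\widetilde\varphi^*J\widetilde\varphi$, and the characteristic function of the pencil $\lambda^2I+\lambda\widetilde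 B+\widetilde A$ is given by (4.20) with data $(v,b(\cdot))$ at every $\lambda\in\mathbb C$ where the pencil is invertible. (2) Let $A,B,X,Y$ be bounded operators on a complex Hilbert space $H$ and $\varphi:H\to\mathbb C$ be bounded, with $B=B^*$, $A-A^*=i\varphi^*J\varphi$ and $L(\lambda)=(\lambda I-Y)(\lambda I-X)$ for all $\lambda\in\mathbb C$. Suppose that $X$ has simple absolutely continuous spectrum $[a,b]$, in the sense that there is a unitary $V:L^2(a,b)\to H$ with $(V^{-1}XVf)(x)=xf(x)$ for all $f$, and that the function $v=V^{-1}\varphi^*1$ (so that $V^{-1}\varphi^*J\varphi V$ has kernel $Jv(x)\overline{v(t)}$) is essentially bounded. Then there is a real-valued, measurable, essentially bounded function $b(\cdot)$ on $[a,b]$ such that $(V^{-1}XV,V^{-1}YV)$ is the model pair with data $(v,b(\cdot))$, and the characteristic function $S_\Delta(\lambda,B)$ is given by (4.20) with data $(v,b(\cdot))$ at every $\lambda\in\mathbb C$ for which $L(\lambda)$ is invertible. (This includes the case where $X$ is a spectral root, $\sigma(X)\cap\sigma(Y)=\emptyset$, and $\operatorname{rank}\varphi^*J\varphi=1$, that is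 $v\neq0$; these two conditions are not needed.) -/

import Mathlib

open MeasureTheory Filter Topology
open scoped ComplexConjugate

noncomputable section

/-- The quadratic operator pencil `L(z) = z² I + z B + A`. -/
def quadPencil {H : Type*} [NormedAddCommGroup H] [InnerProductSpace ℂ H]
    (A B : H →L[ℂ] H) (z : ℂ) : H →L[ℂ] H :=
  z ^ 2 • (1 : H →L[ℂ] H) + z • B + A

/-- `(A, H, φ, E, σ)` is a local colligation: `σ = σ*` and `A - A* = i φ* σ φ`. -/
def IsLocalColligation {H E : Type*}
    [NormedAddCommGroup H] [InnerProductSpace ℂ H] [CompleteSpace H]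
    [NormedAddCommGroup E] [InnerProductSpace ℂ E] [CompleteSpace E]
    (A : H →L[ℂ] H) (φ : H →L[ℂ] E) (σ : E →L[ℂ] E) : Prop :=
  IsSelfAdjoint σ ∧
    A - ContinuousLinearMap.adjoint A
      = Complex.I • ((ContinuousLinearMap.adjoint φ).comp (σ.comp φ))

/-- The characteristic function `S(z, B) = I - i φ L(z)⁻¹ φ* σ` of the pencil. It is meaningful
when `L(z)` is invertible (`Ring.inverse` is then the bounded inverse). -/
def charFunction {H E : Type*}
    [NormedAddCommGroup H] [InnerProductSpace ℂ H] [CompleteSpace H]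
    [NormedAddCommGroup E] [InnerProductSpace ℂ E] [CompleteSpace E]
    (A B : H →L[ℂ] H) (φ : H →L[ℂ] E) (σ : E →L[ℂ] E) (z : ℂ) : E →L[ℂ] E :=
  1 - Complex.I •
    (φ.comp ((Ring.inverse (quadPencil A B z)).comp ((ContinuousLinearMap.adjoint φ).comp σ)))

/-- The number `p` is the principal value at `x` of the integral of `g`, i.e. the limit as
`ε → 0+` of the (absolutely convergent) integrals of `g` over `{t : |t - x| > ε}`. -/
def HasPV (μ : Measure ℝ) (g : ℝ → ℂ) (x : ℝ) (p : ℂ) : Prop :=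
  (∀ ε : ℝ, 0 < ε → IntegrableOn g {t : ℝ | ε < |t - x|} μ) ∧
    Tendsto (fun ε : ℝ => ∫ t in {t : ℝ | ε < |t - x|}, g t ∂μ) (𝓝[>] 0) (𝓝 p)

/-- Lebesgue measure on `[a, b]`. -/
abbrev lebIcc (a b : ℝ) : Measure ℝ := volume.restrict (Set.Icc a b)

/-- The Hilbert space `L²(a, b)`. -/
abbrev L2Icc (a b : ℝ) : Type := Lp ℂ 2 (lebIcc a b)

/-- `(X, Y)` is the model pair on `L²(a, b)`:
`(X f)(x) = x f(x)` and
`(Y f)(x) = -(x + β(x)) f(x) + i J v(x) p.v.∫_a^b f(t) conj(v(t)) / (t - x) dt`. -/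
def IsModelPair (a b J : ℝ) (v : ℝ → ℂ) (β : ℝ → ℝ) (X Y : L2Icc a b →L[ℂ] L2Icc a b) : Prop :=
  (∀ f : L2Icc a b, ∀ᵐ x : ℝ ∂(lebIcc a b), X f x = (x : ℂ) * f x) ∧
  (∀ f : L2Icc a b, ∀ᵐ x : ℝ ∂(lebIcc a b), ∃ p : ℂ,
    HasPV (lebIcc a b) (fun t : ℝ => f t * conj (v t) / ((t : ℂ) - (x : ℂ))) x p ∧
    Y f x = -((x : ℂ) + (β x : ℂ)) * f x + Complex.I * (J : ℂ) * v x * p)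

/-- `ζ(x, z) = z + x + β(x)`, with `β` continued by zero outside `[a, b]`. -/
def zetaFn (a b : ℝ) (β : ℝ → ℝ) (z : ℂ) (x : ℝ) : ℂ :=
  z + (x : ℂ) + (((Set.Icc a b).indicator β x : ℝ) : ℂ)

/-- `ω(x) = J |v(x)|²`, with `v` continued by zero outside `[a, b]`. -/
def omegaFn (a b J : ℝ) (v : ℝ → ℂ) (x : ℝ) : ℝ :=
  J * ‖(Set.Icc a b).indicator v x‖ ^ 2

/-- `d(x, z) = (ζ - π ω) / (ζ + π ω)`. -/
def dCoef (a b J : ℝ) (v : ℝ → ℂ) (β : ℝ → ℝ) (z : ℂ) (x : ℝ) : ℂ :=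
  (zetaFn a b β z x - (Real.pi : ℂ) * (omegaFn a b J v x : ℂ)) /
    (zetaFn a b β z x + (Real.pi : ℂ) * (omegaFn a b J v x : ℂ))

/-- The square root `[ζ² - π² ω²]^{1/2} = (ζ + π ω) d^{1/2}`, with `d^{1/2} = exp((ln d) / 2)`
and the principal logarithm. -/
def rootFactor (a b J : ℝ) (v : ℝ → ℂ) (β : ℝ → ℝ) (z : ℂ) (x : ℝ) : ℂ :=
  (zetaFn a b β z x + (Real.pi : ℂ) * (omegaFn a b J v x : ℂ)) *
    Complex.exp (Complex.log (dCoef a b J v β z x) / 2)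

/-- The integrand of the closed form; `P x` stands for
`p.v.∫_ℝ ln d(t, z) / ((t - z) (t - x)) dt`. -/
def closedIntegrand (a b J : ℝ) (v : ℝ → ℂ) (β : ℝ → ℝ) (P : ℝ → ℂ) (z : ℂ) (x : ℝ) : ℂ :=
  (omegaFn a b J v x : ℂ) / rootFactor a b J v β z x *
    Complex.exp ((z - (x : ℂ)) / (2 * (Real.pi : ℂ) * Complex.I) * P x) / ((x : ℂ) - z)

/-- The number `s` is given at the point `z` by the closed form
`s = 1 + i ∫_a^b ω(x) / [ζ² - π² ω²]^{1/2}
  · exp{ (z - x) / (2πi) · p.v.∫_ℝ ln d(t, z) / ((t - z) (t - x)) dt } dx / (x - z)`,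
and every ingredient of it makes sense: for almost all `x` the quotient `d` has a nonzero
denominator and lies in the plane slit along `(-∞, 0]`, where `ln` is the principal logarithm;
the principal value exists for almost all `x` in `[a, b]`; the outer integral converges
absolutely. -/
def HasClosedForm (a b J : ℝ) (v : ℝ → ℂ) (β : ℝ → ℝ) (z s : ℂ) : Prop :=
  (∀ᵐ x : ℝ, zetaFn a b β z x + (Real.pi : ℂ) * (omegaFn a b J v x : ℂ) ≠ 0 ∧
    dCoef a b J v β z x ∈ Complex.slitPlane) ∧
  ∃ P : ℝ → ℂ,
    (∀ᵐ x : ℝ ∂(lebIcc a b), HasPV volume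
      (fun t : ℝ => Complex.log (dCoef a b J v β z t) / (((t : ℂ) - z) * ((t : ℂ) - (x : ℂ))))
      x (P x)) ∧
    Integrable (closedIntegrand a b J v β P z) (lebIcc a b) ∧
    s = 1 + Complex.I * ∫ x, closedIntegrand a b J v β P z x ∂(lebIcc a b)

end

/-!
Write `T` for the Hilbert transform `(T h)(x) = p.v. ∫ h(t) / (t - x) dt` on `L²(ℝ)` and `F_h(w)
= ∫ h(t) / (t - w) dt` for the Cauchy transform. Here `T` is defined as `π i (1 - 2 P)`, `P`
being the projection onto the closed span of the Cauchy kernels with pole in the upper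
half-plane, so that boundedness and `T* = -T` are free. Lebesgue points and the Poisson kernel
identify `T h` with the principal value (`ae_hasPV_hilbertT`) and give the boundary values
`F_h(x ± i0) = T h ± π i h` (`ae_tendsto_cauchyT`).

*The characteristic function.* Let `z` be a regular point of the pencil. Then `z ∉ [a, b]` and
`z - Y` is invertible. Put `h = conj(v) (z - Y)⁻¹ v`, continued by zero. The resolvent equation
says that `Φ = F_h - i J` solves the scalar jump problem `(ζ + π ω) Φ₊ = (ζ - π ω) Φ₋` on the
line, and the characteristic function of the pencil at `z` is `i J Φ(z)`. Three facts turn this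
into the closed form.

* The coefficients `ζ ± π ω` are bounded away from zero (`one_le_mul_norm_symbol`): testing the
  invertibility of `z - Y` on concentrating Cauchy kernels reduces it to a pointwise inequality.
* The resolvent at `conj z` yields a solution `Φ'` of the conjugate jump problem, and `Φ Φ' = 1`
  (`solution_mul_solutionConj`), because products of boundary values are again boundary values.
  For real `z` the boundary values of `Φ'` are the conjugates of those of `Φ`, which makes the
  quotient `d` positive; for other `z` it has nonzero imaginary part or equals one. So `d` never
  meets `(-∞, 0]`.
* `Φ = -i J exp E` with `E(w) = (2 π i)⁻¹ ∫ ln d(t, z) / (t - w) dt` (`solution_eq_exp`). As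
  functions of `z`, the logarithmic derivative of `Φ` equals the derivative of `E`, since
  differentiating the jump relation gives another one that is solved explicitly with the help of
  `Φ'`, and both sides have the same limit as `z` moves to infinity along a vertical ray. Real
  `z` are reached by continuity.

So the characteristic function is `exp (E(z))`. The jump of `Φ' = i J exp (-E)` across the line
shows that `Φ' - i J` is the Cauchy transform of `J ω / [ζ² - π² ω²]^{1/2} · exp (-(2 π i)⁻¹ T
ln d)`. Evaluated at `z` and multiplied by `exp (E(z))`, this is the closed form for `exp
(E(z))`, because the exponent in the closed form is `E(z) - (2 π i)⁻¹ T ln d`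
(`hasClosedForm_exp`, `exists_hasClosedForm`).

*The inverse problem.* If `X` is multiplication by `x`, the colligation condition prescribes the
commutator of `Y` and `X`, and the singular integral of the model pair has the same commutator.
The difference commutes with `X`, hence with multiplication by Cauchy kernels, hence is
multiplication by an essentially bounded function (`exists_eq_mulOp_of_commute`), which is real
because `Y` is self-adjoint. So the given pair is unitarily equivalent to a model pair.
-/

noncomputable section

/-! ### Poisson averages and Lebesgue points -/

/-- The Poisson kernel without its normalisation `1 / π`. -/
def poissonKer (ε s : ℝ) : ℝ := ε / (s ^ 2 + ε ^ 2)

lemma poissonKer_nonneg {ε : ℝ} (hε : 0 < ε) (s : ℝ) : 0 ≤ poissonKer ε s := by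
  unfold poissonKer; positivity

lemma continuous_poissonKer {ε : ℝ} (hε : 0 < ε) : Continuous (poissonKer ε) := by
  unfold poissonKer
  refine continuous_const.div (by fun_prop) fun s => ?_
  positivity

lemma integral_poissonKer {ε : ℝ} (hε : 0 < ε) : ∫ s, poissonKer ε s = Real.pi := by
  have h := Measure.integral_comp_mul_left (fun s : ℝ => (1 + s ^ 2)⁻¹) ε⁻¹
  rw [integral_univ_inv_one_add_sq, inv_inv, abs_of_pos hε, smul_eq_mul] at h
  have h2 : ∀ s, poissonKer ε s = ε⁻¹ * (1 + (ε⁻¹ * s) ^ 2)⁻¹ := fun s => by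
    unfold poissonKer; field_simp; ring
  simp_rw [h2, integral_const_mul, h]
  field_simp

lemma integrable_poissonKer {ε : ℝ} (hε : 0 < ε) : Integrable (poissonKer ε) := by
  by_contra h
  have := integral_poissonKer hε
  rw [integral_undef h] at this
  exact Real.pi_ne_zero this.symm

lemma poissonKer_le {ε : ℝ} (hε : 0 < ε) (s : ℝ) : poissonKer ε s ≤ ε⁻¹ := by
  unfold poissonKer
  rw [div_le_iff₀ (by positivity)]
  have : ε⁻¹ * (s ^ 2 + ε ^ 2) = ε⁻¹ * s ^ 2 + ε := by field_simp
  rw [this]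
  have : 0 ≤ ε⁻¹ * s ^ 2 := by positivity
  linarith

lemma memLp_poissonKer {ε : ℝ} (hε : 0 < ε) : MemLp (poissonKer ε) 2 volume := by
  rw [memLp_two_iff_integrable_sq (continuous_poissonKer hε).aestronglyMeasurable]
  refine ((integrable_poissonKer hε).const_mul ε⁻¹).mono'
    ((continuous_poissonKer hε).pow 2).aestronglyMeasurable (ae_of_all _ fun s => ?_)
  rw [Real.norm_of_nonneg (by positivity), sq]
  exact mul_le_mul_of_nonneg_right (poissonKer_le hε s) (poissonKer_nonneg hε s)

/-- The Poisson kernel is dominated by a sum of multiples of indicators of dyadic intervals. -/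
lemma poissonKer_le_tsum_indicator {ε : ℝ} (hε : 0 < ε) (x t : ℝ) :
    ENNReal.ofReal (poissonKer ε (t - x)) ≤
      ∑' n : ℕ, (Metric.closedBall x (2 ^ n * ε)).indicator
        (fun _ => ENNReal.ofReal (4 * (4 ^ n)⁻¹ * ε⁻¹)) t := by
  have hex : ∃ n : ℕ, |t - x| ≤ 2 ^ n * ε := by
    obtain ⟨n, hn⟩ := pow_unbounded_of_one_lt (|t - x| / ε) (one_lt_two)
    exact ⟨n, by rw [div_lt_iff₀ hε] at hn; exact hn.le⟩
  classical
  let n := Nat.find hex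
  have hn : |t - x| ≤ 2 ^ n * ε := Nat.find_spec hex
  refine le_trans ?_ (ENNReal.le_tsum n)
  rw [Set.indicator_of_mem (by rwa [Metric.mem_closedBall, Real.dist_eq])]
  apply ENNReal.ofReal_le_ofReal
  rcases Nat.eq_zero_or_pos n with h0 | hpos
  · rw [h0]
    refine (poissonKer_le hε _).trans ?_
    have : 0 < ε⁻¹ := by positivity
    norm_num
    linarith
  · obtain ⟨m, hm⟩ : ∃ m, n = m + 1 := ⟨n - 1, by omega⟩
    have hm' : 2 ^ m * ε < |t - x| := by
      have := Nat.find_min hex (show m < n by omega)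
      exact not_le.mp this
    rw [hm]
    unfold poissonKer
    have h1 : (2 ^ m * ε) ^ 2 ≤ (t - x) ^ 2 := by
      rw [← sq_abs (t - x)]
      exact pow_le_pow_left₀ (by positivity) hm'.le 2
    have h2 : (4 : ℝ) ^ m = (2 ^ m) ^ 2 := by
      rw [← pow_mul, mul_comm, pow_mul]; norm_num
    rw [div_le_iff₀ (by positivity), pow_succ, h2]
    have h3 : 4 * ((2 ^ m) ^ 2 * 4)⁻¹ * ε⁻¹ * ((2 ^ m * ε) ^ 2) = ε := by field_simp
    have h4 : 0 ≤ 4 * (((2 : ℝ) ^ m) ^ 2 * 4)⁻¹ * ε⁻¹ := by positivity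
    nlinarith [mul_le_mul_of_nonneg_left h1 h4, mul_nonneg h4 (sq_nonneg ε)]

/-- Almost every point is a Lebesgue point with respect to Poisson averages. The dyadic
domination of the Poisson kernel reduces this to the Lebesgue differentiation theorem on
intervals. -/
theorem ae_tendsto_lintegral_poissonKer {h : ℝ → ℂ} (hh : MemLp h 2 volume) :
    ∀ᵐ x : ℝ, Tendsto (fun ε => ∫⁻ t, ENNReal.ofReal (poissonKer ε (t - x)) * ‖h t - h x‖ₑ)
      (𝓝[>] 0) (𝓝 0) := by
  have hloc : LocallyIntegrable h volume := hh.locallyIntegrable (by norm_num)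
  have hm : AEStronglyMeasurable h volume := hh.1
  filter_upwards [(IsUnifLocDoublingMeasure.vitaliFamily (volume : Measure ℝ)
    1).ae_tendsto_lintegral_enorm_sub_div hloc] with x hx
  have hmx : AEMeasurable (fun t => ‖h t - h x‖ₑ) volume :=
    (hm.sub aestronglyMeasurable_const).enorm
  set B : ℝ → ENNReal := fun r => (∫⁻ t in Metric.closedBall x r, ‖h t - h x‖ₑ) / ENNReal.ofReal (2 * r)
    with hB
  have hB0 : Tendsto B (𝓝[>] 0) (𝓝 0) := by
    have := hx.comp (IsUnifLocDoublingMeasure.tendsto_closedBall_filterAt (volume : Measure ℝ)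
      (K := 1) (x := x) (l := 𝓝[>] (0 : ℝ)) (fun _ => x) id tendsto_id
      (by filter_upwards [self_mem_nhdsWithin] with r (hr : 0 < r); simpa using hr.le))
    refine this.congr fun r => ?_
    simp [hB, Real.volume_closedBall]
  obtain ⟨M, hM, hBM⟩ : ∃ M : ENNReal, M ≠ ⊤ ∧ ∀ r, 0 < r → B r ≤ M := by
    obtain ⟨r0, hr0, hr0'⟩ : ∃ r0 > 0, ∀ r, 0 < r → r < r0 → B r ≤ 1 := by
      have := hB0.eventually (Iic_mem_nhds (zero_lt_one' ENNReal))
      rw [eventually_nhdsWithin_iff, Metric.eventually_nhds_iff] at this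
      obtain ⟨r0, h1, h2⟩ := this
      exact ⟨r0, h1, fun r hr hr' => h2 (by simpa [abs_of_pos hr] using hr') hr⟩
    have hfin : ∫⁻ t, ‖h t‖ₑ ^ 2 ≠ ⊤ := by
      have := lintegral_rpow_enorm_lt_top_of_eLpNorm_lt_top (by norm_num) (by norm_num) hh.2
      simpa using this.ne
    set N := ∫⁻ t, ‖h t‖ₑ ^ 2
    refine ⟨1 + (1 + ‖h x‖ₑ + N / ENNReal.ofReal (2 * r0)), ?_, fun r hr => ?_⟩
    · simp only [ne_eq, ENNReal.add_eq_top, ENNReal.one_ne_top, enorm_ne_top, false_or]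
      exact ENNReal.div_ne_top hfin (by simpa using hr0)
    · rcases lt_or_ge r r0 with hlt | hge
      · exact (hr0' r hr hlt).trans le_self_add
      · refine le_trans ?_ le_add_self
        have h2r : ENNReal.ofReal (2 * r) ≠ 0 := by simpa using hr
        rw [hB]
        have hstep : ∫⁻ t in Metric.closedBall x r, ‖h t - h x‖ₑ ≤
            (1 + ‖h x‖ₑ) * ENNReal.ofReal (2 * r) + N := by
          calc ∫⁻ t in Metric.closedBall x r, ‖h t - h x‖ₑ
              ≤ ∫⁻ t in Metric.closedBall x r, ((1 + ‖h x‖ₑ) + ‖h t‖ₑ ^ 2) := by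
                refine lintegral_mono fun t => ?_
                refine (enorm_sub_le).trans ?_
                have : ‖h t‖ₑ ≤ 1 + ‖h t‖ₑ ^ 2 := by
                  rcases le_total ‖h t‖ₑ 1 with h1 | h1
                  · exact h1.trans le_self_add
                  · refine le_trans ?_ le_add_self
                    rw [sq]; exact le_mul_of_one_le_left' h1
                calc ‖h t‖ₑ + ‖h x‖ₑ ≤ (1 + ‖h t‖ₑ ^ 2) + ‖h x‖ₑ := by gcongr
                  _ = _ := by ring
            _ = (1 + ‖h x‖ₑ) * ENNReal.ofReal (2 * r) +
                ∫⁻ t in Metric.closedBall x r, ‖h t‖ₑ ^ 2 := by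
                rw [lintegral_add_left measurable_const, setLIntegral_const, Real.volume_closedBall]
            _ ≤ _ := by gcongr; exact setLIntegral_le_lintegral _ _
        calc (∫⁻ t in Metric.closedBall x r, ‖h t - h x‖ₑ) / ENNReal.ofReal (2 * r)
            ≤ ((1 + ‖h x‖ₑ) * ENNReal.ofReal (2 * r) + N) / ENNReal.ofReal (2 * r) := by gcongr
          _ = (1 + ‖h x‖ₑ) + N / ENNReal.ofReal (2 * r) := by
              rw [ENNReal.add_div, ENNReal.mul_div_cancel_right h2r ENNReal.ofReal_ne_top]
          _ ≤ _ := by gcongr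
  have hmaj : ∀ ε : ℝ, 0 < ε →
      ∫⁻ t, ENNReal.ofReal (poissonKer ε (t - x)) * ‖h t - h x‖ₑ ≤
        ∑' n : ℕ, ENNReal.ofReal (8 * (2 ^ n)⁻¹) * B (2 ^ n * ε) := by
    intro ε hε
    calc ∫⁻ t, ENNReal.ofReal (poissonKer ε (t - x)) * ‖h t - h x‖ₑ
        ≤ ∫⁻ t, ∑' n : ℕ, (Metric.closedBall x (2 ^ n * ε)).indicator
            (fun t => ENNReal.ofReal (4 * (4 ^ n)⁻¹ * ε⁻¹) * ‖h t - h x‖ₑ) t := by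
          refine lintegral_mono fun t => ?_
          refine (mul_le_mul_left (poissonKer_le_tsum_indicator hε x t) _).trans ?_
          rw [← ENNReal.tsum_mul_right]
          refine ENNReal.tsum_le_tsum fun n => ?_
          by_cases ht : t ∈ Metric.closedBall x (2 ^ n * ε)
          · simp only [Set.indicator_of_mem ht, le_refl]
          · simp only [Set.indicator_of_notMem ht, zero_mul, le_refl]
      _ = ∑' n : ℕ, ENNReal.ofReal (4 * (4 ^ n)⁻¹ * ε⁻¹) *
            ∫⁻ t in Metric.closedBall x (2 ^ n * ε), ‖h t - h x‖ₑ := by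
          rw [lintegral_tsum fun n =>
            (hmx.const_mul _).indicator Metric.isClosed_closedBall.measurableSet]
          congr 1; ext n
          rw [lintegral_indicator Metric.isClosed_closedBall.measurableSet,
            lintegral_const_mul' _ _ ENNReal.ofReal_ne_top]
      _ = _ := by
          congr 1; ext n
          have hpos : 0 < 2 * (2 ^ n * ε) := by positivity
          have : ENNReal.ofReal (4 * (4 ^ n)⁻¹ * ε⁻¹) =
              ENNReal.ofReal (8 * (2 ^ n)⁻¹) * (ENNReal.ofReal (2 * (2 ^ n * ε)))⁻¹ := by
            rw [← ENNReal.ofReal_inv_of_pos hpos, ← ENNReal.ofReal_mul (by positivity)]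
            congr 1
            have h2 : (4 : ℝ) ^ n = (2 ^ n) ^ 2 := by
              rw [← pow_mul, mul_comm, pow_mul]; norm_num
            rw [h2]; field_simp; norm_num
          rw [this]
          simp only [hB]
          rw [div_eq_mul_inv]
          ring
  have hlim : Tendsto (fun ε => ∑' n : ℕ, ENNReal.ofReal (8 * (2 ^ n)⁻¹) * B (2 ^ n * ε))
      (𝓝[>] 0) (𝓝 0) := by
    simp_rw [← lintegral_count]
    have := tendsto_lintegral_filter_of_dominated_convergence (μ := (Measure.count : Measure ℕ))
      (l := 𝓝[>] (0 : ℝ)) (F := fun ε n => ENNReal.ofReal (8 * (2 ^ n)⁻¹) * B (2 ^ n * ε))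
      (f := fun _ => 0) (fun n => ENNReal.ofReal (8 * (2 ^ n)⁻¹) * M)
      (Eventually.of_forall fun ε => measurable_from_nat)
      (by
        filter_upwards [self_mem_nhdsWithin] with ε (hε : 0 < ε)
        exact ae_of_all _ fun n => mul_le_mul_right (hBM _ (by positivity)) _)
      (by
        rw [lintegral_count, ENNReal.tsum_mul_right]
        refine ENNReal.mul_ne_top ?_ hM
        have hs : Summable fun n : ℕ => 8 * ((2 : ℝ) ^ n)⁻¹ := by
          simpa using (summable_geometric_two).mul_left 8
        exact hs.tsum_ofReal_ne_top)
      (ae_of_all _ fun n => by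
        have h1 : Tendsto (fun ε : ℝ => 2 ^ n * ε) (𝓝[>] 0) (𝓝[>] 0) := by
          refine tendsto_nhdsWithin_iff.mpr ⟨?_, ?_⟩
          · have : Tendsto (fun ε : ℝ => 2 ^ n * ε) (𝓝 0) (𝓝 (2 ^ n * 0)) :=
              tendsto_id.const_mul _
            rw [mul_zero] at this
            exact this.mono_left nhdsWithin_le_nhds
          · filter_upwards [self_mem_nhdsWithin] with ε (hε : 0 < ε)
            exact Set.mem_Ioi.2 (by positivity)
        have h2 := ENNReal.Tendsto.const_mul (a := ENNReal.ofReal (8 * (2 ^ n)⁻¹))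
          (hB0.comp h1) (Or.inr ENNReal.ofReal_ne_top)
        simpa using h2)
    simpa using this
  refine tendsto_of_tendsto_of_tendsto_of_le_of_le' tendsto_const_nhds hlim
    (Eventually.of_forall fun _ => zero_le) ?_
  filter_upwards [self_mem_nhdsWithin] with ε hε using hmaj ε hε

lemma integrable_poissonKer_mul {h : ℝ → ℂ} (hh : MemLp h 2 volume) {ε : ℝ} (hε : 0 < ε)
    (x : ℝ) : Integrable fun t => (poissonKer ε (t - x) : ℂ) * h t := by
  have h1 : MemLp (fun t => (poissonKer ε (t - x) : ℂ)) 2 volume :=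
    ((memLp_poissonKer hε).comp_measurePreserving
      (measurePreserving_sub_right volume x)).ofReal
  exact h1.integrable_mul hh

lemma integrable_poissonKer_mul_norm_sub {h : ℝ → ℂ} (hh : MemLp h 2 volume) {ε : ℝ} (hε : 0 < ε)
    (x : ℝ) (c : ℂ) : Integrable fun t => poissonKer ε (t - x) * ‖h t - c‖ := by
  have h2 : Integrable fun t => (poissonKer ε (t - x) : ℂ) * c :=
    (((integrable_poissonKer hε).comp_sub_right x).ofReal).mul_const c
  refine ((integrable_poissonKer_mul hh hε x).sub h2).norm.congr (ae_of_all _ fun t => ?_)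
  simp only [Pi.sub_apply]
  rw [← mul_sub, norm_mul, Complex.norm_real, Real.norm_of_nonneg (poissonKer_nonneg hε _)]

theorem ae_tendsto_integral_poissonKer_norm_sub {h : ℝ → ℂ} (hh : MemLp h 2 volume) :
    ∀ᵐ x : ℝ, Tendsto (fun ε => ∫ t, poissonKer ε (t - x) * ‖h t - h x‖) (𝓝[>] 0) (𝓝 0) := by
  filter_upwards [ae_tendsto_lintegral_poissonKer hh] with x hx
  have := (ENNReal.tendsto_toReal ENNReal.zero_ne_top).comp hx
  rw [ENNReal.toReal_zero] at this
  refine this.congr' ?_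
  filter_upwards [self_mem_nhdsWithin] with ε (hε : 0 < ε)
  rw [integral_eq_lintegral_of_nonneg_ae
    (ae_of_all _ fun t => mul_nonneg (poissonKer_nonneg hε _) (norm_nonneg _))
    (integrable_poissonKer_mul_norm_sub hh hε x (h x)).1]
  simp only [Function.comp_apply]
  congr 1
  refine lintegral_congr fun t => ?_
  rw [ENNReal.ofReal_mul (poissonKer_nonneg hε _), ofReal_norm]

/-- At a Lebesgue point the Poisson averages of a function converge to its value. -/
lemma tendsto_integral_poissonKer_mul {h : ℝ → ℂ} (hh : MemLp h 2 volume) {x : ℝ}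
    (hx : Tendsto (fun ε => ∫ t, poissonKer ε (t - x) * ‖h t - h x‖) (𝓝[>] 0) (𝓝 0)) :
    Tendsto (fun ε => ∫ t, (poissonKer ε (t - x) : ℂ) * h t) (𝓝[>] 0) (𝓝 (Real.pi * h x)) := by
  rw [tendsto_iff_norm_sub_tendsto_zero]
  refine squeeze_zero' (Eventually.of_forall fun _ => norm_nonneg _) ?_ hx
  filter_upwards [self_mem_nhdsWithin] with ε (hε : 0 < ε)
  have h1 : ∫ t, (poissonKer ε (t - x) : ℂ) * h x = Real.pi * h x := by
    rw [integral_mul_const, integral_complex_ofReal, integral_sub_right_eq_self (poissonKer ε) x,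
      integral_poissonKer hε]
  have h2 : Integrable fun t => (poissonKer ε (t - x) : ℂ) * h x :=
    (((integrable_poissonKer hε).comp_sub_right x).ofReal).mul_const _
  rw [← h1, ← integral_sub (integrable_poissonKer_mul hh hε x) h2]
  refine (norm_integral_le_integral_norm _).trans (le_of_eq (integral_congr_ae
    (ae_of_all _ fun t => ?_)))
  simp only
  rw [← mul_sub, norm_mul, Complex.norm_real, Real.norm_of_nonneg (poissonKer_nonneg hε _)]

/-! ### Cauchy kernels on the line -/

/-- The Hilbert space `L²(ℝ)`. -/
abbrev L2R : Type := Lp ℂ 2 (volume : Measure ℝ)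

/-- The Cauchy kernel `t ↦ 1 / (t - w)`. -/
def cauchyKer (w : ℂ) (t : ℝ) : ℂ := ((t : ℂ) - w)⁻¹

lemma ofReal_sub_ne_zero {w : ℂ} (hw : w.im ≠ 0) (t : ℝ) : (t : ℂ) - w ≠ 0 := by
  intro h
  have := congrArg Complex.im h
  simp at this
  exact hw this

lemma continuous_cauchyKer {w : ℂ} (hw : w.im ≠ 0) : Continuous (cauchyKer w) :=
  (Complex.continuous_ofReal.sub continuous_const).inv₀ (ofReal_sub_ne_zero hw)

lemma measurable_cauchyKer (w : ℂ) : Measurable (cauchyKer w) :=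
  (Complex.measurable_ofReal.sub_const w).inv

lemma norm_cauchyKer_sq {w : ℂ} (hw : w.im ≠ 0) (t : ℝ) :
    ‖cauchyKer w t‖ ^ 2 = |w.im|⁻¹ * poissonKer |w.im| (t - w.re) := by
  have h : ‖(t : ℂ) - w‖ ^ 2 = (t - w.re) ^ 2 + |w.im| ^ 2 := by
    rw [Complex.sq_norm, Complex.normSq_apply, sq_abs]; simp; ring
  have h0 : |w.im| ≠ 0 := abs_ne_zero.mpr hw
  rw [cauchyKer, norm_inv, inv_pow, h, poissonKer]
  field_simp

lemma norm_cauchyKer_le {w : ℂ} (hw : w.im ≠ 0) (t : ℝ) : ‖cauchyKer w t‖ ≤ |w.im|⁻¹ := by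
  rw [cauchyKer, norm_inv]
  refine inv_anti₀ (abs_pos.mpr hw) ?_
  have := Complex.abs_im_le_norm ((t : ℂ) - w)
  simpa using this

lemma memLp_cauchyKer {w : ℂ} (hw : w.im ≠ 0) : MemLp (cauchyKer w) 2 volume := by
  rw [memLp_two_iff_integrable_sq_norm (continuous_cauchyKer hw).aestronglyMeasurable]
  simp_rw [norm_cauchyKer_sq hw]
  exact ((integrable_poissonKer (abs_pos.mpr hw)).comp_sub_right _).const_mul _

lemma conj_cauchyKer (w : ℂ) (t : ℝ) : conj (cauchyKer w t) = cauchyKer (conj w) t := by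
  simp [cauchyKer]

lemma cauchyKer_sub_conj (x : ℝ) {ε : ℝ} (hε : 0 < ε) (t : ℝ) :
    cauchyKer (x + ε * Complex.I) t - cauchyKer (x - ε * Complex.I) t =
      2 * Complex.I * poissonKer ε (t - x) := by
  have h1 : (t : ℂ) - (x + ε * Complex.I) ≠ 0 := ofReal_sub_ne_zero (by simpa using hε.ne') t
  have h2 : (t : ℂ) - (x - ε * Complex.I) ≠ 0 := ofReal_sub_ne_zero (by simpa using hε.ne') t
  have h3 : ((t - x) ^ 2 + ε ^ 2 : ℂ) = (t - (x + ε * Complex.I)) * (t - (x - ε * Complex.I)) := by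
    ring_nf; simp
  simp only [cauchyKer, poissonKer]
  push_cast
  rw [h3]
  field_simp
  ring

lemma cauchyKer_add_conj (x : ℝ) {ε : ℝ} (hε : 0 < ε) (t : ℝ) :
    cauchyKer (x + ε * Complex.I) t + cauchyKer (x - ε * Complex.I) t =
      2 * (((t - x) / ((t - x) ^ 2 + ε ^ 2) : ℝ) : ℂ) := by
  have h1 : (t : ℂ) - (x + ε * Complex.I) ≠ 0 := ofReal_sub_ne_zero (by simpa using hε.ne') t
  have h2 : (t : ℂ) - (x - ε * Complex.I) ≠ 0 := ofReal_sub_ne_zero (by simpa using hε.ne') t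
  have h3 : ((t - x) ^ 2 + ε ^ 2 : ℂ) = (t - (x + ε * Complex.I)) * (t - (x - ε * Complex.I)) := by
    ring_nf; simp
  simp only [cauchyKer]
  push_cast
  rw [h3]
  field_simp
  ring

lemma tendsto_cauchyKer {l : Filter ℝ} (w : ℂ)
    (hl : Tendsto (fun t : ℝ => (t : ℂ)) l (Bornology.cobounded ℂ)) :
    Tendsto (cauchyKer w) l (𝓝 0) := by
  refine tendsto_inv₀_cobounded.comp ?_
  rw [← tendsto_norm_atTop_iff_cobounded] at hl ⊢
  refine tendsto_atTop_mono (fun t => norm_sub_norm_le _ _) ?_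
  exact tendsto_atTop_add_const_right _ _ hl

lemma tendsto_cauchyKer_atTop (w : ℂ) : Tendsto (cauchyKer w) atTop (𝓝 0) :=
  tendsto_cauchyKer w (RCLike.tendsto_ofReal_atTop_cobounded ℂ)

lemma tendsto_cauchyKer_atBot (w : ℂ) : Tendsto (cauchyKer w) atBot (𝓝 0) :=
  tendsto_cauchyKer w (RCLike.tendsto_ofReal_atBot_cobounded ℂ)

lemma hasDerivAt_cauchyKer {w : ℂ} (hw : w.im ≠ 0) (t : ℝ) :
    HasDerivAt (cauchyKer w) (-(cauchyKer w t * cauchyKer w t)) t := by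
  have h1 : HasDerivAt (fun t : ℝ => (t : ℂ) - w) 1 t :=
    (Complex.ofRealCLM.hasDerivAt (x := t)).sub_const w
  refine (h1.inv (ofReal_sub_ne_zero hw t)).congr_deriv ?_
  simp only [cauchyKer]; field_simp

/-- Two Cauchy kernels with poles on the same side of the line have a product of integral zero. -/
lemma integral_cauchyKer_mul_cauchyKer {p q : ℂ} (hpq : 0 < p.im * q.im) :
    ∫ t, cauchyKer p t * cauchyKer q t = 0 := by
  have hp : p.im ≠ 0 := fun h => by simp [h] at hpq
  have hq : q.im ≠ 0 := fun h => by simp [h] at hpq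
  have hint : Integrable fun t => cauchyKer p t * cauchyKer q t :=
    (memLp_cauchyKer hp).integrable_mul (memLp_cauchyKer hq)
  rcases eq_or_ne p q with rfl | hne
  · have h := integral_of_hasDerivAt_of_tendsto (fun t => (hasDerivAt_cauchyKer hp t).neg)
      (by simpa using hint) (m := 0) (n := 0) (by simpa using! (tendsto_cauchyKer_atBot p).neg)
      (by simpa using! (tendsto_cauchyKer_atTop p).neg)
    simpa using h
  · -- a primitive is a multiple of `log ((t - p) / (t - q))`, and the quotient avoids the cut
    let r : ℝ → ℂ := fun t => ((t : ℂ) - p) * cauchyKer q t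
    have hr1 : ∀ t, r t = 1 + (q - p) * cauchyKer q t := fun t => by
      have := ofReal_sub_ne_zero hq t
      simp only [r, cauchyKer]; field_simp; ring
    have hslit : ∀ t, r t ∈ Complex.slitPlane := by
      intro t
      by_contra hcon
      rw [Complex.mem_slitPlane_iff_not_le_zero, not_not, Complex.le_def] at hcon
      have hre : (r t).re ≤ 0 := hcon.1
      have him : (r t).im = 0 := hcon.2
      have h2 : r t * (t - q) = t - p := by
        have := ofReal_sub_ne_zero hq t
        simp only [r, cauchyKer]; field_simp
      have h3 := congrArg Complex.im h2
      simp [him] at h3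
      rw [← h3] at hpq
      nlinarith [mul_self_nonneg q.im]
    have hder : ∀ t, HasDerivAt (fun t => (p - q)⁻¹ * Complex.log (r t))
        (cauchyKer p t * cauchyKer q t) t := by
      intro t
      have hrd : HasDerivAt r ((q - p) * -(cauchyKer q t * cauchyKer q t)) t := by
        have := ((hasDerivAt_cauchyKer hq t).const_mul (q - p)).const_add 1
        rwa [show r = fun t => 1 + (q - p) * cauchyKer q t from funext hr1]
      have h1 := (hrd.clog_real (hslit t)).const_mul ((p - q)⁻¹)
      refine h1.congr_deriv ?_
      have e1 := ofReal_sub_ne_zero hq t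
      have e2 := ofReal_sub_ne_zero hp t
      have e3 := sub_ne_zero.mpr hne
      simp only [r, cauchyKer]
      field_simp
      ring
    have hlim : ∀ l : Filter ℝ, Tendsto (cauchyKer q) l (𝓝 0) →
        Tendsto (fun t => (p - q)⁻¹ * Complex.log (r t)) l (𝓝 0) := by
      intro l hl
      have h1 : Tendsto r l (𝓝 1) := by
        simp_rw [show r = fun t => 1 + (q - p) * cauchyKer q t from funext hr1]
        simpa using (hl.const_mul (q - p)).const_add 1
      have h2 := (h1.clog (by simp)).const_mul ((p - q)⁻¹)
      simpa using h2
    have h := integral_of_hasDerivAt_of_tendsto hder hint (hlim _ (tendsto_cauchyKer_atBot q))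
      (hlim _ (tendsto_cauchyKer_atTop q))
    simpa using h

/-- The Cauchy kernel as an element of `L²(ℝ)`. -/
def cauchyL2 (w : ℂ) (hw : w.im ≠ 0) : L2R := (memLp_cauchyKer hw).toLp (cauchyKer w)

lemma coeFn_cauchyL2 {w : ℂ} (hw : w.im ≠ 0) : cauchyL2 w hw =ᵐ[volume] cauchyKer w :=
  MemLp.coeFn_toLp _

/-- Complex conjugation on `L²(ℝ)`, as a real linear map. -/
def conjL2 : L2R →L[ℝ] L2R := (Complex.conjCLE : ℂ →L[ℝ] ℂ).compLpL 2 volume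

lemma coeFn_conjL2 (h : L2R) : conjL2 h =ᵐ[volume] fun t => conj (h t) := by
  filter_upwards [ContinuousLinearMap.coeFn_compLpL (𝕜' := ℝ) (Complex.conjCLE : ℂ →L[ℝ] ℂ) h] with t ht
  rw [conjL2, ht]; simp

lemma conjL2_smul (c : ℂ) (h : L2R) : conjL2 (c • h) = conj c • conjL2 h := by
  ext1
  filter_upwards [coeFn_conjL2 (c • h), coeFn_conjL2 h, Lp.coeFn_smul c h,
    Lp.coeFn_smul (conj c) (conjL2 h)] with t h1 h2 h3 h4
  rw [h1, h3, h4]; simp [h2]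

lemma conjL2_cauchyL2 {w : ℂ} (hw : w.im ≠ 0) :
    conjL2 (cauchyL2 w hw) = cauchyL2 (conj w) (by simpa using hw) := by
  ext1
  filter_upwards [coeFn_conjL2 (cauchyL2 w hw), coeFn_cauchyL2 hw,
    coeFn_cauchyL2 (w := conj w) (by simpa using hw)] with t h1 h2 h3
  rw [h1, h2, h3, conj_cauchyKer]

lemma inner_conjL2 (h g : L2R) : inner ℂ (conjL2 h) g = ∫ t, h t * g t := by
  rw [L2.inner_def]
  refine integral_congr_ae ?_
  filter_upwards [coeFn_conjL2 h] with t ht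
  rw [ht, RCLike.inner_apply]; simp [mul_comm]

lemma inner_cauchyL2 {w : ℂ} (hw : w.im ≠ 0) (h : L2R) :
    inner ℂ (cauchyL2 w hw) h = ∫ t, h t * cauchyKer (conj w) t := by
  rw [L2.inner_def]
  refine integral_congr_ae ?_
  filter_upwards [coeFn_cauchyL2 hw] with t ht
  rw [ht, RCLike.inner_apply, conj_cauchyKer]

lemma integrable_mul_cauchyKer (h : L2R) {w : ℂ} (hw : w.im ≠ 0) :
    Integrable fun t => h t * cauchyKer w t :=
  (Lp.memLp h).integrable_mul (memLp_cauchyKer hw)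

/-- The Cauchy kernels span a dense subspace, because Poisson averages, which are combinations
of them, recover a function almost everywhere. -/
lemma topologicalClosure_span_cauchyL2 :
    (Submodule.span ℂ {f : L2R | ∃ w, ∃ hw : w.im ≠ 0, f = cauchyL2 w hw}).topologicalClosure
      = ⊤ := by
  rw [Submodule.topologicalClosure_eq_top_iff, Submodule.eq_bot_iff]
  intro h hh
  rw [Submodule.mem_orthogonal] at hh
  have h0 : ∀ w : ℂ, w.im ≠ 0 → ∫ t, h t * cauchyKer w t = 0 := by
    intro w hw
    have := hh (cauchyL2 (conj w) (by simpa using hw))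
      (Submodule.subset_span ⟨conj w, by simpa using hw, rfl⟩)
    rwa [inner_cauchyL2, Complex.conj_conj] at this
  rw [Lp.eq_zero_iff_ae_eq_zero]
  filter_upwards [ae_tendsto_integral_poissonKer_norm_sub (Lp.memLp h)] with x hx
  have h1 := tendsto_integral_poissonKer_mul (Lp.memLp h) hx
  have h2 : Tendsto (fun ε => ∫ t, (poissonKer ε (t - x) : ℂ) * h t) (𝓝[>] 0) (𝓝 0) := by
    refine tendsto_const_nhds.congr' ?_
    filter_upwards [self_mem_nhdsWithin] with ε (hε : 0 < ε)
    have e1 : ((x : ℂ) + ε * Complex.I).im ≠ 0 := by simpa using hε.ne'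
    have e2 : ((x : ℂ) - ε * Complex.I).im ≠ 0 := by simpa using hε.ne'
    have e3 := integral_sub (integrable_mul_cauchyKer h e1) (integrable_mul_cauchyKer h e2)
    rw [h0 _ e1, h0 _ e2, sub_zero] at e3
    have e4 : ∫ t, (2 * Complex.I) * ((poissonKer ε (t - x) : ℂ) * h t) = 0 := by
      rw [← e3]
      congr 1; ext t
      rw [← mul_sub, cauchyKer_sub_conj x hε]; ring
    rw [integral_const_mul] at e4
    have e5 : ∫ t, (poissonKer ε (t - x) : ℂ) * h t = 0 := by simpa using e4
    exact e5.symm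
  simpa [Real.pi_ne_zero] using tendsto_nhds_unique h1 h2

/-! ### The Hilbert transform on `L²(ℝ)` -/

/-- The closed span of the Cauchy kernels with poles in the upper half-plane. It is the Hardy
space of the lower half-plane. -/
def hardyLower : Submodule ℂ L2R :=
  (Submodule.span ℂ {f : L2R | ∃ w, ∃ hw : w.im ≠ 0, 0 < w.im ∧ f = cauchyL2 w hw}).topologicalClosure

instance : CompleteSpace hardyLower :=
  (Submodule.isClosed_topologicalClosure _).completeSpace_coe

/-- The operator `h ↦ p.v. ∫ h(t) / (t - x) dt` on `L²(ℝ)`, encoded as `iπ (1 - 2 P)` with `P` the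
orthogonal projection onto the Hardy space of the lower half-plane. That it is given by the
principal value is `ae_hasPV_hilbertT`. -/
def hilbertT : L2R →L[ℂ] L2R :=
  (Real.pi * Complex.I : ℂ) • ((1 : L2R →L[ℂ] L2R) - (2 : ℂ) • hardyLower.starProjection)

lemma hilbertT_cauchyL2_of_pos {w : ℂ} (hw : 0 < w.im) :
    hilbertT (cauchyL2 w hw.ne') = -(Real.pi * Complex.I : ℂ) • cauchyL2 w hw.ne' := by
  have h1 : cauchyL2 w hw.ne' ∈ hardyLower :=
    Submodule.le_topologicalClosure _ (Submodule.subset_span ⟨w, hw.ne', hw, rfl⟩)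
  simp only [hilbertT, smul_apply, sub_apply, one_apply_eq_self, Submodule.starProjection_eq_self_iff.mpr h1]
  module

lemma hilbertT_cauchyL2_of_neg {w : ℂ} (hw : w.im < 0) :
    hilbertT (cauchyL2 w hw.ne) = (Real.pi * Complex.I : ℂ) • cauchyL2 w hw.ne := by
  have h1 : cauchyL2 w hw.ne ∈ hardyLowerᗮ := by
    rw [hardyLower, Submodule.orthogonal_closure, Submodule.mem_orthogonal]
    intro u hu
    induction hu using Submodule.span_induction with
    | mem u hu =>
      obtain ⟨p, hp, hp0, rfl⟩ := hu
      rw [inner_cauchyL2, ← integral_cauchyKer_mul_cauchyKer (p := w) (q := conj p)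
        (by simpa using mul_pos_of_neg_of_neg hw (neg_neg_of_pos hp0))]
      refine integral_congr_ae ?_
      filter_upwards [coeFn_cauchyL2 hw.ne] with t ht
      rw [ht]
    | zero => simp
    | add u v _ _ hu hv => rw [inner_add_left, hu, hv, add_zero]
    | smul c u _ hu => rw [inner_smul_left, hu, mul_zero]
  have h2 : hardyLower.starProjection (cauchyL2 w hw.ne) = 0 :=
    (Submodule.starProjection_apply_eq_zero_iff _).mpr h1
  simp only [hilbertT, smul_apply, sub_apply, one_apply_eq_self, h2]
  module

lemma adjoint_hilbertT : ContinuousLinearMap.adjoint hilbertT = -hilbertT := by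
  have h1 : star (hardyLower.starProjection) = hardyLower.starProjection :=
    (isSelfAdjoint_starProjection hardyLower).star_eq
  rw [← ContinuousLinearMap.star_eq_adjoint, hilbertT, star_smul, star_sub, star_smul, h1, star_one]
  simp

lemma hilbertT_conjL2 (h : L2R) : hilbertT (conjL2 h) = conjL2 (hilbertT h) := by
  let W : Submodule ℂ L2R :=
    { carrier := {h | hilbertT (conjL2 h) = conjL2 (hilbertT h)}
      add_mem' := fun {x y} hx hy => by
        simp only [Set.mem_ofPred_eq] at *
        simp only [map_add, hx, hy]
      zero_mem' := by simp
      smul_mem' := fun c x hx => by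
        simp only [Set.mem_ofPred_eq] at *
        simp only [map_smul, conjL2_smul, hx] }
  have hcl : IsClosed (W : Set L2R) :=
    isClosed_eq (by fun_prop) (by fun_prop)
  have hle : (Submodule.span ℂ {f : L2R | ∃ w, ∃ hw : w.im ≠ 0, f = cauchyL2 w hw}) ≤ W := by
    rw [Submodule.span_le]
    rintro f ⟨w, hw, rfl⟩
    change hilbertT (conjL2 _) = conjL2 (hilbertT _)
    rw [conjL2_cauchyL2]
    rcases lt_or_gt_of_ne hw with h | h
    · rw [hilbertT_cauchyL2_of_neg h, hilbertT_cauchyL2_of_pos (by simpa using h), conjL2_smul,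
        conjL2_cauchyL2]
      simp
    · rw [hilbertT_cauchyL2_of_pos h, hilbertT_cauchyL2_of_neg (by simpa using h), conjL2_smul,
        conjL2_cauchyL2]
      simp
  have := Submodule.topologicalClosure_minimal _ hle hcl
  rw [topologicalClosure_span_cauchyL2] at this
  exact this (Submodule.mem_top (x := h))

lemma integral_hilbertT_mul (h g : L2R) :
    ∫ t, hilbertT h t * g t = -∫ t, h t * hilbertT g t := by
  rw [← inner_conjL2, ← inner_conjL2, ← hilbertT_conjL2, ← ContinuousLinearMap.adjoint_inner_right,
    adjoint_hilbertT]
  simp [inner_neg_right]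

/-- The Cauchy transform `w ↦ ∫ h(t) / (t - w) dt`. -/
def cauchyT (h : ℝ → ℂ) (w : ℂ) : ℂ := ∫ t, h t * cauchyKer w t

lemma integral_hilbertT_mul_cauchyKer_of_pos (h : L2R) {w : ℂ} (hw : 0 < w.im) :
    ∫ t, hilbertT h t * cauchyKer w t = Real.pi * Complex.I * cauchyT h w := by
  have h1 := integral_hilbertT_mul h (cauchyL2 w hw.ne')
  rw [hilbertT_cauchyL2_of_pos hw] at h1
  rw [cauchyT, ← integral_const_mul]
  refine (Eq.trans (integral_congr_ae ?_) h1).trans ?_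
  · filter_upwards [coeFn_cauchyL2 hw.ne'] with t ht; rw [ht]
  · rw [← integral_neg]
    refine integral_congr_ae ?_
    filter_upwards [coeFn_cauchyL2 hw.ne', Lp.coeFn_smul (-(Real.pi * Complex.I : ℂ))
      (cauchyL2 w hw.ne')] with t ht ht2
    rw [ht2]; simp [ht]; ring

lemma integral_hilbertT_mul_cauchyKer_of_neg (h : L2R) {w : ℂ} (hw : w.im < 0) :
    ∫ t, hilbertT h t * cauchyKer w t = -(Real.pi * Complex.I * cauchyT h w) := by
  have h1 := integral_hilbertT_mul h (cauchyL2 w hw.ne)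
  rw [hilbertT_cauchyL2_of_neg hw] at h1
  rw [cauchyT, ← integral_const_mul]
  refine (Eq.trans (integral_congr_ae ?_) h1).trans ?_
  · filter_upwards [coeFn_cauchyL2 hw.ne] with t ht; rw [ht]
  · congr 1
    refine integral_congr_ae ?_
    filter_upwards [coeFn_cauchyL2 hw.ne, Lp.coeFn_smul ((Real.pi * Complex.I : ℂ))
      (cauchyL2 w hw.ne)] with t ht ht2
    rw [ht2]; simp [ht]; ring

lemma cauchyT_sub_cauchyT (h : L2R) (x : ℝ) {ε : ℝ} (hε : 0 < ε) :
    cauchyT h (x + ε * Complex.I) - cauchyT h (x - ε * Complex.I) =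
      2 * Complex.I * ∫ t, (poissonKer ε (t - x) : ℂ) * h t := by
  have e1 : ((x : ℂ) + ε * Complex.I).im ≠ 0 := by simpa using hε.ne'
  have e2 : ((x : ℂ) - ε * Complex.I).im ≠ 0 := by simpa using hε.ne'
  rw [cauchyT, cauchyT, ← integral_sub (integrable_mul_cauchyKer h e1)
    (integrable_mul_cauchyKer h e2), ← integral_const_mul]
  congr 1; ext t
  rw [← mul_sub, cauchyKer_sub_conj x hε]; ring

/-- Boundary values of the Cauchy transform: at almost every point the limits from the upper and
the lower half-plane are `T h ± iπ h`. Indeed both sides of the line see the Cauchy transform as the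
Poisson extension of its boundary function. -/
theorem ae_tendsto_cauchyT (h : L2R) : ∀ᵐ x : ℝ,
    Tendsto (fun ε : ℝ => cauchyT h (x + ε * Complex.I)) (𝓝[>] 0)
      (𝓝 (hilbertT h x + Real.pi * Complex.I * h x)) ∧
    Tendsto (fun ε : ℝ => cauchyT h (x - ε * Complex.I)) (𝓝[>] 0)
      (𝓝 (hilbertT h x - Real.pi * Complex.I * h x)) := by
  filter_upwards [ae_tendsto_integral_poissonKer_norm_sub (Lp.memLp h),
    ae_tendsto_integral_poissonKer_norm_sub (Lp.memLp (hilbertT h))] with x hx hTx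
  have h1 := tendsto_integral_poissonKer_mul (Lp.memLp h) hx
  have h2 := tendsto_integral_poissonKer_mul (Lp.memLp _) hTx
  have key : ∀ ε : ℝ, 0 < ε →
      cauchyT h (x + ε * Complex.I) = (Real.pi : ℂ)⁻¹ * (∫ t, (poissonKer ε (t - x) : ℂ) * hilbertT h t)
        + Complex.I * ∫ t, (poissonKer ε (t - x) : ℂ) * h t ∧
      cauchyT h (x - ε * Complex.I) = (Real.pi : ℂ)⁻¹ * (∫ t, (poissonKer ε (t - x) : ℂ) * hilbertT h t)
        - Complex.I * ∫ t, (poissonKer ε (t - x) : ℂ) * h t := by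
    intro ε hε
    have e1 : 0 < ((x : ℂ) + ε * Complex.I).im := by simpa using hε
    have e2 : ((x : ℂ) - ε * Complex.I).im < 0 := by simpa using hε
    have a1 := cauchyT_sub_cauchyT h x hε
    have a2 := cauchyT_sub_cauchyT (hilbertT h) x hε
    have a3 := integral_hilbertT_mul_cauchyKer_of_pos h e1
    have a4 := integral_hilbertT_mul_cauchyKer_of_neg h e2
    change cauchyT (hilbertT h) _ = _ at a3 a4
    rw [a3, a4] at a2
    have hpi : (Real.pi : ℂ) ≠ 0 := by exact_mod_cast Real.pi_ne_zero
    have a5 : cauchyT h (x + ε * Complex.I) + cauchyT h (x - ε * Complex.I) =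
        2 * ((Real.pi : ℂ)⁻¹ * ∫ t, (poissonKer ε (t - x) : ℂ) * hilbertT h t) := by
      have : Complex.I * (Real.pi * (cauchyT h (x + ε * Complex.I) + cauchyT h (x - ε * Complex.I)))
          = Complex.I * (2 * ∫ t, (poissonKer ε (t - x) : ℂ) * hilbertT h t) := by
        linear_combination a2
      have := mul_left_cancel₀ Complex.I_ne_zero this
      field_simp
      linear_combination this
    constructor
    · linear_combination (a1 + a5) / 2
    · linear_combination (a5 - a1) / 2
  have hpi : (Real.pi : ℂ) ≠ 0 := by exact_mod_cast Real.pi_ne_zero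
  constructor
  · have h3 := (h2.const_mul (Real.pi : ℂ)⁻¹).add (h1.const_mul Complex.I)
    rw [inv_mul_cancel_left₀ hpi, ← mul_assoc, mul_comm Complex.I] at h3
    refine h3.congr' ?_
    filter_upwards [self_mem_nhdsWithin] with ε hε using (key ε hε).1.symm
  · have h3 := (h2.const_mul (Real.pi : ℂ)⁻¹).sub (h1.const_mul Complex.I)
    rw [inv_mul_cancel_left₀ hpi, ← mul_assoc, mul_comm Complex.I] at h3
    refine h3.congr' ?_
    filter_upwards [self_mem_nhdsWithin] with ε hε using (key ε hε).2.symm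

/-! ### Principal values -/

lemma measurableSet_lt_abs_sub (ε x : ℝ) : MeasurableSet {t : ℝ | ε < |t - x|} :=
  measurableSet_lt measurable_const (by fun_prop)

lemma HasPV.unique {μ : Measure ℝ} {g : ℝ → ℂ} {x : ℝ} {p q : ℂ} (hp : HasPV μ g x p)
    (hq : HasPV μ g x q) : p = q :=
  tendsto_nhds_unique hp.2 hq.2

lemma HasPV.congr_ae {μ : Measure ℝ} {g g' : ℝ → ℂ} {x : ℝ} {p : ℂ} (hp : HasPV μ g x p)
    (h : g =ᵐ[μ] g') : HasPV μ g' x p := by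
  refine ⟨fun ε hε => (hp.1 ε hε).congr (ae_restrict_of_ae h), hp.2.congr fun ε => ?_⟩
  exact integral_congr_ae (ae_restrict_of_ae h)

lemma HasPV.const_mul {μ : Measure ℝ} {g : ℝ → ℂ} {x : ℝ} {p : ℂ} (hp : HasPV μ g x p) (c : ℂ) :
    HasPV μ (fun t => c * g t) x (c * p) := by
  refine ⟨fun ε hε => (hp.1 ε hε).const_mul c, (hp.2.const_mul c).congr fun ε => ?_⟩
  rw [integral_const_mul]

lemma HasPV.sub {μ : Measure ℝ} {g g' : ℝ → ℂ} {x : ℝ} {p q : ℂ} (hp : HasPV μ g x p)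
    (hq : HasPV μ g' x q) : HasPV μ (fun t => g t - g' t) x (p - q) := by
  refine ⟨fun ε hε => (hp.1 ε hε).sub (hq.1 ε hε), (hp.2.sub hq.2).congr' ?_⟩
  filter_upwards [self_mem_nhdsWithin] with ε hε
  rw [integral_sub (hp.1 ε hε) (hq.1 ε hε)]

/-- The principal value of an integrable function is its integral. -/
lemma HasPV.of_integrable {μ : Measure ℝ} [NullSingletonClass μ] {g : ℝ → ℂ} (hg : Integrable g μ) (x : ℝ) :
    HasPV μ g x (∫ t, g t ∂μ) := by
  refine ⟨fun ε _ => hg.integrableOn, ?_⟩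
  simp_rw [← integral_indicator (measurableSet_lt_abs_sub _ x)]
  refine tendsto_integral_filter_of_dominated_convergence (fun t => ‖g t‖)
    (Eventually.of_forall fun ε => hg.1.indicator (measurableSet_lt_abs_sub ε x))
    (Eventually.of_forall fun ε => ae_of_all _ fun t => norm_indicator_le_norm_self _ _) hg.norm ?_
  have hne : ∀ᵐ t ∂μ, t ≠ x := by simp [ae_iff, measure_singleton]
  filter_upwards [hne] with t ht
  refine tendsto_const_nhds.congr' ?_
  have : 0 < |t - x| := abs_pos.mpr (sub_ne_zero.mpr ht)
  filter_upwards [nhdsWithin_le_nhds (Iio_mem_nhds this)] with ε hε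
  rw [Set.indicator_of_mem]
  exact hε

lemma hasPV_restrict_iff {s : Set ℝ} (hs : MeasurableSet s) {g : ℝ → ℂ} {x : ℝ} {p : ℂ} :
    HasPV (volume.restrict s) g x p ↔ HasPV volume (s.indicator g) x p := by
  unfold HasPV
  refine and_congr (forall₂_congr fun ε _ => ?_) ?_
  · rw [IntegrableOn, IntegrableOn, Measure.restrict_restrict (measurableSet_lt_abs_sub ε x),
      integrable_indicator_iff hs, IntegrableOn, Measure.restrict_restrict hs, Set.inter_comm]
  · refine tendsto_congr fun ε => ?_
    rw [Measure.restrict_restrict (measurableSet_lt_abs_sub ε x), setIntegral_indicator hs]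

/-- Multiplication of a singular integral by a Cauchy kernel, from the partial fraction
`1 / ((t - w) (t - x)) = (1 / (x - w)) (1 / (t - x) - 1 / (t - w))`. -/
lemma HasPV.mul_cauchyKer {h : ℝ → ℂ} {x : ℝ} {p w : ℂ}
    (hp : HasPV volume (fun t => h t / ((t : ℂ) - x)) x p)
    (hint : Integrable fun t => h t * cauchyKer w t) (hxw : (x : ℂ) ≠ w) :
    HasPV volume (fun t => h t * cauchyKer w t / ((t : ℂ) - x)) x
      (cauchyKer w x * (p - cauchyT h w)) := by
  refine ((hp.sub (HasPV.of_integrable hint x)).const_mul (cauchyKer w x)).congr_ae ?_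
  have h1 : ∀ᵐ t : ℝ, t ≠ x := by simp [ae_iff, measure_singleton]
  have h2 : ∀ᵐ t : ℝ, t ≠ w.re := by simp [ae_iff, measure_singleton]
  filter_upwards [h1, h2] with t ht ht2
  have e1 : (t : ℂ) - x ≠ 0 := sub_ne_zero.mpr (by exact_mod_cast ht)
  have e2 : (t : ℂ) - w ≠ 0 := sub_ne_zero.mpr (fun h => ht2 (by simp [← h]))
  have e3 : (x : ℂ) - w ≠ 0 := sub_ne_zero.mpr hxw
  simp only [cauchyKer]
  field_simp
  ring

/-- The difference between the kernel `1 / s` truncated at `ε` and the conjugate Poisson kernel. -/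
def truncKer (ε s : ℝ) : ℝ := (if ε < |s| then s⁻¹ else 0) - s / (s ^ 2 + ε ^ 2)

lemma truncKer_neg (ε s : ℝ) : truncKer ε (-s) = -truncKer ε s := by
  unfold truncKer
  rw [abs_neg, neg_sq]
  split_ifs <;> ring

lemma abs_truncKer_le {ε : ℝ} (hε : 0 < ε) (s : ℝ) : |truncKer ε s| ≤ poissonKer ε s := by
  unfold truncKer poissonKer
  have hpos : 0 < s ^ 2 + ε ^ 2 := by positivity
  split_ifs with h
  · have hs : 0 < |s| := hε.trans h
    have hs0 : s ≠ 0 := abs_pos.mp hs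
    have e : s⁻¹ - s / (s ^ 2 + ε ^ 2) = ε ^ 2 / (s * (s ^ 2 + ε ^ 2)) := by field_simp; ring
    rw [e, abs_div, abs_mul, abs_of_pos hpos, abs_of_pos (by positivity : 0 < ε ^ 2),
      div_le_div_iff₀ (by positivity) hpos]
    have : ε ^ 2 ≤ ε * |s| := by nlinarith
    nlinarith [mul_le_mul_of_nonneg_right this hpos.le]
  · rw [zero_sub, abs_neg, abs_div, abs_of_pos hpos]
    gcongr
    exact not_lt.mp h

lemma measurable_truncKer (ε : ℝ) : Measurable (truncKer ε) := by
  unfold truncKer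
  exact (Measurable.ite (measurableSet_lt measurable_const (by fun_prop)) measurable_inv
    measurable_const).sub (by fun_prop)

lemma integral_truncKer (ε : ℝ) : ∫ s, truncKer ε s = 0 := by
  have h := integral_neg_eq_self (truncKer ε) volume
  simp_rw [truncKer_neg, integral_neg] at h
  linarith

/-- The Hilbert transform is given by the principal value almost everywhere. The truncated
integral differs from the mean of the two boundary approximations by an average against an odd kernel
dominated by the Poisson kernel, which vanishes in the limit at Lebesgue points. -/
theorem ae_hasPV_hilbertT (h : L2R) :
    ∀ᵐ x : ℝ, HasPV volume (fun t => h t / ((t : ℂ) - x)) x (hilbertT h x) := by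
  filter_upwards [ae_tendsto_integral_poissonKer_norm_sub (Lp.memLp h), ae_tendsto_cauchyT h]
    with x hx hB
  have hK : ∀ ε : ℝ, 0 < ε → Integrable fun t => (truncKer ε (t - x) : ℂ) := fun ε hε =>
    (((integrable_poissonKer hε).comp_sub_right x).mono'
      ((measurable_truncKer ε).comp (measurable_sub_const x)).aestronglyMeasurable
      (ae_of_all _ fun t => abs_truncKer_le hε _)).ofReal
  have hKh : ∀ ε : ℝ, 0 < ε → Integrable fun t => (truncKer ε (t - x) : ℂ) * h t := by
    intro ε hε
    refine (integrable_poissonKer_mul (Lp.memLp h) hε x).mono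
      (((Complex.measurable_ofReal.comp ((measurable_truncKer ε).comp
        (measurable_sub_const x))).aestronglyMeasurable).mul (Lp.memLp h).1)
      (ae_of_all _ fun t => ?_)
    rw [norm_mul, norm_mul, Complex.norm_real, Complex.norm_real]
    gcongr
    rw [Real.norm_of_nonneg (poissonKer_nonneg hε _)]
    exact abs_truncKer_le hε _
  have him : ∀ ε : ℝ, 0 < ε → ((x : ℂ) + ε * Complex.I).im ≠ 0 ∧
      ((x : ℂ) - ε * Complex.I).im ≠ 0 := fun ε hε => by
    constructor <;> simpa using hε.ne'
  have hsplit : ∀ ε : ℝ, 0 < ε → ∀ t : ℝ,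
      {t : ℝ | ε < |t - x|}.indicator (fun t => h t / ((t : ℂ) - x)) t =
        (truncKer ε (t - x) : ℂ) * h t + 2⁻¹ * (h t * cauchyKer (x + ε * Complex.I) t +
          h t * cauchyKer (x - ε * Complex.I) t) := by
    intro ε hε t
    rw [← mul_add, cauchyKer_add_conj x hε, Set.indicator_apply]
    simp only [truncKer, Set.mem_ofPred_eq]
    split_ifs with hlt
    · push_cast; ring
    · push_cast; ring
  have hint2 : ∀ ε : ℝ, 0 < ε → Integrable fun t => (2 : ℂ)⁻¹ *
      (h t * cauchyKer (x + ε * Complex.I) t + h t * cauchyKer (x - ε * Complex.I) t) :=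
    fun ε hε => ((integrable_mul_cauchyKer h (him ε hε).1).add
      (integrable_mul_cauchyKer h (him ε hε).2)).const_mul _
  refine ⟨fun ε hε => ?_, ?_⟩
  · rw [← integrable_indicator_iff (measurableSet_lt_abs_sub ε x)]
    exact ((hKh ε hε).add (hint2 ε hε)).congr (ae_of_all _ fun t => (hsplit ε hε t).symm)
  · have hlim0 : Tendsto (fun ε => ∫ t, (truncKer ε (t - x) : ℂ) * h t) (𝓝[>] 0) (𝓝 0) := by
      rw [tendsto_zero_iff_norm_tendsto_zero]
      refine squeeze_zero' (Eventually.of_forall fun _ => norm_nonneg _) ?_ hx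
      filter_upwards [self_mem_nhdsWithin] with ε (hε : 0 < ε)
      have h0 : ∫ t, (truncKer ε (t - x) : ℂ) * h x = 0 := by
        rw [integral_mul_const, integral_complex_ofReal,
          integral_sub_right_eq_self (truncKer ε) x, integral_truncKer]
        simp
      rw [← sub_zero (∫ t, (truncKer ε (t - x) : ℂ) * h t), ← h0,
        ← integral_sub (hKh ε hε) ((hK ε hε).mul_const _)]
      refine (norm_integral_le_integral_norm _).trans ?_
      refine integral_mono_of_nonneg (ae_of_all _ fun t => norm_nonneg _)
        (integrable_poissonKer_mul_norm_sub (Lp.memLp h) hε x (h x)) (ae_of_all _ fun t => ?_)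
      simp only
      rw [← mul_sub, norm_mul, Complex.norm_real]
      gcongr
      exact abs_truncKer_le hε _
    have hlim := hlim0.add ((hB.1.add hB.2).const_mul (2 : ℂ)⁻¹)
    rw [show (0 : ℂ) + 2⁻¹ * (hilbertT h x + Real.pi * Complex.I * h x +
      (hilbertT h x - Real.pi * Complex.I * h x)) = hilbertT h x by ring] at hlim
    refine hlim.congr' ?_
    filter_upwards [self_mem_nhdsWithin] with ε (hε : 0 < ε)
    rw [← integral_indicator (measurableSet_lt_abs_sub ε x),
      integral_congr_ae (ae_of_all _ (hsplit ε hε)), integral_add (hKh ε hε) (hint2 ε hε),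
      integral_const_mul, integral_add (integrable_mul_cauchyKer h (him ε hε).1)
        (integrable_mul_cauchyKer h (him ε hε).2)]
    rfl

lemma memLp_mul_cauchyKer (h : L2R) {w : ℂ} (hw : w.im ≠ 0) :
    MemLp (fun t => h t * cauchyKer w t) 2 volume := by
  refine ((Lp.memLp h).const_mul ((|w.im|⁻¹ : ℝ) : ℂ)).mono
    ((Lp.memLp h).1.mul (continuous_cauchyKer hw).aestronglyMeasurable) (ae_of_all _ fun t => ?_)
  rw [norm_mul, norm_mul, mul_comm]
  gcongr
  simpa using norm_cauchyKer_le hw t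

/-- The identity `∫ (h₁ T h₂ + h₂ T h₁) / (t - w) dt = F₁(w) F₂(w)` for the Cauchy transforms
`F₁`, `F₂`. It says that the product of two Cauchy transforms is the Cauchy transform of the jump of
its boundary values. -/
theorem integral_hilbertT_product (h₁ h₂ : L2R) {w : ℂ} (hw : w.im ≠ 0) :
    (Integrable fun t => (h₁ t * hilbertT h₂ t + h₂ t * hilbertT h₁ t) * cauchyKer w t) ∧
    ∫ t, (h₁ t * hilbertT h₂ t + h₂ t * hilbertT h₁ t) * cauchyKer w t =
      cauchyT h₁ w * cauchyT h₂ w := by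
  set g : L2R := (memLp_mul_cauchyKer h₁ hw).toLp _ with hg
  have hgc : g =ᵐ[volume] fun t => h₁ t * cauchyKer w t := MemLp.coeFn_toLp _
  have hTg : hilbertT g =ᵐ[volume] fun t => cauchyKer w t * (hilbertT h₁ t - cauchyT h₁ w) := by
    filter_upwards [ae_hasPV_hilbertT g, ae_hasPV_hilbertT h₁] with x h1 h2
    have h3 := h2.mul_cauchyKer (integrable_mul_cauchyKer h₁ hw)
      (sub_ne_zero.mp (ofReal_sub_ne_zero hw x))
    refine h1.unique (h3.congr_ae ?_)
    filter_upwards [hgc] with t ht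
    rw [ht]
  have i1 : Integrable fun t => hilbertT h₂ t * g t :=
    (Lp.memLp (hilbertT h₂)).integrable_mul (Lp.memLp g)
  have i2 : Integrable fun t => h₂ t * hilbertT g t :=
    (Lp.memLp h₂).integrable_mul (Lp.memLp (hilbertT g))
  have i12 : Integrable fun t => hilbertT h₂ t * g t + h₂ t * hilbertT g t := i1.add i2
  have i3 := (integrable_mul_cauchyKer h₂ hw).const_mul (cauchyT h₁ w)
  have hcongr : (fun t => hilbertT h₂ t * g t + h₂ t * hilbertT g t +
      cauchyT h₁ w * (h₂ t * cauchyKer w t)) =ᵐ[volume]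
      fun t => (h₁ t * hilbertT h₂ t + h₂ t * hilbertT h₁ t) * cauchyKer w t := by
    filter_upwards [hgc, hTg] with t h1 h2
    rw [h1, h2]; ring
  refine ⟨(i12.add i3).congr hcongr, ?_⟩
  rw [← integral_congr_ae hcongr, integral_add i12 i3, integral_add i1 i2,
    integral_hilbertT_mul, integral_const_mul]
  simp [cauchyT]

/-! ### Operators on `L²(a, b)` -/

lemma norm_sq_eq_integral {μ : Measure ℝ} (f : Lp ℂ 2 μ) : ‖f‖ ^ 2 = ∫ t, ‖f t‖ ^ 2 ∂μ := by
  have h : ((‖f‖ ^ 2 : ℝ) : ℂ) = ((∫ t, ‖f t‖ ^ 2 ∂μ : ℝ) : ℂ) := by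
    have h1 := inner_self_eq_norm_sq_to_K (𝕜 := ℂ) f
    rw [L2.inner_def] at h1
    rw [← integral_complex_ofReal]
    push_cast
    refine Eq.trans h1.symm (integral_congr_ae (ae_of_all _ fun t => ?_))
    simp only
    rw [inner_self_eq_norm_sq_to_K]; simp
  exact_mod_cast h

/-- Multiplication by an essentially bounded function on `L²(a, b)`. -/
def mulOp {a b : ℝ} (m : ℝ → ℂ) (hm : MemLp m ⊤ (lebIcc a b)) : L2Icc a b →L[ℂ] L2Icc a b :=
  (ContinuousLinearMap.mul ℂ ℂ).holderL (lebIcc a b) ⊤ 2 2 (hm.toLp m)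

lemma coeFn_mulOp {a b : ℝ} {m : ℝ → ℂ} (hm : MemLp m ⊤ (lebIcc a b)) (f : L2Icc a b) :
    mulOp m hm f =ᵐ[lebIcc a b] fun t => m t * f t := by
  have h := (ContinuousLinearMap.mul ℂ ℂ).coeFn_holder (r := 2) (hm.toLp m) f
  filter_upwards [h, hm.coeFn_toLp] with t h1 h2
  change ((ContinuousLinearMap.mul ℂ ℂ).holder 2 (hm.toLp m) f) t = _
  rw [h1, h2]; simp

lemma adjoint_mulOp {a b : ℝ} {m : ℝ → ℂ} (hm : MemLp m ⊤ (lebIcc a b))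
    (hm' : MemLp (fun t => conj (m t)) ⊤ (lebIcc a b)) :
    ContinuousLinearMap.adjoint (mulOp m hm) = mulOp _ hm' := by
  symm
  rw [ContinuousLinearMap.eq_adjoint_iff]
  intro f g
  rw [L2.inner_def, L2.inner_def]
  refine integral_congr_ae ?_
  filter_upwards [coeFn_mulOp hm g, coeFn_mulOp hm' f] with t h1 h2
  rw [h1, h2, RCLike.inner_apply, RCLike.inner_apply]
  simp; ring

lemma memLp_top_conj {μ : Measure ℝ} {m : ℝ → ℂ} (hm : MemLp m ⊤ μ) :
    MemLp (fun t => conj (m t)) ⊤ μ := hm.star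

lemma memLp_top_ofReal_id {a b : ℝ} : MemLp (fun t : ℝ => (t : ℂ)) ⊤ (lebIcc a b) := by
  refine memLp_top_of_bound (by fun_prop) (max |a| |b|) ?_
  filter_upwards [ae_restrict_mem measurableSet_Icc] with t ht
  rw [Complex.norm_real]
  exact abs_le_max_abs_abs ht.1 ht.2

/-- Restriction of functions from `ℝ` to `[a, b]`. -/
def restrOp (a b : ℝ) : L2R →L[ℂ] L2Icc a b := LpToLpRestrictCLM ℝ ℂ ℂ volume 2 (Set.Icc a b)

lemma coeFn_restrOp {a b : ℝ} (h : L2R) : restrOp a b h =ᵐ[lebIcc a b] h :=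
  LpToLpRestrictCLM_coeFn ℂ _ h

/-- Extension by zero from `[a, b]` to `ℝ`, encoded as the adjoint of the restriction. -/
def extOp (a b : ℝ) : L2Icc a b →L[ℂ] L2R := ContinuousLinearMap.adjoint (restrOp a b)

lemma coeFn_extOp {a b : ℝ} (f : L2Icc a b) :
    extOp a b f =ᵐ[volume] (Set.Icc a b).indicator f := by
  have hm : MemLp ((Set.Icc a b).indicator f) 2 volume :=
    (memLp_indicator_iff_restrict measurableSet_Icc).mpr (Lp.memLp f)
  suffices extOp a b f = hm.toLp _ by rw [this]; exact hm.coeFn_toLp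
  refine ext_inner_right ℂ fun g => ?_
  rw [extOp, ContinuousLinearMap.adjoint_inner_left, L2.inner_def, L2.inner_def,
    ← integral_indicator measurableSet_Icc]
  have h1 : ∀ᵐ t : ℝ, t ∈ Set.Icc a b → restrOp a b g t = g t :=
    (ae_restrict_iff' measurableSet_Icc).mp (coeFn_restrOp g)
  refine integral_congr_ae ?_
  filter_upwards [h1, hm.coeFn_toLp] with t h1 h2
  rw [h2]
  by_cases ht : t ∈ Set.Icc a b
  · simp [ht, h1 ht]
  · simp [ht]

lemma restrOp_extOp {a b : ℝ} (f : L2Icc a b) : restrOp a b (extOp a b f) = f := by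
  ext1
  filter_upwards [coeFn_restrOp (a := a) (b := b) (extOp a b f),
    ae_restrict_of_ae (s := Set.Icc a b) (coeFn_extOp f),
    ae_restrict_mem measurableSet_Icc] with t h1 h2 ht
  rw [h1, h2, Set.indicator_of_mem ht]

/-- The operator `f ↦ conj(v) f` from `L²(a, b)` to `L²(ℝ)`, extension by zero included. -/
def weightOp {a b : ℝ} (v : ℝ → ℂ) (hv : MemLp v ⊤ (lebIcc a b)) : L2Icc a b →L[ℂ] L2R :=
  (extOp a b).comp (mulOp _ (memLp_top_conj hv))

lemma coeFn_weightOp {a b : ℝ} {v : ℝ → ℂ} (hv : MemLp v ⊤ (lebIcc a b)) (f : L2Icc a b) :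
    weightOp v hv f =ᵐ[volume] (Set.Icc a b).indicator fun t => f t * conj (v t) := by
  have h1 : ∀ᵐ t : ℝ, t ∈ Set.Icc a b → mulOp _ (memLp_top_conj hv) f t = conj (v t) * f t :=
    (ae_restrict_iff' measurableSet_Icc).mp (coeFn_mulOp _ f)
  filter_upwards [coeFn_extOp (mulOp _ (memLp_top_conj hv) f), h1] with t h2 h1
  rw [weightOp, ContinuousLinearMap.comp_apply, h2]
  by_cases ht : t ∈ Set.Icc a b
  · simp [ht, h1 ht, mul_comm]
  · simp [ht]

lemma adjoint_weightOp {a b : ℝ} {v : ℝ → ℂ} (hv : MemLp v ⊤ (lebIcc a b)) :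
    ContinuousLinearMap.adjoint (weightOp v hv) = (mulOp v hv).comp (restrOp a b) := by
  rw [weightOp, ContinuousLinearMap.adjoint_comp, extOp, ContinuousLinearMap.adjoint_adjoint,
    adjoint_mulOp (memLp_top_conj hv) (by simpa using hv)]
  simp

lemma coeFn_adjoint_weightOp {a b : ℝ} {v : ℝ → ℂ} (hv : MemLp v ⊤ (lebIcc a b)) (g : L2R) :
    ContinuousLinearMap.adjoint (weightOp v hv) g =ᵐ[lebIcc a b] fun t => v t * g t := by
  rw [adjoint_weightOp, ContinuousLinearMap.comp_apply]
  filter_upwards [coeFn_mulOp hv (restrOp a b g), coeFn_restrOp (a := a) (b := b) g] with t h1 h2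
  rw [h1, h2]

lemma integrable_weightOp {a b : ℝ} {v : ℝ → ℂ} (hv : MemLp v ⊤ (lebIcc a b)) (f : L2Icc a b) :
    Integrable (weightOp v hv f) volume := by
  rw [integrable_congr (coeFn_weightOp hv f), integrable_indicator_iff measurableSet_Icc]
  exact (Lp.memLp f).integrable_mul (q := 2) ((memLp_top_conj hv).mono_exponent le_top)

/-! ### The model pair -/

lemma memLp_top_add_ofReal {a b : ℝ} {β : ℝ → ℝ} (hβ : MemLp β ⊤ (lebIcc a b)) :
    MemLp (fun t : ℝ => (t : ℂ) + (β t : ℂ)) ⊤ (lebIcc a b) :=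
  memLp_top_ofReal_id.add hβ.ofReal

/-- Multiplication by the independent variable, the first operator of the model pair. -/
def modelX (a b : ℝ) : L2Icc a b →L[ℂ] L2Icc a b := mulOp _ memLp_top_ofReal_id

/-- The second operator of the model pair. -/
def modelY {a b : ℝ} (J : ℝ) (v : ℝ → ℂ) (hv : MemLp v ⊤ (lebIcc a b)) (β : ℝ → ℝ)
    (hβ : MemLp β ⊤ (lebIcc a b)) : L2Icc a b →L[ℂ] L2Icc a b :=
  -mulOp _ (memLp_top_add_ofReal hβ) + (Complex.I * J) •
    (ContinuousLinearMap.adjoint (weightOp v hv)).comp (hilbertT.comp (weightOp v hv))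

lemma coeFn_modelY {a b : ℝ} (J : ℝ) {v : ℝ → ℂ} (hv : MemLp v ⊤ (lebIcc a b)) {β : ℝ → ℝ}
    (hβ : MemLp β ⊤ (lebIcc a b)) (f : L2Icc a b) :
    modelY J v hv β hβ f =ᵐ[lebIcc a b] fun t =>
      -((t : ℂ) + β t) * f t + Complex.I * J * v t * hilbertT (weightOp v hv f) t := by
  have e : modelY J v hv β hβ f = -mulOp _ (memLp_top_add_ofReal hβ) f + (Complex.I * J) •
      ContinuousLinearMap.adjoint (weightOp v hv) (hilbertT (weightOp v hv f)) := rfl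
  rw [e]
  filter_upwards [Lp.coeFn_add (-mulOp _ (memLp_top_add_ofReal hβ) f) ((Complex.I * J) •
      ContinuousLinearMap.adjoint (weightOp v hv) (hilbertT (weightOp v hv f))),
    Lp.coeFn_neg (mulOp _ (memLp_top_add_ofReal hβ) f),
    Lp.coeFn_smul (Complex.I * J)
      (ContinuousLinearMap.adjoint (weightOp v hv) (hilbertT (weightOp v hv f))),
    coeFn_mulOp (memLp_top_add_ofReal hβ) f,
    coeFn_adjoint_weightOp hv (hilbertT (weightOp v hv f))] with t h1 h2 h3 h4 h5
  rw [h1, Pi.add_apply, h2, h3, Pi.neg_apply, Pi.smul_apply, h4, h5, smul_eq_mul]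
  ring

lemma isSelfAdjoint_modelX (a b : ℝ) : IsSelfAdjoint (modelX a b) := by
  rw [ContinuousLinearMap.isSelfAdjoint_iff', modelX,
    adjoint_mulOp memLp_top_ofReal_id (by simpa using memLp_top_ofReal_id)]
  simp

lemma isSelfAdjoint_modelY {a b : ℝ} (J : ℝ) {v : ℝ → ℂ} (hv : MemLp v ⊤ (lebIcc a b)) {β : ℝ → ℝ}
    (hβ : MemLp β ⊤ (lebIcc a b)) : IsSelfAdjoint (modelY J v hv β hβ) := by
  have hM : ContinuousLinearMap.adjoint (mulOp _ (memLp_top_add_ofReal hβ)) =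
      mulOp _ (memLp_top_add_ofReal hβ) := by
    rw [adjoint_mulOp _ (by simpa using memLp_top_add_ofReal hβ)]; simp
  rw [ContinuousLinearMap.isSelfAdjoint_iff', modelY, map_add, map_neg, hM, map_smulₛₗ,
    ContinuousLinearMap.adjoint_comp, ContinuousLinearMap.adjoint_comp,
    ContinuousLinearMap.adjoint_adjoint, adjoint_hilbertT]
  simp [ContinuousLinearMap.comp_neg, ContinuousLinearMap.neg_comp, ContinuousLinearMap.comp_assoc]

theorem isModelPair_model {a b : ℝ} (J : ℝ) {v : ℝ → ℂ} (hv : MemLp v ⊤ (lebIcc a b)) {β : ℝ → ℝ}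
    (hβ : MemLp β ⊤ (lebIcc a b)) :
    IsModelPair a b J v β (modelX a b) (modelY J v hv β hβ) := by
  refine ⟨fun f => coeFn_mulOp _ f, fun f => ?_⟩
  filter_upwards [coeFn_modelY J hv hβ f,
    ae_restrict_of_ae (s := Set.Icc a b) (ae_hasPV_hilbertT (weightOp v hv f))] with x h1 h2
  refine ⟨_, ?_, h1⟩
  rw [hasPV_restrict_iff measurableSet_Icc]
  refine h2.congr_ae ?_
  filter_upwards [coeFn_weightOp hv f] with t ht
  rw [ht]
  by_cases htI : t ∈ Set.Icc a b <;> simp [htI]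

lemma IsModelPair.unique {a b J : ℝ} {v : ℝ → ℂ} {β : ℝ → ℝ} {X Y X' Y' : L2Icc a b →L[ℂ] L2Icc a b}
    (h : IsModelPair a b J v β X Y) (h' : IsModelPair a b J v β X' Y') : X = X' ∧ Y = Y' := by
  constructor
  · ext1 f
    ext1
    filter_upwards [h.1 f, h'.1 f] with x h1 h2
    rw [h1, h2]
  · ext1 f
    ext1
    filter_upwards [h.2 f, h'.2 f] with x ⟨p, hp, h1⟩ ⟨q, hq, h2⟩
    rw [h1, h2, hp.unique hq]

lemma integral_weightOp {a b : ℝ} {v : L2Icc a b} (hv : MemLp v ⊤ (lebIcc a b)) (f : L2Icc a b) :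
    ∫ t, weightOp v hv f t = inner ℂ v f := by
  rw [integral_congr_ae (coeFn_weightOp hv f), integral_indicator measurableSet_Icc, L2.inner_def]
  rfl

/-- The commutator of the model pair has rank at most one. -/
lemma modelY_mul_modelX_sub {a b : ℝ} (J : ℝ) {v : L2Icc a b} (hv : MemLp v ⊤ (lebIcc a b))
    {β : ℝ → ℝ} (hβ : MemLp β ⊤ (lebIcc a b)) (f : L2Icc a b) :
    modelY J v hv β hβ (modelX a b f) - modelX a b (modelY J v hv β hβ f) =
      (Complex.I * J * inner ℂ v f) • v := by
  set h := weightOp v hv f with hh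
  have hXf := coeFn_mulOp (memLp_top_ofReal_id (a := a) (b := b)) f
  have hXf' : ∀ᵐ t : ℝ, t ∈ Set.Icc a b → modelX a b f t = t * f t :=
    (ae_restrict_iff' measurableSet_Icc).mp hXf
  have hT : ∀ᵐ x : ℝ, hilbertT (weightOp v hv (modelX a b f)) x - x * hilbertT h x = inner ℂ v f := by
    filter_upwards [ae_hasPV_hilbertT (weightOp v hv (modelX a b f)), ae_hasPV_hilbertT h]
      with x h1 h2
    have h3 := HasPV.of_integrable (integrable_weightOp hv f) x
    rw [integral_weightOp] at h3
    refine (h1.sub (h2.const_mul x)).unique (h3.congr_ae ?_)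
    have hne : ∀ᵐ t : ℝ, t ≠ x := by simp [ae_iff, measure_singleton]
    filter_upwards [coeFn_weightOp hv f, coeFn_weightOp hv (modelX a b f), hXf', hne]
      with t e1 e2 e3 ht
    have e4 : (t : ℂ) - x ≠ 0 := sub_ne_zero.mpr (by exact_mod_cast ht)
    rw [hh, e1, e2]
    by_cases htI : t ∈ Set.Icc a b
    · simp only [Set.indicator_of_mem htI, e3 htI]
      field_simp
    · simp [htI]
  ext1
  filter_upwards [Lp.coeFn_sub (modelY J v hv β hβ (modelX a b f)) (modelX a b (modelY J v hv β hβ f)),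
    coeFn_modelY J hv hβ (modelX a b f), coeFn_modelY J hv hβ f,
    coeFn_mulOp (memLp_top_ofReal_id (a := a) (b := b)) (modelY J v hv β hβ f), hXf,
    Lp.coeFn_smul (Complex.I * J * inner ℂ v f) v, ae_restrict_of_ae hT] with x e1 e2 e3 e4 e5 e6 e7
  rw [e1, Pi.sub_apply, e2, modelX, e4, e3, e6, Pi.smul_apply, smul_eq_mul, ← e7]
  rw [show (mulOp _ memLp_top_ofReal_id f : L2Icc a b) x = x * f x from e5]
  simp only [modelX, hh]
  ring

lemma adjoint_innerSL_apply {H : Type*} [NormedAddCommGroup H] [InnerProductSpace ℂ H]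
    [CompleteSpace H] (v : H) (c : ℂ) :
    ContinuousLinearMap.adjoint (innerSL ℂ v) c = c • v := by
  refine ext_inner_right ℂ fun w => ?_
  rw [ContinuousLinearMap.adjoint_inner_left, inner_smul_left, RCLike.inner_apply]
  simp [mul_comm]

theorem isLocalColligation_model {a b : ℝ} (J : ℝ) {v : L2Icc a b} (hv : MemLp v ⊤ (lebIcc a b))
    {β : ℝ → ℝ} (hβ : MemLp β ⊤ (lebIcc a b)) :
    IsLocalColligation (modelY J v hv β hβ * modelX a b) (innerSL ℂ v)
      ((J : ℂ) • (1 : ℂ →L[ℂ] ℂ)) := by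
  refine ⟨?_, ?_⟩
  · rw [IsSelfAdjoint, star_smul, star_one, ← starRingEnd_apply, Complex.conj_ofReal]
  · have h1 : ContinuousLinearMap.adjoint (modelY J v hv β hβ * modelX a b) =
        modelX a b * modelY J v hv β hβ := by
      rw [← ContinuousLinearMap.star_eq_adjoint, star_mul, (isSelfAdjoint_modelX a b).star_eq,
        (isSelfAdjoint_modelY J hv hβ).star_eq]
    ext1 f
    rw [h1]
    refine (modelY_mul_modelX_sub J hv hβ f).trans ?_
    simp only [smul_apply, ContinuousLinearMap.comp_apply, adjoint_innerSL_apply,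
      innerSL_apply_apply, one_apply_eq_self, smul_eq_mul, smul_smul]
    ring_nf

/-! ### Operators commuting with the independent variable -/

lemma memLp_top_cauchyKer {a b : ℝ} {w : ℂ} (hw : w.im ≠ 0) :
    MemLp (cauchyKer w) ⊤ (lebIcc a b) :=
  memLp_top_of_bound (continuous_cauchyKer hw).aestronglyMeasurable _
    (ae_of_all _ (norm_cauchyKer_le hw))

lemma memLp_two_const {a b : ℝ} (c : ℂ) : MemLp (fun _ : ℝ => c) 2 (lebIcc a b) := memLp_const c

/-- A bounded operator commuting with multiplication by the independent variable is multiplication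
by an essentially bounded function. It commutes with multiplication by the Cauchy kernels, and these
are total in `L²`. -/
theorem exists_eq_mulOp_of_commute {a b : ℝ} (D : L2Icc a b →L[ℂ] L2Icc a b)
    (hD : ∀ f, D (modelX a b f) = modelX a b (D f)) :
    ∃ u : ℝ → ℂ, ∃ hu : MemLp u ⊤ (lebIcc a b), D = mulOp u hu := by
  set e : L2Icc a b := (memLp_two_const 1).toLp _ with he
  have hec : e =ᵐ[lebIcc a b] fun _ => 1 := MemLp.coeFn_toLp _
  set u : L2Icc a b := D e with hu
  have hinv : ∀ (w : ℂ) (hw : w.im ≠ 0) (f : L2Icc a b),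
      modelX a b (mulOp _ (memLp_top_cauchyKer hw) f) - w • mulOp _ (memLp_top_cauchyKer hw) f = f ∧
      mulOp _ (memLp_top_cauchyKer hw) (modelX a b f - w • f) = f := by
    intro w hw f
    constructor
    · ext1
      filter_upwards [Lp.coeFn_sub (modelX a b (mulOp _ (memLp_top_cauchyKer hw) f))
          (w • mulOp _ (memLp_top_cauchyKer hw) f),
        Lp.coeFn_smul w (mulOp _ (memLp_top_cauchyKer hw) f),
        coeFn_mulOp (memLp_top_cauchyKer hw) f,
        coeFn_mulOp memLp_top_ofReal_id (mulOp _ (memLp_top_cauchyKer hw) f)] with t e1 e2 e3 e4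
      rw [e1, Pi.sub_apply, modelX, e4, e2, Pi.smul_apply, e3, cauchyKer, smul_eq_mul]
      have := ofReal_sub_ne_zero hw t
      field_simp
    · ext1
      filter_upwards [Lp.coeFn_sub (modelX a b f) (w • f), Lp.coeFn_smul w f,
        coeFn_mulOp (memLp_top_cauchyKer hw) (modelX a b f - w • f),
        coeFn_mulOp memLp_top_ofReal_id f] with t e1 e2 e3 e4
      rw [e3, e1, Pi.sub_apply, e2, Pi.smul_apply, modelX, e4, cauchyKer, smul_eq_mul]
      have := ofReal_sub_ne_zero hw t
      field_simp
  have hDK : ∀ (w : ℂ) (hw : w.im ≠ 0) (f : L2Icc a b),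
      D (mulOp _ (memLp_top_cauchyKer hw) f) = mulOp _ (memLp_top_cauchyKer hw) (D f) := by
    intro w hw f
    have h1 := (hinv w hw (D (mulOp _ (memLp_top_cauchyKer hw) f))).2
    rw [← hD, ← map_smul, ← map_sub, (hinv w hw f).1] at h1
    exact h1.symm
  -- compare `D f` and `u f` as elements of `L¹`, where both depend continuously on `f`
  let B := (ContinuousLinearMap.mul ℂ ℂ).holderL (lebIcc a b) 2 2 1
  have hB : ∀ f g : L2Icc a b, B f g =ᵐ[lebIcc a b] fun t => f t * g t := fun f g =>
    (ContinuousLinearMap.mul ℂ ℂ).coeFn_holder f g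
  let A : L2R →L[ℂ] Lp ℂ 1 (lebIcc a b) :=
    (B.flip e).comp (D.comp (restrOp a b)) - (B.flip u).comp (restrOp a b)
  have hA : A = 0 := by
    have hle : (Submodule.span ℂ {f : L2R | ∃ w, ∃ hw : w.im ≠ 0, f = cauchyL2 w hw}) ≤
        A.toLinearMap.ker := by
      rw [Submodule.span_le]
      rintro f ⟨w, hw, rfl⟩
      have h1 : restrOp a b (cauchyL2 w hw) = mulOp _ (memLp_top_cauchyKer hw) e := by
        ext1
        filter_upwards [coeFn_restrOp (a := a) (b := b) (cauchyL2 w hw),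
          ae_restrict_of_ae (coeFn_cauchyL2 hw), coeFn_mulOp (memLp_top_cauchyKer hw) e, hec]
          with t e1 e2 e3 e4
        rw [e1, e2, e3, e4, mul_one]
      change B (D (restrOp a b (cauchyL2 w hw))) e - B (restrOp a b (cauchyL2 w hw)) u = 0
      rw [sub_eq_zero, h1, hDK w hw]
      ext1
      filter_upwards [hB (mulOp _ (memLp_top_cauchyKer hw) (D e)) e,
        hB (mulOp _ (memLp_top_cauchyKer hw) e) u,
        coeFn_mulOp (memLp_top_cauchyKer hw) e, coeFn_mulOp (memLp_top_cauchyKer hw) (D e), hec]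
        with t e1 e2 e3 e4 e5
      rw [e1, e2, e3, e4, e5, hu]; ring
    have := Submodule.topologicalClosure_minimal _ hle A.isClosed_ker
    rw [topologicalClosure_span_cauchyL2] at this
    ext1 f
    exact this (Submodule.mem_top (x := f))
  have hDu : ∀ f : L2Icc a b, D f =ᵐ[lebIcc a b] fun t => u t * f t := by
    intro f
    have h1 : B (D f) e = B f u := by
      have := DFunLike.congr_fun hA (extOp a b f)
      change B (D (restrOp a b (extOp a b f))) e - B (restrOp a b (extOp a b f)) u = 0 at this
      rwa [restrOp_extOp, sub_eq_zero] at this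
    filter_upwards [hB (D f) e, hB f u, hec] with t e1 e2 e3
    rw [h1, e2, e3, mul_one] at e1
    rw [← e1, mul_comm]
  have hub : ∀ᵐ t ∂(lebIcc a b), ‖u t‖ ^ 2 ≤ ‖D‖ ^ 2 := by
    refine ae_le_of_forall_setIntegral_le ((Lp.memLp u).integrable_norm_pow (by norm_num))
      (integrable_const _) fun s hs hμ => ?_
    have h1 := D.le_opNorm (indicatorConstLp 2 hs hμ.ne (1 : ℂ))
    have h2 := pow_le_pow_left₀ (norm_nonneg _) h1 2
    rw [mul_pow, norm_sq_eq_integral, norm_sq_eq_integral] at h2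
    have h3 : ∫ t, ‖D (indicatorConstLp 2 hs hμ.ne (1 : ℂ)) t‖ ^ 2 ∂(lebIcc a b) =
        ∫ t in s, ‖u t‖ ^ 2 ∂(lebIcc a b) := by
      rw [← integral_indicator hs]
      refine integral_congr_ae ?_
      filter_upwards [hDu (indicatorConstLp 2 hs hμ.ne (1 : ℂ)),
        indicatorConstLp_coeFn (hs := hs) (hμs := hμ.ne) (c := (1 : ℂ)) (p := 2)] with t e1 e2
      rw [e1, e2]
      by_cases ht : t ∈ s <;> simp [ht]
    have h4 : ‖D‖ ^ 2 * ∫ t, ‖(indicatorConstLp 2 hs hμ.ne (1 : ℂ) : L2Icc a b) t‖ ^ 2 ∂(lebIcc a b) =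
        ∫ t in s, ‖D‖ ^ 2 ∂(lebIcc a b) := by
      rw [← integral_indicator hs, ← integral_const_mul]
      refine integral_congr_ae ?_
      filter_upwards [indicatorConstLp_coeFn (hs := hs) (hμs := hμ.ne) (c := (1 : ℂ)) (p := 2)]
        with t e2
      rw [e2]
      by_cases ht : t ∈ s <;> simp [ht]
    rwa [h3, h4] at h2
  have hutop : MemLp u ⊤ (lebIcc a b) := by
    refine memLp_top_of_bound (Lp.memLp u).1 ‖D‖ ?_
    filter_upwards [hub] with t ht
    exact le_of_sq_le_sq ht (norm_nonneg _)
  refine ⟨u, hutop, ?_⟩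
  ext1 f
  ext1
  filter_upwards [hDu f, coeFn_mulOp hutop f] with t h1 h2
  rw [h1, h2]

/-- The symbol of a self-adjoint multiplication operator is real. -/
lemma ae_conj_eq_of_isSelfAdjoint_mulOp {a b : ℝ} {u : ℝ → ℂ} {hu : MemLp u ⊤ (lebIcc a b)}
    (h : IsSelfAdjoint (mulOp u hu)) : ∀ᵐ t ∂(lebIcc a b), conj (u t) = u t := by
  have h1 := (ContinuousLinearMap.isSelfAdjoint_iff'.mp h)
  rw [adjoint_mulOp hu (memLp_top_conj hu)] at h1
  filter_upwards [coeFn_mulOp hu ((memLp_two_const 1).toLp _),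
    coeFn_mulOp (memLp_top_conj hu) ((memLp_two_const 1).toLp _),
    (memLp_two_const (a := a) (b := b) 1).coeFn_toLp] with t e1 e2 e3
  rw [h1, e1, e3] at e2
  simpa using e2.symm

/-! ### Lower bounds for symbols -/

lemma memLp_two_indicator_of_top {a b : ℝ} {m : ℝ → ℂ} (hm : MemLp m ⊤ (lebIcc a b)) :
    MemLp ((Set.Icc a b).indicator m) 2 volume :=
  (memLp_indicator_iff_restrict measurableSet_Icc).mpr (hm.mono_exponent le_top)

lemma exists_bound_of_memLp_top {a b : ℝ} {m : ℝ → ℂ} (hm : MemLp m ⊤ (lebIcc a b)) :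
    ∃ M : ℝ, 0 ≤ M ∧ ∀ᵐ t : ℝ, ‖(Set.Icc a b).indicator m t‖ ≤ M := by
  have h1 : ∀ᵐ t ∂(lebIcc a b), ‖m t‖ ≤ (eLpNorm m ⊤ (lebIcc a b)).toReal := by
    rw [eLpNorm_exponent_top]
    filter_upwards [ae_le_eLpNormEssSup (f := m) (μ := lebIcc a b)] with t ht
    have hfin : eLpNormEssSup m (lebIcc a b) ≠ ⊤ := by
      have := hm.2.ne
      rwa [eLpNorm_exponent_top] at this
    have := ENNReal.toReal_mono hfin ht
    simpa using this
  refine ⟨(eLpNorm m ⊤ (lebIcc a b)).toReal, ENNReal.toReal_nonneg, ?_⟩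
  filter_upwards [(ae_restrict_iff' measurableSet_Icc).mp h1] with t ht
  by_cases h : t ∈ Set.Icc a b
  · rw [Set.indicator_of_mem h]; exact ht h
  · simp [h]

/-- If `S = m + K (T + s π i) U` is bounded below by `C⁻¹`, then so is its symbol `m`. Normalised
Cauchy kernels with poles approaching a point `x` concentrate at `x`, and `T + s π i` annihilates
them, so `S` acts on them asymptotically as the number `m x`. -/
theorem one_le_mul_norm_symbol {a b : ℝ} {v : ℝ → ℂ} (hv : MemLp v ⊤ (lebIcc a b)) {m : ℝ → ℂ}
    (hm : MemLp m ⊤ (lebIcc a b)) (S : L2Icc a b → L2Icc a b) (K : L2R →L[ℂ] L2Icc a b) {s C : ℝ}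
    (hs : s = 1 ∨ s = -1) (hC : 0 ≤ C)
    (hS : ∀ f, S f = mulOp m hm f +
      K (hilbertT (weightOp v hv f) + (s * Real.pi * Complex.I : ℂ) • weightOp v hv f))
    (hlow : ∀ f, ‖f‖ ≤ C * ‖S f‖) :
    ∀ᵐ x ∂(lebIcc a b), 1 ≤ C * ‖m x‖ := by
  obtain ⟨M, hM0, hM⟩ := exists_bound_of_memLp_top hv
  set vt := (Set.Icc a b).indicator v with hvt
  have hvt2 : MemLp vt 2 volume := memLp_two_indicator_of_top hv
  have hm2 : MemLp (fun t => ((‖m t‖ ^ 2 : ℝ) : ℂ)) ⊤ (lebIcc a b) := by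
    have h1 : MemLp (fun t => ‖m t‖ * ‖m t‖) ⊤ (lebIcc a b) := hm.norm.mul hm.norm
    refine (h1.ofReal (K := ℂ)).congr_norm ?_ (ae_of_all _ fun t => ?_)
    · exact (Complex.continuous_ofReal.comp_aestronglyMeasurable (hm.1.norm.pow 2))
    · simp [sq]
  have hm2' := memLp_two_indicator_of_top hm2
  have hone : MemLp ((Set.Icc a b).indicator fun _ => (1 : ℂ)) 2 volume :=
    memLp_two_indicator_of_top (memLp_const 1)
  rw [ae_restrict_iff' measurableSet_Icc]
  filter_upwards [hM, ae_tendsto_integral_poissonKer_norm_sub hvt2,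
    ae_tendsto_integral_poissonKer_norm_sub hm2', ae_tendsto_integral_poissonKer_norm_sub hone]
    with x hMx hx1 hx2 hx3 hxI
  have l2 := tendsto_integral_poissonKer_mul hm2' hx2
  have l3 := tendsto_integral_poissonKer_mul hone hx3
  rw [Set.indicator_of_mem hxI] at l2 l3
  have hs2 : |s| = 1 := by rcases hs with h | h <;> simp [h]
  have hs0 : s ≠ 0 := by rcases hs with h | h <;> simp [h]
  have him : ∀ ε : ℝ, ((x : ℂ) + (s * ε : ℝ) * Complex.I).im = s * ε := fun ε => by simp
  have hw : ∀ ε : ℝ, 0 < ε → ((x : ℂ) + (s * ε : ℝ) * Complex.I).im ≠ 0 := fun ε hε => by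
    rw [him]; exact mul_ne_zero hs0 hε.ne'
  have hP : ∀ ε : ℝ, 0 < ε → ∀ t : ℝ,
      ε * ‖cauchyKer ((x : ℂ) + (s * ε : ℝ) * Complex.I) t‖ ^ 2 = poissonKer ε (t - x) := by
    intro ε hε t
    rw [norm_cauchyKer_sq (hw ε hε), him, abs_mul, hs2, one_mul, abs_of_pos hε]
    simp [hε.ne']
  -- `k` is the Cauchy kernel, `f` its restriction to `[a, b]`
  have main : ∀ ε : ℝ, 0 < ε →
      Real.sqrt (∫ t, poissonKer ε (t - x) * ‖(Set.Icc a b).indicator (fun _ => (1 : ℂ)) t‖) ≤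
        C * (Real.sqrt (∫ t, poissonKer ε (t - x) *
            ‖(Set.Icc a b).indicator (fun t => ((‖m t‖ ^ 2 : ℝ) : ℂ)) t‖) +
          ‖K‖ * (‖hilbertT‖ + Real.pi) *
            Real.sqrt (2 * M * ∫ t, poissonKer ε (t - x) * ‖vt t - vt x‖)) := by
    intro ε hε
    set w : ℂ := (x : ℂ) + (s * ε : ℝ) * Complex.I with hwdef
    set k : L2R := cauchyL2 w (hw ε hε) with hk
    have hkc : k =ᵐ[volume] cauchyKer w := coeFn_cauchyL2 _
    set f : L2Icc a b := restrOp a b k with hf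
    have hfc : ∀ᵐ t : ℝ, t ∈ Set.Icc a b → f t = cauchyKer w t := by
      filter_upwards [(ae_restrict_iff' measurableSet_Icc).mp (coeFn_restrOp (a := a) (b := b) k),
        hkc] with t e1 e2 ht
      rw [hf, e1 ht, e2]
    have hann : hilbertT k + (s * Real.pi * Complex.I : ℂ) • k = 0 := by
      rcases hs with h | h
      · have hpos : 0 < w.im := by rw [hwdef, him, h]; simpa using hε
        rw [hk, hilbertT_cauchyL2_of_pos hpos, h]
        push_cast; module
      · have hneg : w.im < 0 := by rw [hwdef, him, h]; simpa using hε
        rw [hk, hilbertT_cauchyL2_of_neg hneg, h]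
        push_cast; module
    set c : ℂ := conj (vt x)
    have hsplit : hilbertT (weightOp v hv f) + (s * Real.pi * Complex.I : ℂ) • weightOp v hv f =
        hilbertT (weightOp v hv f - c • k) +
          (s * Real.pi * Complex.I : ℂ) • (weightOp v hv f - c • k) := by
      have h0 : c • hilbertT k + c • (s * Real.pi * Complex.I : ℂ) • k = 0 := by
        rw [← smul_add, hann, smul_zero]
      rw [map_sub, map_smul, smul_sub, smul_comm _ c k]
      rw [sub_add_sub_comm, h0, sub_zero]
    have n1 : ε * ‖f‖ ^ 2 =
        ∫ t, poissonKer ε (t - x) * ‖(Set.Icc a b).indicator (fun _ => (1 : ℂ)) t‖ := by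
      rw [norm_sq_eq_integral, ← integral_indicator measurableSet_Icc, ← integral_const_mul]
      refine integral_congr_ae ?_
      filter_upwards [hfc] with t ht
      by_cases htI : t ∈ Set.Icc a b
      · simp [htI, ht htI, ← hP ε hε, hwdef]
      · simp [htI]
    have n2 : ε * ‖mulOp m hm f‖ ^ 2 = ∫ t, poissonKer ε (t - x) *
        ‖(Set.Icc a b).indicator (fun t => ((‖m t‖ ^ 2 : ℝ) : ℂ)) t‖ := by
      rw [norm_sq_eq_integral, ← integral_indicator measurableSet_Icc, ← integral_const_mul]
      refine integral_congr_ae ?_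
      filter_upwards [hfc, (ae_restrict_iff' measurableSet_Icc).mp (coeFn_mulOp hm f)] with t ht ht2
      by_cases htI : t ∈ Set.Icc a b
      · rw [Set.indicator_of_mem htI, Set.indicator_of_mem htI, ht2 htI, ht htI, norm_mul, mul_pow,
          ← hP ε hε, Complex.norm_real, Real.norm_of_nonneg (by positivity)]
        ring
      · simp [htI]
    have n3 : ε * ‖weightOp v hv f - c • k‖ ^ 2 ≤
        2 * M * ∫ t, poissonKer ε (t - x) * ‖vt t - vt x‖ := by
      rw [norm_sq_eq_integral, ← integral_const_mul, ← integral_const_mul]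
      refine integral_mono_ae (((Lp.memLp _).integrable_norm_pow (by norm_num)).const_mul _)
        ((integrable_poissonKer_mul_norm_sub hvt2 hε x (vt x)).const_mul _) ?_
      filter_upwards [hfc, coeFn_weightOp hv f, Lp.coeFn_sub (weightOp v hv f) (c • k),
        Lp.coeFn_smul c k, hkc, hM] with t e1 e2 e3 e4 e5 e6
      have e7 : (weightOp v hv f - c • k : L2R) t = conj (vt t - vt x) * cauchyKer w t := by
        rw [e3, Pi.sub_apply, e2, e4, Pi.smul_apply, e5, smul_eq_mul, map_sub]
        by_cases htI : t ∈ Set.Icc a b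
        · rw [Set.indicator_of_mem htI, e1 htI, hvt, Set.indicator_of_mem htI]; simp only [c, hvt]; ring
        · rw [hvt, Set.indicator_of_notMem htI, Set.indicator_of_notMem htI]; simp [c, hvt]
      rw [e7, norm_mul, RCLike.norm_conj, mul_pow]
      have e8 : ε * (‖vt t - vt x‖ ^ 2 * ‖cauchyKer w t‖ ^ 2) =
          ‖vt t - vt x‖ * (poissonKer ε (t - x) * ‖vt t - vt x‖) := by
        rw [← hP ε hε]; ring
      rw [e8]
      refine mul_le_mul_of_nonneg_right ?_ (mul_nonneg (poissonKer_nonneg hε _) (norm_nonneg _))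
      exact (norm_sub_le _ _).trans (by linarith)
    have hsq : ∀ r : ℝ, 0 ≤ r → Real.sqrt ε * r = Real.sqrt (ε * r ^ 2) := fun r hr => by
      rw [Real.sqrt_mul hε.le, Real.sqrt_sq hr]
    have hSf : ‖S f‖ ≤ ‖mulOp m hm f‖ +
        ‖K‖ * (‖hilbertT‖ + Real.pi) * ‖weightOp v hv f - c • k‖ := by
      rw [hS, hsplit]
      refine (norm_add_le _ _).trans (add_le_add le_rfl ((K.le_opNorm _).trans ?_))
      rw [mul_assoc ‖K‖]
      refine mul_le_mul_of_nonneg_left ?_ (norm_nonneg K)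
      refine (norm_add_le _ _).trans ?_
      rw [add_mul]
      refine add_le_add (hilbertT.le_opNorm _) ?_
      rw [norm_smul]
      have : ‖(s * Real.pi * Complex.I : ℂ)‖ = Real.pi := by
        simp [hs2, abs_of_pos Real.pi_pos]
      rw [this]
    calc Real.sqrt (∫ t, poissonKer ε (t - x) * ‖(Set.Icc a b).indicator (fun _ => (1 : ℂ)) t‖)
        = Real.sqrt ε * ‖f‖ := by rw [hsq _ (norm_nonneg _), n1]
      _ ≤ Real.sqrt ε * (C * (‖mulOp m hm f‖ +
          ‖K‖ * (‖hilbertT‖ + Real.pi) * ‖weightOp v hv f - c • k‖)) := by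
          refine mul_le_mul_of_nonneg_left ((hlow f).trans ?_) (Real.sqrt_nonneg _)
          exact mul_le_mul_of_nonneg_left hSf hC
      _ = C * (Real.sqrt ε * ‖mulOp m hm f‖ +
          ‖K‖ * (‖hilbertT‖ + Real.pi) * (Real.sqrt ε * ‖weightOp v hv f - c • k‖)) := by ring
      _ ≤ _ := by
          rw [hsq _ (norm_nonneg _), hsq _ (norm_nonneg _), n2]
          have := Real.pi_pos
          gcongr
  have conv : ∀ (g : ℝ → ℂ) (r : ℝ), 0 ≤ r →
      (∀ t, g t = ((‖g t‖ : ℝ) : ℂ)) →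
      Tendsto (fun ε => ∫ t, (poissonKer ε (t - x) : ℂ) * g t) (𝓝[>] 0) (𝓝 (Real.pi * r)) →
      Tendsto (fun ε => ∫ t, poissonKer ε (t - x) * ‖g t‖) (𝓝[>] 0) (𝓝 (Real.pi * r)) := by
    intro g r _ hg h
    have h1 := (Complex.continuous_re.tendsto _).comp h
    have e : ((Real.pi : ℂ) * (r : ℂ)).re = Real.pi * r := by simp
    rw [e] at h1
    refine h1.congr fun ε => ?_
    simp only [Function.comp_apply]
    have : ∫ t, (poissonKer ε (t - x) : ℂ) * g t =
        ((∫ t, poissonKer ε (t - x) * ‖g t‖ : ℝ) : ℂ) := by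
      rw [← integral_complex_ofReal]
      refine integral_congr_ae (ae_of_all _ fun t => ?_)
      simp only
      rw [hg t]; push_cast; simp
    rw [this, Complex.ofReal_re]
  have c1 := conv ((Set.Icc a b).indicator fun _ => (1 : ℂ)) 1 zero_le_one (fun t => by
    by_cases htI : t ∈ Set.Icc a b <;> simp [htI]) (by simpa using l3)
  have c2 := conv ((Set.Icc a b).indicator fun t => ((‖m t‖ ^ 2 : ℝ) : ℂ)) (‖m x‖ ^ 2) (by positivity) (fun t => by
    by_cases htI : t ∈ Set.Icc a b <;> simp [htI]) l2
  have lim1 := c1.sqrt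
  have lim2 := ((c2.sqrt).add (((hx1.const_mul (2 * M)).sqrt).const_mul
    (‖K‖ * (‖hilbertT‖ + Real.pi)))).const_mul C
  have hle := le_of_tendsto_of_tendsto lim1 lim2 (by
    filter_upwards [self_mem_nhdsWithin] with ε hε using main ε hε)
  rw [mul_one, Real.sqrt_mul Real.pi_pos.le, Real.sqrt_sq (norm_nonneg _)] at hle
  have hpi := Real.sqrt_pos.mpr Real.pi_pos
  simp only [mul_zero, Real.sqrt_zero, add_zero] at hle
  have : Real.sqrt Real.pi * 1 ≤ Real.sqrt Real.pi * (C * ‖m x‖) := by linarith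
  exact le_of_mul_le_mul_left this hpi

/-! ### The jump problem on the line -/

/-- The coefficient `ζ + π ω` of the jump problem. -/
def symP (a b J : ℝ) (v : ℝ → ℂ) (β : ℝ → ℝ) (z : ℂ) (t : ℝ) : ℂ :=
  zetaFn a b β z t + (Real.pi : ℂ) * (omegaFn a b J v t : ℂ)

/-- The coefficient `ζ - π ω` of the jump problem. -/
def symM (a b J : ℝ) (v : ℝ → ℂ) (β : ℝ → ℝ) (z : ℂ) (t : ℝ) : ℂ :=
  zetaFn a b β z t - (Real.pi : ℂ) * (omegaFn a b J v t : ℂ)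

lemma dCoef_eq (a b J : ℝ) (v : ℝ → ℂ) (β : ℝ → ℝ) (z : ℂ) (t : ℝ) :
    dCoef a b J v β z t = symM a b J v β z t / symP a b J v β z t := rfl

lemma omegaFn_of_notMem {a b J : ℝ} {v : ℝ → ℂ} {t : ℝ} (ht : t ∉ Set.Icc a b) :
    omegaFn a b J v t = 0 := by simp [omegaFn, ht]

lemma resolvent_apply_spec {H : Type*} [NormedAddCommGroup H] [InnerProductSpace ℂ H]
    {Y : H →L[ℂ] H} {z : ℂ} (hz : z ∈ resolventSet ℂ Y) (f : H) :
    z • resolvent Y z f - Y (resolvent Y z f) = f ∧ resolvent Y z (z • f - Y f) = f := by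
  have h1 : (algebraMap ℂ (H →L[ℂ] H) z - Y) * resolvent Y z = 1 := Ring.mul_inverse_cancel _ hz
  have h2 : resolvent Y z * (algebraMap ℂ (H →L[ℂ] H) z - Y) = 1 := Ring.inverse_mul_cancel _ hz
  rw [Algebra.algebraMap_eq_smul_one] at h1 h2
  exact ⟨DFunLike.congr_fun h1 f, DFunLike.congr_fun h2 f⟩

section Jump

variable {a b J : ℝ} {v : L2Icc a b} {β : ℝ → ℝ}

lemma ae_jump_of_eq (hv : MemLp v ⊤ (lebIcc a b)) (hβ : MemLp β ⊤ (lebIcc a b)) {z : ℂ}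
    {f g : L2Icc a b} (h : z • g - modelY J v hv β hβ g = f) :
    ∀ᵐ t : ℝ, zetaFn a b β z t * weightOp v hv g t -
      Complex.I * omegaFn a b J v t * hilbertT (weightOp v hv g) t = weightOp v hv f t := by
  have h1 : ∀ᵐ t ∂(lebIcc a b), z * g t - (-((t : ℂ) + β t) * g t +
      Complex.I * J * v t * hilbertT (weightOp v hv g) t) = f t := by
    filter_upwards [coeFn_modelY J hv hβ g, Lp.coeFn_sub (z • g) (modelY J v hv β hβ g),
      Lp.coeFn_smul z g] with t e1 e2 e3
    rw [← h, e2, Pi.sub_apply, e3, e1, Pi.smul_apply, smul_eq_mul]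
  filter_upwards [(ae_restrict_iff' measurableSet_Icc).mp h1, coeFn_weightOp hv g,
    coeFn_weightOp hv f] with t e1 e2 e3
  by_cases ht : t ∈ Set.Icc a b
  · have e4 : ((omegaFn a b J v t : ℝ) : ℂ) = J * (v t * conj (v t)) := by
      simp only [omegaFn, Set.indicator_of_mem ht]
      rw [Complex.mul_conj, Complex.normSq_eq_norm_sq]; push_cast; ring
    rw [e2, e3, e4]
    simp only [zetaFn, Set.indicator_of_mem ht]
    rw [← e1 ht]; ring
  · rw [e2, e3, omegaFn_of_notMem ht]; simp [ht]

lemma weightOp_self (hJ : J = 1 ∨ J = -1) (hv : MemLp v ⊤ (lebIcc a b)) :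
    ∀ᵐ t : ℝ, weightOp v hv v t = J * omegaFn a b J v t := by
  filter_upwards [coeFn_weightOp hv v] with t e1
  rw [e1]
  by_cases ht : t ∈ Set.Icc a b
  · simp only [omegaFn, Set.indicator_of_mem ht]
    rw [Complex.mul_conj, Complex.normSq_eq_norm_sq]
    rcases hJ with rfl | rfl <;> simp
  · rw [omegaFn_of_notMem ht]; simp [ht]

/-- If `z - Y` is invertible, the coefficients `ζ ± π ω` are bounded away from zero on `[a, b]`. -/
theorem exists_pos_le_norm_sym (hv : MemLp v ⊤ (lebIcc a b)) (hβ : MemLp β ⊤ (lebIcc a b)) {z : ℂ}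
    (hz : z ∈ resolventSet ℂ (modelY J v hv β hβ)) :
    ∃ δ : ℝ, 0 < δ ∧ ∀ᵐ t : ℝ, t ∈ Set.Icc a b →
      δ ≤ ‖symP a b J v β z t‖ ∧ δ ≤ ‖symM a b J v β z t‖ := by
  set Y := modelY J v hv β hβ with hY
  set C := ‖resolvent Y z‖
  have hC : 0 ≤ C := norm_nonneg _
  have key : ∀ s : ℝ, (s = 1 ∨ s = -1) → ∀ᵐ t : ℝ ∂(lebIcc a b),
      1 ≤ C * ‖z + ((t : ℂ) + β t) - (s * Real.pi * J : ℂ) * (v t * conj (v t))‖ := by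
    intro s hs
    have hm : MemLp (fun t : ℝ => z + ((t : ℂ) + β t) - (s * Real.pi * J : ℂ) * (v t * conj (v t))) ⊤
        (lebIcc a b) :=
      ((memLp_const z).add (memLp_top_add_ofReal hβ)).sub
        (((memLp_top_conj hv).mul hv).const_mul (s * Real.pi * J : ℂ))
    refine one_le_mul_norm_symbol hv hm (fun f => z • f - Y f)
      (-(Complex.I * J) • ContinuousLinearMap.adjoint (weightOp v hv)) hs hC (fun f => ?_)
      (fun f => ?_)
    · ext1
      set G : L2R := hilbertT (weightOp v hv f) + (s * Real.pi * Complex.I : ℂ) • weightOp v hv f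
        with hG
      have hGc : ∀ᵐ t ∂(lebIcc a b), G t = hilbertT (weightOp v hv f) t +
          (s * Real.pi * Complex.I : ℂ) * (f t * conj (v t)) := by
        filter_upwards [ae_restrict_of_ae (Lp.coeFn_add (hilbertT (weightOp v hv f))
          ((s * Real.pi * Complex.I : ℂ) • weightOp v hv f)),
          ae_restrict_of_ae (Lp.coeFn_smul (s * Real.pi * Complex.I : ℂ) (weightOp v hv f)),
          ae_restrict_of_ae (coeFn_weightOp hv f), ae_restrict_mem measurableSet_Icc]
          with t e1 e2 e3 ht
        rw [hG, e1, Pi.add_apply, e2, Pi.smul_apply, e3, Set.indicator_of_mem ht, smul_eq_mul]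
      have e : (-(Complex.I * J : ℂ) • ContinuousLinearMap.adjoint (weightOp v hv)) G =
          -(Complex.I * J : ℂ) • ContinuousLinearMap.adjoint (weightOp v hv) G := rfl
      rw [e]
      filter_upwards [coeFn_modelY J hv hβ f, Lp.coeFn_sub (z • f) (Y f), Lp.coeFn_smul z f,
        Lp.coeFn_add (mulOp _ hm f)
          (-(Complex.I * J : ℂ) • ContinuousLinearMap.adjoint (weightOp v hv) G),
        Lp.coeFn_smul (-(Complex.I * J : ℂ)) (ContinuousLinearMap.adjoint (weightOp v hv) G),
        coeFn_mulOp hm f, coeFn_adjoint_weightOp hv G, hGc] with t e1 e2 e3 e4 e5 e6 e7 e8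
      rw [e2, Pi.sub_apply, e3, e1, e4, Pi.add_apply, e5, Pi.smul_apply, Pi.smul_apply, e6, e7, e8,
        smul_eq_mul, smul_eq_mul]
      linear_combination (s * Real.pi * J * (v t * conj (v t)) * f t) * Complex.I_sq
    · have h1 := (resolvent Y z).le_opNorm (z • f - Y f)
      rwa [(resolvent_apply_spec hz f).2] at h1
  refine ⟨(C + 1)⁻¹, by positivity, ?_⟩
  have hcon : ∀ r : ℝ, 0 ≤ r → 1 ≤ C * r → (C + 1)⁻¹ ≤ r := fun r h0 hr => by
    rw [inv_le_iff_one_le_mul₀ (by positivity)]; nlinarith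
  filter_upwards [(ae_restrict_iff' measurableSet_Icc).mp (key 1 (Or.inl rfl)),
    (ae_restrict_iff' measurableSet_Icc).mp (key (-1) (Or.inr rfl))] with t e1 e2 ht
  have e4 : ((omegaFn a b J v t : ℝ) : ℂ) = J * (v t * conj (v t)) := by
    simp only [omegaFn, Set.indicator_of_mem ht]
    rw [Complex.mul_conj, Complex.normSq_eq_norm_sq]; push_cast; ring
  constructor
  · refine hcon _ (norm_nonneg _) ((e2 ht).trans (le_of_eq ?_))
    congr 2
    simp only [symP, zetaFn, Set.indicator_of_mem ht, e4]
    push_cast; ring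
  · refine hcon _ (norm_nonneg _) ((e1 ht).trans (le_of_eq ?_))
    congr 2
    simp only [symM, zetaFn, Set.indicator_of_mem ht, e4]
    push_cast; ring

lemma ae_sym_ne_zero (hv : MemLp v ⊤ (lebIcc a b)) (hβ : MemLp β ⊤ (lebIcc a b)) {z : ℂ}
    (hz : z ∈ resolventSet ℂ (modelY J v hv β hβ)) :
    ∀ᵐ t : ℝ, symP a b J v β z t ≠ 0 ∧ symM a b J v β z t ≠ 0 := by
  obtain ⟨δ, hδ, h⟩ := exists_pos_le_norm_sym hv hβ hz
  have hne : ∀ᵐ t : ℝ, t ≠ -z.re := by simp [ae_iff, measure_singleton]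
  filter_upwards [h, hne] with t ht htz
  by_cases hI : t ∈ Set.Icc a b
  · exact ⟨norm_pos_iff.mp (hδ.trans_le (ht hI).1), norm_pos_iff.mp (hδ.trans_le (ht hI).2)⟩
  · have h0 : z + (t : ℂ) ≠ 0 := fun h0 => htz (by
      have := congrArg Complex.re h0
      simp at this; linarith)
    simp [symP, symM, zetaFn, omegaFn_of_notMem hI, hI, h0]

/-- The function `h = conj(v) (z - Y)⁻¹ v`, continued by zero, whose Cauchy transform solves the
jump problem. -/
def density (J : ℝ) (hv : MemLp v ⊤ (lebIcc a b)) (hβ : MemLp β ⊤ (lebIcc a b)) (z : ℂ) : L2R :=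
  weightOp v hv (resolvent (modelY J v hv β hβ) z v)

/-- The conjugate of `density` at the conjugate point. Its Cauchy transform solves the jump problem
with the inverse coefficient. -/
def densityConj (J : ℝ) (hv : MemLp v ⊤ (lebIcc a b)) (hβ : MemLp β ⊤ (lebIcc a b)) (z : ℂ) : L2R :=
  conjL2 (density J hv hβ (conj z))

lemma conj_mem_resolventSet {H : Type*} [NormedAddCommGroup H] [InnerProductSpace ℂ H]
    [CompleteSpace H] {Y : H →L[ℂ] H} (hY : IsSelfAdjoint Y) {z : ℂ} (hz : z ∈ resolventSet ℂ Y) :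
    conj z ∈ resolventSet ℂ Y := by
  rw [spectrum.mem_resolventSet_iff] at hz ⊢
  have := hz.star
  rwa [star_sub, hY.star_eq, ← algebraMap_star_comm] at this

lemma mem_resolventSet_of_im_ne_zero {H : Type*} [NormedAddCommGroup H] [InnerProductSpace ℂ H]
    [CompleteSpace H] {Y : H →L[ℂ] H} (hY : IsSelfAdjoint Y) {z : ℂ} (hz : z.im ≠ 0) :
    z ∈ resolventSet ℂ Y := by
  by_contra h
  have h1 : z = z.re := hY.mem_spectrum_eq_re h
  exact hz (by rw [h1]; simp)

lemma conj_zetaFn (z : ℂ) (t : ℝ) : conj (zetaFn a b β (conj z) t) = zetaFn a b β z t := by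
  simp [zetaFn]

lemma abs_im_le_norm_sym (z : ℂ) (t : ℝ) :
    |z.im| ≤ ‖symP a b J v β z t‖ ∧ |z.im| ≤ ‖symM a b J v β z t‖ := by
  have h1 := Complex.abs_im_le_norm (symP a b J v β z t)
  have h2 := Complex.abs_im_le_norm (symM a b J v β z t)
  simp only [symP, symM, zetaFn] at h1 h2
  simp at h1 h2
  exact ⟨h1, h2⟩

lemma sym_ne_zero_of_im_ne_zero {z : ℂ} (hz : z.im ≠ 0) (t : ℝ) :
    symP a b J v β z t ≠ 0 ∧ symM a b J v β z t ≠ 0 := by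
  obtain ⟨h1, h2⟩ := abs_im_le_norm_sym (a := a) (b := b) (J := J) (v := v) (β := β) z t
  have := abs_pos.mpr hz
  exact ⟨norm_pos_iff.mp (by linarith), norm_pos_iff.mp (by linarith)⟩

lemma dCoef_mem_slitPlane_of_im_ne_zero {z : ℂ} (hz : z.im ≠ 0) (t : ℝ) :
    dCoef a b J v β z t ∈ Complex.slitPlane := by
  by_contra hcon
  rw [Complex.mem_slitPlane_iff_not_le_zero, not_not, Complex.le_def] at hcon
  have hre : (dCoef a b J v β z t).re ≤ 0 := hcon.1
  have hi : (dCoef a b J v β z t).im = 0 := hcon.2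
  have h2 : dCoef a b J v β z t * symP a b J v β z t = symM a b J v β z t := by
    rw [dCoef_eq, div_mul_cancel₀ _ (sym_ne_zero_of_im_ne_zero hz t).1]
  have h3 := congrArg Complex.im h2
  simp [symP, symM, zetaFn, hi] at h3
  have h4 : ((dCoef a b J v β z t).re - 1) * z.im = 0 := by linear_combination h3
  rcases mul_eq_zero.mp h4 with h5 | h5
  · linarith
  · exact hz h5

variable (hJ : J = 1 ∨ J = -1) (hv : MemLp v ⊤ (lebIcc a b)) (hβ : MemLp β ⊤ (lebIcc a b))

include hJ in
lemma ae_jump_density {z : ℂ} (hz : z ∈ resolventSet ℂ (modelY J v hv β hβ)) :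
    ∀ᵐ t : ℝ, zetaFn a b β z t * density J hv hβ z t -
      Complex.I * omegaFn a b J v t * hilbertT (density J hv hβ z) t = J * omegaFn a b J v t := by
  filter_upwards [ae_jump_of_eq hv hβ (resolvent_apply_spec hz (v : L2Icc a b)).1,
    weightOp_self hJ hv] with t e1 e2
  rw [← e2, ← e1]; rfl

include hJ in
lemma ae_jump_densityConj {z : ℂ} (hz : z ∈ resolventSet ℂ (modelY J v hv β hβ)) :
    ∀ᵐ t : ℝ, zetaFn a b β z t * densityConj J hv hβ z t +
      Complex.I * omegaFn a b J v t * hilbertT (densityConj J hv hβ z) t =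
        J * omegaFn a b J v t := by
  have hz' := conj_mem_resolventSet (isSelfAdjoint_modelY J hv hβ) hz
  have h1 := ae_jump_density hJ hv hβ hz'
  filter_upwards [h1, coeFn_conjL2 (density J hv hβ (conj z)),
    coeFn_conjL2 (hilbertT (density J hv hβ (conj z)))] with t e1 e2 e3
  rw [densityConj, hilbertT_conjL2, e2, e3]
  have := congrArg conj e1
  simp only [map_sub, map_mul, conj_zetaFn, Complex.conj_ofReal, Complex.conj_I] at this
  linear_combination this

include hJ in
/-- The two solutions of the jump problem have boundary values with equal products on both sides of
the line. Here `h` and `h'` are the densities, and the boundary values are `T h ± iπ h - iJ` and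
`T h' ± iπ h' + iJ`. -/
lemma ae_boundary_product {z : ℂ} (hz : z ∈ resolventSet ℂ (modelY J v hv β hβ)) :
    ∀ᵐ t : ℝ,
      symP a b J v β z t * (hilbertT (density J hv hβ z) t + Real.pi * Complex.I * density J hv hβ z t -
        Complex.I * J) =
      symM a b J v β z t * (hilbertT (density J hv hβ z) t - Real.pi * Complex.I * density J hv hβ z t -
        Complex.I * J) ∧
      symM a b J v β z t * (hilbertT (densityConj J hv hβ z) t +
        Real.pi * Complex.I * densityConj J hv hβ z t + Complex.I * J) =
      symP a b J v β z t * (hilbertT (densityConj J hv hβ z) t -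
        Real.pi * Complex.I * densityConj J hv hβ z t + Complex.I * J) ∧
      (density J hv hβ z t * hilbertT (densityConj J hv hβ z) t +
        densityConj J hv hβ z t * hilbertT (density J hv hβ z) t) +
        Complex.I * J * density J hv hβ z t - Complex.I * J * densityConj J hv hβ z t = 0 := by
  filter_upwards [ae_jump_density hJ hv hβ hz, ae_jump_densityConj hJ hv hβ hz,
    ae_sym_ne_zero hv hβ hz] with t e1 e2 e3
  set h := density J hv hβ z t
  set h' := densityConj J hv hβ z t
  set g := hilbertT (density J hv hβ z) t
  set g' := hilbertT (densityConj J hv hβ z) t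
  have c1 : symP a b J v β z t * (g + Real.pi * Complex.I * h - Complex.I * J) =
      symM a b J v β z t * (g - Real.pi * Complex.I * h - Complex.I * J) := by
    simp only [symP, symM]
    linear_combination (2 * Real.pi * Complex.I) * e1 +
      (2 * Real.pi * omegaFn a b J v t * g) * Complex.I_sq
  have c2 : symM a b J v β z t * (g' + Real.pi * Complex.I * h' + Complex.I * J) =
      symP a b J v β z t * (g' - Real.pi * Complex.I * h' + Complex.I * J) := by
    simp only [symP, symM]
    linear_combination (2 * Real.pi * Complex.I) * e2 -
      (2 * Real.pi * omegaFn a b J v t * g') * Complex.I_sq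
  refine ⟨c1, c2, ?_⟩
  have hpi : (Real.pi : ℂ) ≠ 0 := by exact_mod_cast Real.pi_ne_zero
  have c3 : (symP a b J v β z t * symM a b J v β z t * (2 * Real.pi * Complex.I)) *
      ((h * g' + h' * g) + Complex.I * J * h - Complex.I * J * h') = 0 := by
    have : symP a b J v β z t * (g + Real.pi * Complex.I * h - Complex.I * J) *
        (symM a b J v β z t * (g' + Real.pi * Complex.I * h' + Complex.I * J)) =
        symM a b J v β z t * (g - Real.pi * Complex.I * h - Complex.I * J) *
        (symP a b J v β z t * (g' - Real.pi * Complex.I * h' + Complex.I * J)) := by rw [c1, c2]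
    linear_combination this
  rcases mul_eq_zero.mp c3 with h0 | h0
  · simp [e3.1, e3.2, hpi] at h0
  · exact h0

lemma cauchyT_add_mul (h₁ h₂ : L2R) {w : ℂ} (hw : w.im ≠ 0) (c d : ℂ) :
    ∫ t, ((h₁ t * hilbertT h₂ t + h₂ t * hilbertT h₁ t) + c * h₁ t - d * h₂ t) * cauchyKer w t =
      cauchyT h₁ w * cauchyT h₂ w + c * cauchyT h₁ w - d * cauchyT h₂ w := by
  obtain ⟨i0, e0⟩ := integral_hilbertT_product h₁ h₂ hw
  have i1 := (integrable_mul_cauchyKer h₁ hw).const_mul c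
  have i2 := (integrable_mul_cauchyKer h₂ hw).const_mul d
  have i01 : Integrable fun t => (h₁ t * hilbertT h₂ t + h₂ t * hilbertT h₁ t) * cauchyKer w t +
      c * (h₁ t * cauchyKer w t) := i0.add i1
  have : ∀ t, ((h₁ t * hilbertT h₂ t + h₂ t * hilbertT h₁ t) + c * h₁ t - d * h₂ t) * cauchyKer w t =
      (h₁ t * hilbertT h₂ t + h₂ t * hilbertT h₁ t) * cauchyKer w t + c * (h₁ t * cauchyKer w t) -
        d * (h₂ t * cauchyKer w t) := fun t => by ring
  simp_rw [this]
  rw [integral_sub i01 i2, integral_add i0 i1, e0, integral_const_mul, integral_const_mul]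
  rfl

include hJ in
/-- The two solutions are inverse to each other off the line. -/
theorem solution_mul_solutionConj {z : ℂ} (hz : z ∈ resolventSet ℂ (modelY J v hv β hβ)) {w : ℂ}
    (hw : w.im ≠ 0) :
    (cauchyT (density J hv hβ z) w - Complex.I * J) *
      (cauchyT (densityConj J hv hβ z) w + Complex.I * J) = 1 := by
  have h1 := cauchyT_add_mul (density J hv hβ z) (densityConj J hv hβ z) hw (Complex.I * J)
    (Complex.I * J)
  rw [integral_congr_ae (g := fun _ => 0) (by
    filter_upwards [ae_boundary_product hJ hv hβ hz] with t ht
    rw [ht.2.2, zero_mul]), integral_zero] at h1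
  have hJ2 : (J : ℂ) ^ 2 = 1 := by rcases hJ with h | h <;> simp [h]
  linear_combination -h1 - (J : ℂ) ^ 2 * Complex.I_sq + hJ2

include hJ in
lemma ae_boundary_mul_eq_one {z : ℂ} (hz : z ∈ resolventSet ℂ (modelY J v hv β hβ)) :
    ∀ᵐ t : ℝ,
      (hilbertT (density J hv hβ z) t + Real.pi * Complex.I * density J hv hβ z t - Complex.I * J) *
      (hilbertT (densityConj J hv hβ z) t + Real.pi * Complex.I * densityConj J hv hβ z t +
        Complex.I * J) = 1 := by
  filter_upwards [ae_tendsto_cauchyT (density J hv hβ z), ae_tendsto_cauchyT (densityConj J hv hβ z)]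
    with t e1 e2
  refine tendsto_nhds_unique ((e1.1.sub_const _).mul (e2.1.add_const _)) ?_
  refine tendsto_const_nhds.congr' ?_
  filter_upwards [self_mem_nhdsWithin] with ε (hε : 0 < ε)
  exact (solution_mul_solutionConj hJ hv hβ hz (by simpa using hε.ne')).symm

include hJ in
/-- The coefficient `d = (ζ - π ω) / (ζ + π ω)` avoids the cut of the logarithm. For real `z` this
is where the second solution is needed: its boundary values are the conjugates of those of the first
on the other side, so the product relation makes `d` the reciprocal of a squared modulus. -/
theorem ae_dCoef_mem_slitPlane {z : ℂ} (hz : z ∈ resolventSet ℂ (modelY J v hv β hβ)) :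
    ∀ᵐ t : ℝ, dCoef a b J v β z t ∈ Complex.slitPlane := by
  by_cases him : z.im = 0
  · have hzc : conj z = z := Complex.conj_eq_iff_im.mpr him
    filter_upwards [ae_boundary_product hJ hv hβ hz, ae_boundary_mul_eq_one hJ hv hβ hz,
      ae_sym_ne_zero hv hβ hz, coeFn_conjL2 (density J hv hβ z),
      coeFn_conjL2 (hilbertT (density J hv hβ z))] with t e1 e2 e3 e4 e5
    rw [densityConj, hzc, hilbertT_conjL2, e4, e5] at e2
    set A := hilbertT (density J hv hβ z) t - Real.pi * Complex.I * density J hv hβ z t -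
      Complex.I * J with hA
    have e6 : conj (hilbertT (density J hv hβ z) t) +
        Real.pi * Complex.I * conj (density J hv hβ z t) + Complex.I * J = conj A := by
      rw [hA]; simp
    rw [e6] at e2
    have hA0 : A ≠ 0 := fun h0 => by simp [h0] at e2
    have e7 : dCoef a b J v β z t = ((‖A‖ ^ 2)⁻¹ : ℝ) := by
      have hn : ((‖A‖ ^ 2 : ℝ) : ℂ) = A * conj A := by
        rw [Complex.mul_conj, Complex.normSq_eq_norm_sq]
      rw [Complex.ofReal_inv, hn, dCoef_eq, div_eq_iff e3.1]
      have hAc : conj A ≠ 0 := by simpa using hA0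
      field_simp
      linear_combination (conj A) * (-e1.1) + symP a b J v β z t * e2
    rw [e7, Complex.ofReal_mem_slitPlane]
    have := norm_pos_iff.mpr hA0
    positivity
  · exact ae_of_all _ fun t => dCoef_mem_slitPlane_of_im_ne_zero him t

end Jump

/-! ### The exponential representation -/

section Exponent

variable {a b J : ℝ} {v : L2Icc a b} {β : ℝ → ℝ}

lemma log_dCoef_of_notMem (z : ℂ) {t : ℝ} (ht : t ∉ Set.Icc a b) :
    Complex.log (dCoef a b J v β z t) = 0 := by
  rw [dCoef_eq, symP, symM, omegaFn_of_notMem ht]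
  by_cases h : zetaFn a b β z t = 0 <;> simp [h]

lemma exists_abs_omegaFn_le (hJ : J = 1 ∨ J = -1) (hv : MemLp v ⊤ (lebIcc a b)) :
    ∃ M : ℝ, 0 ≤ M ∧ ∀ᵐ t : ℝ, |omegaFn a b J v t| ≤ M := by
  obtain ⟨M, h0, h⟩ := exists_bound_of_memLp_top hv
  refine ⟨M ^ 2, by positivity, ?_⟩
  filter_upwards [h] with t ht
  have hJ1 : |J| = 1 := by rcases hJ with rfl | rfl <;> simp
  rw [omegaFn, abs_mul, hJ1, one_mul, abs_of_nonneg (by positivity)]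
  exact pow_le_pow_left₀ (norm_nonneg _) ht 2

lemma norm_log_dCoef_le {M δ : ℝ} (hδ : 0 < δ) {z : ℂ} {t : ℝ} (hM : |omegaFn a b J v t| ≤ M)
    (hP : δ ≤ ‖symP a b J v β z t‖) (hN : δ ≤ ‖symM a b J v β z t‖) :
    ‖Complex.log (dCoef a b J v β z t)‖ ≤ Real.log (1 + 2 * Real.pi * M / δ) + Real.pi := by
  have hpi := Real.pi_pos
  have hM0 : 0 ≤ M := (abs_nonneg _).trans hM
  have hP0 : 0 < ‖symP a b J v β z t‖ := hδ.trans_le hP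
  have hN0 : 0 < ‖symM a b J v β z t‖ := hδ.trans_le hN
  have hw : ‖(2 * Real.pi * omegaFn a b J v t : ℂ)‖ ≤ 2 * Real.pi * M := by
    rw [norm_mul, norm_mul, Complex.norm_real, Complex.norm_real, Real.norm_of_nonneg hpi.le,
      Real.norm_eq_abs]
    simp only [Complex.norm_ofNat]
    gcongr
  have gen : ∀ p q : ℂ, δ ≤ ‖q‖ → ‖p - q‖ ≤ 2 * Real.pi * M →
      ‖p‖ / ‖q‖ ≤ 1 + 2 * Real.pi * M / δ := by
    intro p q hq hpq
    have hq0 : 0 < ‖q‖ := hδ.trans_le hq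
    have h1 : ‖p‖ ≤ ‖q‖ + 2 * Real.pi * M := by
      have := norm_le_norm_add_norm_sub' p q
      linarith
    calc ‖p‖ / ‖q‖ ≤ (‖q‖ + 2 * Real.pi * M) / ‖q‖ := by gcongr
      _ = 1 + 2 * Real.pi * M / ‖q‖ := by field_simp
      _ ≤ _ := by gcongr
  have g1 := gen (symM a b J v β z t) (symP a b J v β z t) hP (by
    have e : symM a b J v β z t - symP a b J v β z t = -(2 * Real.pi * omegaFn a b J v t : ℂ) := by
      simp only [symP, symM]; ring
    rwa [e, norm_neg])
  have g2 := gen (symP a b J v β z t) (symM a b J v β z t) hN (by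
    have e : symP a b J v β z t - symM a b J v β z t = (2 * Real.pi * omegaFn a b J v t : ℂ) := by
      simp only [symP, symM]; ring
    rwa [e])
  have hn : ‖dCoef a b J v β z t‖ = ‖symM a b J v β z t‖ / ‖symP a b J v β z t‖ := by
    rw [dCoef_eq, norm_div]
  have hlog : |Real.log ‖dCoef a b J v β z t‖| ≤ Real.log (1 + 2 * Real.pi * M / δ) := by
    rw [hn, abs_le]
    constructor
    · rw [neg_le, ← Real.log_inv, inv_div]
      exact Real.log_le_log (by positivity) g2
    · exact Real.log_le_log (by positivity) g1
  rw [Complex.log]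
  refine (norm_add_le _ _).trans (add_le_add ?_ ?_)
  · rwa [Complex.norm_real, Real.norm_eq_abs]
  · rw [norm_mul, Complex.norm_I, mul_one, Complex.norm_real, Real.norm_eq_abs]
    exact Complex.abs_arg_le_pi _

lemma aemeasurable_sym (hβ : MemLp β ⊤ (lebIcc a b)) (z : ℂ) :
    AEMeasurable (symP a b J v β z) volume ∧ AEMeasurable (symM a b J v β z) volume := by
  have h1 : AEMeasurable ((Set.Icc a b).indicator β) volume :=
    (aemeasurable_indicator_iff measurableSet_Icc).mpr hβ.1.aemeasurable
  have h2 : AEMeasurable ((Set.Icc a b).indicator v) volume :=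
    (aemeasurable_indicator_iff measurableSet_Icc).mpr (Lp.aestronglyMeasurable v).aemeasurable
  have h3 : AEMeasurable (zetaFn a b β z) volume :=
    ((aemeasurable_const.add Complex.measurable_ofReal.aemeasurable)).add
      (Complex.measurable_ofReal.comp_aemeasurable h1)
  have h4 : AEMeasurable (fun t => ((omegaFn a b J v t : ℝ) : ℂ)) volume :=
    Complex.measurable_ofReal.comp_aemeasurable ((h2.norm.pow_const 2).const_mul J)
  exact ⟨h3.add (h4.const_mul _), h3.sub (h4.const_mul _)⟩

lemma aemeasurable_log_dCoef (hβ : MemLp β ⊤ (lebIcc a b)) (z : ℂ) :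
    AEMeasurable (fun t => Complex.log (dCoef a b J v β z t)) volume :=
  Complex.measurable_log.comp_aemeasurable
    ((aemeasurable_sym hβ z).2.div (aemeasurable_sym hβ z).1)

lemma memLp_log_dCoef (hJ : J = 1 ∨ J = -1) (hv : MemLp v ⊤ (lebIcc a b))
    (hβ : MemLp β ⊤ (lebIcc a b)) {z : ℂ} (hz : z ∈ resolventSet ℂ (modelY J v hv β hβ)) :
    MemLp (fun t => Complex.log (dCoef a b J v β z t)) 2 volume ∧
      Integrable (fun t => Complex.log (dCoef a b J v β z t)) volume := by
  obtain ⟨M, hM0, hM⟩ := exists_abs_omegaFn_le hJ hv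
  obtain ⟨δ, hδ, h⟩ := exists_pos_le_norm_sym hv hβ hz
  have hind : (Set.Icc a b).indicator (fun t => Complex.log (dCoef a b J v β z t)) =
      fun t => Complex.log (dCoef a b J v β z t) := by
    refine Set.indicator_eq_self.mpr fun t ht => ?_
    by_contra hI
    exact ht (log_dCoef_of_notMem z hI)
  have htop : MemLp (fun t => Complex.log (dCoef a b J v β z t)) ⊤ (lebIcc a b) := by
    refine memLp_top_of_bound (aemeasurable_log_dCoef hβ z).aestronglyMeasurable.restrict
      (Real.log (1 + 2 * Real.pi * M / δ) + Real.pi) ?_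
    rw [ae_restrict_iff' measurableSet_Icc]
    filter_upwards [hM, h] with t h1 h2 ht
    exact norm_log_dCoef_le hδ h1 (h2 ht).1 (h2 ht).2
  constructor
  · rw [← hind]; exact memLp_two_indicator_of_top htop
  · rw [← hind, integrable_indicator_iff measurableSet_Icc]
    exact htop.integrable le_top

/-- Dominated convergence for the Cauchy transforms of the logarithms `ln d`. -/
lemma tendsto_cauchyT_log_dCoef (hJ : J = 1 ∨ J = -1) (hv : MemLp v ⊤ (lebIcc a b))
    (hβ : MemLp β ⊤ (lebIcc a b)) {w : ℂ} (hw : w.im ≠ 0) {l : Filter ℝ} [l.IsCountablyGenerated]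
    {zs : ℝ → ℂ} {L : ℝ → ℂ} {δ : ℝ} (hδ : 0 < δ)
    (hlow : ∀ᶠ r in l, ∀ᵐ t : ℝ, t ∈ Set.Icc a b →
      δ ≤ ‖symP a b J v β (zs r) t‖ ∧ δ ≤ ‖symM a b J v β (zs r) t‖)
    (hlim : ∀ᵐ t : ℝ, Tendsto (fun r => Complex.log (dCoef a b J v β (zs r) t)) l (𝓝 (L t))) :
    Tendsto (fun r => cauchyT (fun t => Complex.log (dCoef a b J v β (zs r) t)) w) l
      (𝓝 (cauchyT L w)) := by
  obtain ⟨M, hM0, hM⟩ := exists_abs_omegaFn_le hJ hv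
  refine tendsto_integral_filter_of_dominated_convergence
    ((Set.Icc a b).indicator fun _ => (Real.log (1 + 2 * Real.pi * M / δ) + Real.pi) * |w.im|⁻¹)
    (Eventually.of_forall fun r => (aemeasurable_log_dCoef hβ _).aestronglyMeasurable.mul
      (continuous_cauchyKer hw).aestronglyMeasurable) ?_ ?_ ?_
  · filter_upwards [hlow] with r hr
    filter_upwards [hr, hM] with t h1 h2
    by_cases ht : t ∈ Set.Icc a b
    · rw [Set.indicator_of_mem ht, norm_mul]
      have h3 := norm_log_dCoef_le hδ h2 (h1 ht).1 (h1 ht).2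
      exact mul_le_mul h3 (norm_cauchyKer_le hw t) (norm_nonneg _) ((norm_nonneg _).trans h3)
    · rw [log_dCoef_of_notMem _ ht]; simp [ht]
  · rw [integrable_indicator_iff measurableSet_Icc]
    exact integrable_const _
  · filter_upwards [hlim] with t ht
    exact ht.mul_const _

lemma hasDerivAt_log_dCoef {z : ℂ} (hs : symP a b J v β z t ≠ 0 ∧ symM a b J v β z t ≠ 0)
    (hd : dCoef a b J v β z t ∈ Complex.slitPlane) :
    HasDerivAt (fun z => Complex.log (dCoef a b J v β z t))
      ((symM a b J v β z t)⁻¹ - (symP a b J v β z t)⁻¹) z := by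
  have h0 : HasDerivAt (fun z => zetaFn a b β z t) 1 z :=
    ((hasDerivAt_id z).add_const _).add_const _
  have h1 : HasDerivAt (fun z => symP a b J v β z t) 1 z := h0.add_const _
  have h2 : HasDerivAt (fun z => symM a b J v β z t) 1 z := h0.sub_const _
  have h3 := (h2.div h1 hs.1).clog hd
  refine h3.congr_deriv ?_
  have e1 := hs.1
  have e2 := hs.2
  simp only [Pi.div_apply]
  field_simp

lemma hasDerivAt_cauchyT_log_dCoef (hJ : J = 1 ∨ J = -1) (hv : MemLp v ⊤ (lebIcc a b))
    (hβ : MemLp β ⊤ (lebIcc a b)) {z w : ℂ} (hz : z.im ≠ 0) (hw : w.im ≠ 0) :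
    HasDerivAt (fun z => cauchyT (fun t => Complex.log (dCoef a b J v β z t)) w)
      (cauchyT (fun t => (symM a b J v β z t)⁻¹ - (symP a b J v β z t)⁻¹) w) z := by
  have hz0 : 0 < |z.im| := abs_pos.mpr hz
  have hball : ∀ y ∈ Metric.ball z (|z.im| / 2), |z.im| / 2 ≤ |y.im| := by
    intro y hy
    have h1 : |y.im - z.im| < |z.im| / 2 := by
      have := Complex.abs_im_le_norm (y - z)
      rw [Metric.mem_ball, dist_eq_norm] at hy
      simpa using this.trans_lt hy
    have := abs_sub_abs_le_abs_sub z.im y.im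
    rw [abs_sub_comm] at this
    linarith
  have him : ∀ y ∈ Metric.ball z (|z.im| / 2), y.im ≠ 0 := fun y hy =>
    abs_pos.mp (lt_of_lt_of_le (by positivity) (hball y hy))
  refine (hasDerivAt_integral_of_dominated_loc_of_deriv_le
    (F := fun z t => Complex.log (dCoef a b J v β z t) * cauchyKer w t)
    (F' := fun z t => ((symM a b J v β z t)⁻¹ - (symP a b J v β z t)⁻¹) * cauchyKer w t)
    (bound := (Set.Icc a b).indicator fun _ => (2 * (|z.im| / 2)⁻¹) * |w.im|⁻¹)
    (Metric.ball_mem_nhds z (half_pos hz0))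
    (Eventually.of_forall fun y => (aemeasurable_log_dCoef hβ _).aestronglyMeasurable.mul
      (continuous_cauchyKer hw).aestronglyMeasurable) ?_ ?_ ?_ ?_ ?_).2
  · exact (memLp_log_dCoef hJ hv hβ (mem_resolventSet_of_im_ne_zero
      (isSelfAdjoint_modelY J hv hβ) hz)).1.integrable_mul (memLp_cauchyKer hw)
  · exact ((aemeasurable_sym hβ z).2.inv.sub (aemeasurable_sym hβ z).1.inv).aestronglyMeasurable.mul
      (continuous_cauchyKer hw).aestronglyMeasurable
  · refine ae_of_all _ fun t y hy => ?_
    by_cases ht : t ∈ Set.Icc a b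
    · rw [Set.indicator_of_mem ht, norm_mul]
      refine mul_le_mul ?_ (norm_cauchyKer_le hw t) (norm_nonneg _) (by positivity)
      obtain ⟨h1, h2⟩ := abs_im_le_norm_sym (a := a) (b := b) (J := J) (v := v) (β := β) y t
      refine (norm_sub_le _ _).trans ?_
      rw [norm_inv, norm_inv, two_mul]
      have := hball y hy
      exact add_le_add (inv_anti₀ (by positivity) (this.trans h2))
        (inv_anti₀ (by positivity) (this.trans h1))
    · simp [symM, symP, omegaFn_of_notMem ht, ht]
  · rw [integrable_indicator_iff measurableSet_Icc]
    exact integrable_const _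
  · exact ae_of_all _ fun t y hy => (hasDerivAt_log_dCoef (sym_ne_zero_of_im_ne_zero (him y hy) t)
      (dCoef_mem_slitPlane_of_im_ne_zero (him y hy) t)).mul_const _

lemma cauchyT_eq_inner (h : L2R) {w : ℂ} (hw : w.im ≠ 0) :
    cauchyT h w = inner ℂ (cauchyL2 (conj w) (by simpa using hw)) h := by
  rw [inner_cauchyL2, Complex.conj_conj]; rfl

variable (hJ : J = 1 ∨ J = -1) (hv : MemLp v ⊤ (lebIcc a b)) (hβ : MemLp β ⊤ (lebIcc a b))

/-- The derivative of `density` with respect to the spectral parameter. -/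
def densityDeriv (J : ℝ) (hv : MemLp v ⊤ (lebIcc a b)) (hβ : MemLp β ⊤ (lebIcc a b)) (z : ℂ) :
    L2R :=
  weightOp v hv (-resolvent (modelY J v hv β hβ) z (resolvent (modelY J v hv β hβ) z v))

lemma hasDerivAt_cauchyT_density {z : ℂ} (hz : z ∈ resolventSet ℂ (modelY J v hv β hβ)) {w : ℂ}
    (hw : w.im ≠ 0) :
    HasDerivAt (fun z => cauchyT (density J hv hβ z) w) (cauchyT (densityDeriv J hv hβ z) w) z := by
  simp_rw [fun z => cauchyT_eq_inner (density J hv hβ z) hw,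
    cauchyT_eq_inner (densityDeriv J hv hβ z) hw]
  have h1 := (spectrum.hasDerivAt_resolvent_const_left hz).clm_apply (hasDerivAt_const z v)
  have h2 := (((innerSL ℂ (cauchyL2 (conj w) (by simpa using hw))).comp
    (weightOp v hv)).hasFDerivAt (x := resolvent (modelY J v hv β hβ) z v)).comp_hasDerivAt z h1
  refine h2.congr_deriv ?_
  simp [densityDeriv, sq]

include hJ in
lemma ae_boundary_densityDeriv {z : ℂ} (hz : z ∈ resolventSet ℂ (modelY J v hv β hβ)) :
    ∀ᵐ t : ℝ, (2 * Real.pi * Complex.I) *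
      ((densityDeriv J hv hβ z t * hilbertT (densityConj J hv hβ z) t +
        densityConj J hv hβ z t * hilbertT (densityDeriv J hv hβ z) t) +
        Complex.I * J * densityDeriv J hv hβ z t) =
      (symM a b J v β z t)⁻¹ - (symP a b J v β z t)⁻¹ := by
  have heq : z • (-resolvent (modelY J v hv β hβ) z (resolvent (modelY J v hv β hβ) z v)) -
      modelY J v hv β hβ (-resolvent (modelY J v hv β hβ) z (resolvent (modelY J v hv β hβ) z v)) =
      -resolvent (modelY J v hv β hβ) z v := by
    rw [map_neg, smul_neg, ← neg_sub', (resolvent_apply_spec hz _).1]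
  have hneg : ∀ᵐ t : ℝ, weightOp v hv (-resolvent (modelY J v hv β hβ) z v) t =
      -density J hv hβ z t := by
    rw [map_neg]
    exact Lp.coeFn_neg _
  filter_upwards [ae_jump_of_eq hv hβ heq, hneg, ae_boundary_product hJ hv hβ hz,
    ae_boundary_mul_eq_one hJ hv hβ hz, ae_sym_ne_zero hv hβ hz] with t e0 e1 ⟨c1, c2, _⟩ e3 e4
  rw [e1] at e0
  change zetaFn a b β z t * densityDeriv J hv hβ z t -
    Complex.I * omegaFn a b J v t * hilbertT (densityDeriv J hv hβ z) t = -density J hv hβ z t at e0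
  set h := density J hv hβ z t
  set h' := densityConj J hv hβ z t
  set g := hilbertT (density J hv hβ z) t
  set g' := hilbertT (densityConj J hv hβ z) t
  set q := densityDeriv J hv hβ z t
  set q' := hilbertT (densityDeriv J hv hβ z) t
  have e5 : symP a b J v β z t * (q' + Real.pi * Complex.I * q) -
      symM a b J v β z t * (q' - Real.pi * Complex.I * q) = -(2 * Real.pi * Complex.I * h) := by
    simp only [symP, symM]
    linear_combination (2 * Real.pi * Complex.I) * e0 +
      (2 * Real.pi * omegaFn a b J v t * q') * Complex.I_sq
  obtain ⟨hp, hm⟩ := e4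
  set p := symP a b J v β z t
  set m := symM a b J v β z t
  have e6 : p * m * ((2 * Real.pi * Complex.I) * ((q * g' + h' * q') + Complex.I * J * q)) =
      p - m := by
    set B := g' + Real.pi * Complex.I * h' + Complex.I * J with hB
    linear_combination (m * B) * e5 + (q' - Real.pi * Complex.I * q) * m * c2 - B * c1 +
      (p - m) * e3
  field_simp
  linear_combination e6

include hJ in
/-- The logarithmic derivative of the solution in the spectral parameter. -/
lemma cauchyT_densityDeriv {z : ℂ} (hz : z ∈ resolventSet ℂ (modelY J v hv β hβ)) {w : ℂ}
    (hw : w.im ≠ 0) :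
    cauchyT (densityDeriv J hv hβ z) w = (2 * Real.pi * Complex.I)⁻¹ *
      cauchyT (fun t => (symM a b J v β z t)⁻¹ - (symP a b J v β z t)⁻¹) w *
      (cauchyT (density J hv hβ z) w - Complex.I * J) := by
  have h1 := cauchyT_add_mul (densityDeriv J hv hβ z) (densityConj J hv hβ z) hw (Complex.I * J) 0
  have hpi : (2 * Real.pi * Complex.I : ℂ) ≠ 0 := by simp [Real.pi_ne_zero]
  have h2 : cauchyT (fun t => (symM a b J v β z t)⁻¹ - (symP a b J v β z t)⁻¹) w =
      (2 * Real.pi * Complex.I) * (cauchyT (densityDeriv J hv hβ z) w *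
        (cauchyT (densityConj J hv hβ z) w + Complex.I * J)) := by
    have h3 : cauchyT (densityDeriv J hv hβ z) w * (cauchyT (densityConj J hv hβ z) w + Complex.I * J) =
      cauchyT (densityDeriv J hv hβ z) w * cauchyT (densityConj J hv hβ z) w +
        Complex.I * J * cauchyT (densityDeriv J hv hβ z) w - 0 * cauchyT (densityConj J hv hβ z) w := by
      ring
    rw [h3, ← h1, ← integral_const_mul, cauchyT]
    refine integral_congr_ae ?_
    filter_upwards [ae_boundary_densityDeriv hJ hv hβ hz] with t ht
    rw [← ht]; ring
  rw [h2, inv_mul_cancel_left₀ hpi]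
  linear_combination (-cauchyT (densityDeriv J hv hβ z) w) * solution_mul_solutionConj hJ hv hβ hz hw

/-- The exponent `(1 / 2πi) ∫ ln d(t, z) / (t - w) dt`. -/
def expo (a b J : ℝ) (v : ℝ → ℂ) (β : ℝ → ℝ) (z w : ℂ) : ℂ :=
  (2 * Real.pi * Complex.I)⁻¹ * cauchyT (fun t => Complex.log (dCoef a b J v β z t)) w

lemma tendsto_abs_im_vertical (z : ℂ) {σ : ℝ} (hσ : σ ≠ 0) :
    Tendsto (fun r : ℝ => |(z + (σ * r : ℝ) * Complex.I).im|) atTop atTop := by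
  have h1 : Tendsto (fun r : ℝ => |σ| * r - |z.im|) atTop atTop :=
    tendsto_atTop_add_const_right _ _ (tendsto_id.const_mul_atTop (abs_pos.mpr hσ))
  refine tendsto_atTop_mono' _ ?_ h1
  filter_upwards [eventually_ge_atTop 0] with r hr
  have h2 : (z + (σ * r : ℝ) * Complex.I).im = z.im + σ * r := by simp
  have h3 := abs_sub_abs_le_abs_sub (σ * r) (-z.im)
  rw [abs_mul, abs_of_nonneg hr, abs_neg] at h3
  rw [h2, show z.im + σ * r = σ * r - -z.im by ring]
  exact h3

lemma tendsto_density_vertical (z : ℂ) {σ : ℝ} (hσ : σ ≠ 0) {w : ℂ} (hw : w.im ≠ 0) :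
    Tendsto (fun r : ℝ => cauchyT (density J hv hβ (z + (σ * r : ℝ) * Complex.I)) w) atTop (𝓝 0) := by
  have h1 : Tendsto (fun r : ℝ => z + (σ * r : ℝ) * Complex.I) atTop (Bornology.cobounded ℂ) := by
    rw [← tendsto_norm_atTop_iff_cobounded]
    exact tendsto_atTop_mono (fun r => Complex.abs_im_le_norm _) (tendsto_abs_im_vertical z hσ)
  have h2 := (spectrum.resolvent_tendsto_cobounded (modelY J v hv β hβ)).comp h1
  let Λ : (L2Icc a b →L[ℂ] L2Icc a b) →L[ℂ] ℂ :=
    ((innerSL ℂ (cauchyL2 (conj w) (by simpa using hw))).comp (weightOp v hv)).comp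
      (ContinuousLinearMap.apply ℂ (L2Icc a b) v)
  have h3 := (Λ.continuous.tendsto 0).comp h2
  rw [map_zero] at h3
  refine h3.congr fun r => ?_
  rw [cauchyT_eq_inner _ hw]
  rfl

include hJ hv hβ in
lemma tendsto_expo_vertical (z : ℂ) {σ : ℝ} (hσ : σ ≠ 0) {w : ℂ} (hw : w.im ≠ 0) :
    Tendsto (fun r : ℝ => expo a b J v β (z + (σ * r : ℝ) * Complex.I) w) atTop (𝓝 0) := by
  have him := tendsto_abs_im_vertical z hσ
  have h1 := tendsto_cauchyT_log_dCoef hJ hv hβ hw (l := atTop)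
    (zs := fun r : ℝ => z + (σ * r : ℝ) * Complex.I) (L := fun _ => 0) one_pos ?_ ?_
  · have h2 := h1.const_mul (2 * Real.pi * Complex.I)⁻¹
    rwa [show cauchyT (fun _ => 0) w = 0 by simp [cauchyT], mul_zero] at h2
  · filter_upwards [him.eventually_ge_atTop 1] with r hr
    refine ae_of_all _ fun t _ => ?_
    obtain ⟨h1, h2⟩ := abs_im_le_norm_sym (a := a) (b := b) (J := J) (v := v) (β := β)
      (z + (σ * r : ℝ) * Complex.I) t
    exact ⟨hr.trans h1, hr.trans h2⟩
  · refine ae_of_all _ fun t => ?_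
    have hcob : Tendsto (fun r : ℝ => symP a b J v β (z + (σ * r : ℝ) * Complex.I) t) atTop
        (Bornology.cobounded ℂ) := by
      rw [← tendsto_norm_atTop_iff_cobounded]
      exact tendsto_atTop_mono (fun r => (abs_im_le_norm_sym _ t).1) him
    have h2 : Tendsto (fun r : ℝ => 1 - (2 * Real.pi * omegaFn a b J v t : ℂ) *
        (symP a b J v β (z + (σ * r : ℝ) * Complex.I) t)⁻¹) atTop (𝓝 1) := by
      simpa using ((tendsto_inv₀_cobounded.comp hcob).const_mul
        (2 * Real.pi * omegaFn a b J v t : ℂ)).const_sub 1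
    have h3 : Tendsto (fun r : ℝ => dCoef a b J v β (z + (σ * r : ℝ) * Complex.I) t) atTop
        (𝓝 1) := by
      refine h2.congr' ?_
      filter_upwards [him.eventually_gt_atTop 0] with r hr
      have h4 := (sym_ne_zero_of_im_ne_zero (a := a) (b := b) (J := J) (v := v) (β := β)
        (abs_pos.mp hr) t).1
      rw [dCoef_eq, eq_div_iff h4, sub_mul, inv_mul_cancel_right₀ h4]
      simp only [symP, symM]; ring
    simpa using h3.clog (by simp)

include hJ in
lemma solution_eq_exp_of_preconnected {s : Set ℂ} (hs : IsOpen s) (hs' : IsPreconnected s)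
    (him : ∀ z ∈ s, z.im ≠ 0) {σ : ℝ} (hσ : σ ≠ 0)
    (hray : ∀ z ∈ s, ∀ r : ℝ, 0 ≤ r → z + (σ * r : ℝ) * Complex.I ∈ s) {z w : ℂ} (hz : z ∈ s)
    (hw : w.im ≠ 0) :
    cauchyT (density J hv hβ z) w - Complex.I * J =
      -(Complex.I * J) * Complex.exp (expo a b J v β z w) := by
  set Q : ℂ → ℂ := fun z => (cauchyT (density J hv hβ z) w - Complex.I * J) *
    Complex.exp (-expo a b J v β z w) with hQ
  have hder : ∀ y ∈ s, HasDerivAt Q 0 y := by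
    intro y hy
    have hyr := mem_resolventSet_of_im_ne_zero (isSelfAdjoint_modelY J hv hβ) (him y hy)
    have h1 := (hasDerivAt_cauchyT_density hv hβ hyr hw).sub_const (Complex.I * J)
    have h2 := ((hasDerivAt_cauchyT_log_dCoef hJ hv hβ (him y hy) hw).const_mul
      (2 * Real.pi * Complex.I)⁻¹).neg.cexp
    refine (h1.mul h2).congr_deriv ?_
    rw [cauchyT_densityDeriv hJ hv hβ hyr hw]
    ring
  have hconst : ∀ r : ℝ, 0 ≤ r → Q (z + (σ * r : ℝ) * Complex.I) = Q z := fun r hr =>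
    hs.is_const_of_deriv_eq_zero hs' (fun y hy => (hder y hy).differentiableAt.differentiableWithinAt)
      (fun y hy => (hder y hy).deriv) (hray z hz r hr) hz
  have hlim : Tendsto (fun r : ℝ => Q (z + (σ * r : ℝ) * Complex.I)) atTop
      (𝓝 ((0 - Complex.I * J) * Complex.exp (-0))) :=
    ((tendsto_density_vertical hv hβ z hσ hw).sub_const _).mul
      (tendsto_expo_vertical hJ hv hβ z hσ hw).neg.cexp
  have hlim' : Tendsto (fun r : ℝ => Q (z + (σ * r : ℝ) * Complex.I)) atTop (𝓝 (Q z)) := by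
    refine tendsto_const_nhds.congr' ?_
    filter_upwards [eventually_ge_atTop 0] with r hr using (hconst r hr).symm
  have h := tendsto_nhds_unique hlim' hlim
  simp only [hQ, neg_zero, Complex.exp_zero, mul_one, zero_sub] at h
  rw [← h, mul_assoc, ← Complex.exp_add, neg_add_cancel, Complex.exp_zero, mul_one]

include hJ in
/-- For non-real spectral parameter the solution of the jump problem is an exponential. On each
half-plane both sides have the same logarithmic derivative in the spectral parameter, and they have
the same limit at infinity along vertical rays. -/
theorem solution_eq_exp_of_im_ne_zero {z w : ℂ} (hz : z.im ≠ 0) (hw : w.im ≠ 0) :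
    cauchyT (density J hv hβ z) w - Complex.I * J =
      -(Complex.I * J) * Complex.exp (expo a b J v β z w) := by
  rcases lt_or_gt_of_ne hz with h | h
  · refine solution_eq_exp_of_preconnected hJ hv hβ (s := {z | z.im < 0})
      (isOpen_lt Complex.continuous_im continuous_const) (convex_halfSpace_im_lt 0).isPreconnected
      (fun z hz => ne_of_lt hz) (σ := -1) (by norm_num) (fun z hz r hr => ?_) h hw
    have : z.im < 0 := hz
    simp
    linarith
  · refine solution_eq_exp_of_preconnected hJ hv hβ (s := {z | 0 < z.im})
      (isOpen_lt continuous_const Complex.continuous_im) (convex_halfSpace_im_gt 0).isPreconnected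
      (fun z hz => ne_of_gt hz) (σ := 1) (by norm_num) (fun z hz r hr => ?_) h hw
    have : 0 < z.im := hz
    simp
    linarith

include hJ in
/-- The exponential representation at every regular point. Real points are limits of non-real ones,
and the logarithm stays continuous since `d` avoids its cut. -/
theorem solution_eq_exp {z w : ℂ} (hz : z ∈ resolventSet ℂ (modelY J v hv β hβ)) (hw : w.im ≠ 0) :
    cauchyT (density J hv hβ z) w - Complex.I * J =
      -(Complex.I * J) * Complex.exp (expo a b J v β z w) := by
  by_cases him : z.im = 0
  swap
  · exact solution_eq_exp_of_im_ne_zero hJ hv hβ him hw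
  have hpath : Tendsto (fun r : ℝ => z + r * Complex.I) (𝓝[>] 0) (𝓝 z) := by
    have : Continuous fun r : ℝ => z + r * Complex.I := by fun_prop
    have h := (this.tendsto 0).mono_left (nhdsWithin_le_nhds (s := Set.Ioi 0))
    simpa using h
  have hF : Tendsto (fun r : ℝ => cauchyT (density J hv hβ (z + r * Complex.I)) w) (𝓝[>] 0)
      (𝓝 (cauchyT (density J hv hβ z) w)) :=
    (hasDerivAt_cauchyT_density hv hβ hz hw).continuousAt.tendsto.comp hpath
  obtain ⟨δ, hδ, hlow⟩ := exists_pos_le_norm_sym hv hβ hz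
  have hE : Tendsto (fun r : ℝ => expo a b J v β (z + r * Complex.I) w) (𝓝[>] 0)
      (𝓝 (expo a b J v β z w)) := by
    refine (tendsto_cauchyT_log_dCoef hJ hv hβ hw (zs := fun r : ℝ => z + r * Complex.I)
      (L := fun t => Complex.log (dCoef a b J v β z t)) hδ
      (Eventually.of_forall fun r => ?_) ?_).const_mul _
    · filter_upwards [hlow] with t ht hI
      obtain ⟨h1, h2⟩ := ht hI
      have key : ∀ c : ℂ, c.im = 0 → ‖c‖ ≤ ‖c + r * Complex.I‖ := by
        intro c hc
        have e1 : ‖c‖ = |c.re| := by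
          rw [← Complex.re_add_im c, hc]; simp
        have e2 := Complex.abs_re_le_norm (c + r * Complex.I)
        simp only [Complex.add_re, Complex.re_ofReal_mul, Complex.I_re, mul_zero, add_zero] at e2
        rw [e1]; exact e2
      have e1 : symP a b J v β (z + r * Complex.I) t = symP a b J v β z t + r * Complex.I := by
        simp only [symP, zetaFn]; ring
      have e2 : symM a b J v β (z + r * Complex.I) t = symM a b J v β z t + r * Complex.I := by
        simp only [symM, zetaFn]; ring
      rw [e1, e2]
      exact ⟨h1.trans (key _ (by simp [symP, zetaFn, him])),
        h2.trans (key _ (by simp [symM, zetaFn, him]))⟩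
    · filter_upwards [ae_sym_ne_zero hv hβ hz, ae_dCoef_mem_slitPlane hJ hv hβ hz] with t h1 h2
      exact (hasDerivAt_log_dCoef h1 h2).continuousAt.tendsto.comp hpath
  refine tendsto_nhds_unique (hF.sub_const _) ((hE.cexp.const_mul (-(Complex.I * J))).congr' ?_)
  filter_upwards [self_mem_nhdsWithin] with r (hr : 0 < r)
  exact (solution_eq_exp_of_im_ne_zero hJ hv hβ (by simpa [him] using hr.ne') hw).symm

end Exponent

/-! ### The closed form -/

section ClosedForm

variable {a b J : ℝ} {v : L2Icc a b} {β : ℝ → ℝ}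

lemma exists_pos_le_norm_sub {z : ℂ} (hzI : ∀ t ∈ Set.Icc a b, (t : ℂ) ≠ z) :
    ∃ δ : ℝ, 0 < δ ∧ ∀ t ∈ Set.Icc a b, δ ≤ ‖(t : ℂ) - z‖ := by
  rcases (Set.Icc a b).eq_empty_or_nonempty with h | h
  · exact ⟨1, one_pos, by simp [h]⟩
  · obtain ⟨x, hx, hmin⟩ := isCompact_Icc.exists_isMinOn h
      (f := fun t : ℝ => ‖(t : ℂ) - z‖) (by fun_prop)
    exact ⟨_, norm_pos_iff.mpr (sub_ne_zero.mpr (hzI x hx)), fun t ht => hmin ht⟩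

lemma norm_cauchyKer_le_inv {δ : ℝ} (hδ : 0 < δ) {z : ℂ} {t : ℝ} (h : δ ≤ ‖(t : ℂ) - z‖) :
    ‖cauchyKer z t‖ ≤ δ⁻¹ := by
  rw [cauchyKer, norm_inv]; exact inv_anti₀ hδ h

lemma integrable_mul_cauchyKer_of_support {h : ℝ → ℂ} (hi : Integrable h)
    (hsupp : ∀ᵐ t : ℝ, t ∉ Set.Icc a b → h t = 0) {z : ℂ}
    (hzI : ∀ t ∈ Set.Icc a b, (t : ℂ) ≠ z) : Integrable fun t => h t * cauchyKer z t := by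
  obtain ⟨δ, hδ, hb⟩ := exists_pos_le_norm_sub hzI
  refine (hi.norm.mul_const δ⁻¹).mono' (hi.1.mul (measurable_cauchyKer z).aestronglyMeasurable) ?_
  filter_upwards [hsupp] with t ht
  rw [norm_mul]
  by_cases hI : t ∈ Set.Icc a b
  · exact mul_le_mul_of_nonneg_left (norm_cauchyKer_le_inv hδ (hb t hI)) (norm_nonneg _)
  · simp [ht hI]

/-- The Cauchy transform is continuous off the support of its density. -/
lemma tendsto_cauchyT_of_support {h : ℝ → ℂ} (hi : Integrable h)
    (hsupp : ∀ᵐ t : ℝ, t ∉ Set.Icc a b → h t = 0) {z : ℂ}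
    (hzI : ∀ t ∈ Set.Icc a b, (t : ℂ) ≠ z) :
    Tendsto (fun ε : ℝ => cauchyT h (z + ε * Complex.I)) (𝓝[>] 0) (𝓝 (cauchyT h z)) := by
  obtain ⟨δ, hδ, hb⟩ := exists_pos_le_norm_sub hzI
  refine tendsto_integral_filter_of_dominated_convergence (fun t => ‖h t‖ * (δ / 2)⁻¹)
    (Eventually.of_forall fun ε => hi.1.mul (measurable_cauchyKer _).aestronglyMeasurable) ?_
    (hi.norm.mul_const _) ?_
  · filter_upwards [self_mem_nhdsWithin, nhdsWithin_le_nhds (Iio_mem_nhds (half_pos hδ))]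
      with ε (hε : 0 < ε) (hε2 : ε < δ / 2)
    filter_upwards [hsupp] with t ht
    rw [norm_mul]
    by_cases hI : t ∈ Set.Icc a b
    · refine mul_le_mul_of_nonneg_left (norm_cauchyKer_le_inv (half_pos hδ) ?_) (norm_nonneg _)
      have h1 := norm_sub_norm_le ((t : ℂ) - z) (ε * Complex.I)
      have h2 : ‖(ε * Complex.I : ℂ)‖ = ε := by simp [abs_of_pos hε]
      rw [h2] at h1
      rw [← sub_sub]
      linarith [hb t hI]
    · simp [ht hI]
  · filter_upwards [hsupp] with t ht
    by_cases hI : t ∈ Set.Icc a b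
    · have h1 : Continuous fun ε : ℝ => (t : ℂ) - (z + ε * Complex.I) := by fun_prop
      have h2 := (h1.tendsto 0).mono_left (nhdsWithin_le_nhds (s := Set.Ioi 0))
      simp only [Complex.ofReal_zero, zero_mul, add_zero] at h2
      exact (h2.inv₀ (sub_ne_zero.mpr (hzI t hI))).const_mul (h t)
    · simp [ht hI]

variable (hJ : J = 1 ∨ J = -1) (hv : MemLp v ⊤ (lebIcc a b)) (hβ : MemLp β ⊤ (lebIcc a b))

lemma density_support (z : ℂ) : Integrable (density J hv hβ z) ∧
    ∀ᵐ t : ℝ, t ∉ Set.Icc a b → density J hv hβ z t = 0 := by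
  refine ⟨integrable_weightOp hv _, ?_⟩
  filter_upwards [coeFn_weightOp hv (resolvent (modelY J v hv β hβ) z v)] with t ht hI
  rw [density, ht, Set.indicator_of_notMem hI]

lemma densityConj_support (z : ℂ) : Integrable (densityConj J hv hβ z) ∧
    ∀ᵐ t : ℝ, t ∉ Set.Icc a b → densityConj J hv hβ z t = 0 := by
  obtain ⟨h1, h2⟩ := density_support (J := J) hv hβ (conj z)
  have h3 := coeFn_conjL2 (density J hv hβ (conj z))
  constructor
  · refine (integrable_congr h3).mpr (h1.norm.mono ?_ (ae_of_all _ fun t => by simp))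
    exact (Complex.continuous_conj.comp_aestronglyMeasurable h1.1)
  · filter_upwards [h2, h3] with t e1 e2 hI
    rw [densityConj, e2, e1 hI, map_zero]

include hJ in
lemma solutionConj_eq_exp {z w : ℂ} (hz : z ∈ resolventSet ℂ (modelY J v hv β hβ))
    (hw : w.im ≠ 0) :
    cauchyT (densityConj J hv hβ z) w + Complex.I * J =
      Complex.I * J * Complex.exp (-expo a b J v β z w) := by
  have h1 := solution_mul_solutionConj hJ hv hβ hz hw
  rw [solution_eq_exp hJ hv hβ hz hw] at h1
  have hJ2 : (J : ℂ) ^ 2 = 1 := by rcases hJ with h | h <;> simp [h]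
  have h2 : Complex.exp (-expo a b J v β z w) * Complex.exp (expo a b J v β z w) = 1 := by
    rw [← Complex.exp_add, neg_add_cancel, Complex.exp_zero]
  linear_combination (Complex.I * J * Complex.exp (-expo a b J v β z w)) * h1 +
    (Complex.I ^ 2 * J ^ 2 * (cauchyT (densityConj J hv hβ z) w + Complex.I * J)) * h2 +
    (cauchyT (densityConj J hv hβ z) w + Complex.I * J) * J ^ 2 * Complex.I_sq -
    (cauchyT (densityConj J hv hβ z) w + Complex.I * J) * hJ2

include hJ in
/-- The exponential representations extend to all points off `[a, b]`. -/
lemma solution_eq_exp_self {z : ℂ} (hz : z ∈ resolventSet ℂ (modelY J v hv β hβ))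
    (hzI : ∀ t ∈ Set.Icc a b, (t : ℂ) ≠ z) :
    cauchyT (density J hv hβ z) z - Complex.I * J =
      -(Complex.I * J) * Complex.exp (expo a b J v β z z) ∧
    cauchyT (densityConj J hv hβ z) z + Complex.I * J =
      Complex.I * J * Complex.exp (-expo a b J v β z z) := by
  have hE : Tendsto (fun ε : ℝ => expo a b J v β z (z + ε * Complex.I)) (𝓝[>] 0)
      (𝓝 (expo a b J v β z z)) :=
    (tendsto_cauchyT_of_support (memLp_log_dCoef hJ hv hβ hz).2
      (ae_of_all _ fun t ht => log_dCoef_of_notMem z ht) hzI).const_mul _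
  have him : ∀ᶠ ε : ℝ in 𝓝[>] 0, (z + ε * Complex.I).im ≠ 0 := by
    have hne : ∀ᶠ ε : ℝ in 𝓝[>] 0, ε ≠ -z.im := by
      by_cases h : z.im = 0
      · filter_upwards [self_mem_nhdsWithin] with ε (hε : 0 < ε)
        rw [h, neg_zero]; exact hε.ne'
      · exact nhdsWithin_le_nhds (isOpen_ne.mem_nhds (by simpa using (neg_ne_zero.mpr h).symm))
    filter_upwards [hne] with ε hε h
    simp at h
    exact hε (by linarith)
  constructor
  · refine tendsto_nhds_unique ((tendsto_cauchyT_of_support (density_support hv hβ z).1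
      (density_support hv hβ z).2 hzI).sub_const _) ((hE.cexp.const_mul _).congr' ?_)
    filter_upwards [him] with ε hε using (solution_eq_exp hJ hv hβ hz hε).symm
  · refine tendsto_nhds_unique ((tendsto_cauchyT_of_support (densityConj_support hv hβ z).1
      (densityConj_support hv hβ z).2 hzI).add_const _) ((hE.neg.cexp.const_mul _).congr' ?_)
    filter_upwards [him] with ε hε using (solutionConj_eq_exp hJ hv hβ hz hε).symm

include hJ in
/-- The density of the second solution in terms of `ln d`: the jump of the exponential
representation across the line. -/
lemma ae_densityConj_eq {z : ℂ} (hz : z ∈ resolventSet ℂ (modelY J v hv β hβ)) (ℓ : L2R)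
    (hℓ : ∀ᵐ t : ℝ, ℓ t = Complex.log (dCoef a b J v β z t)) :
    ∀ᵐ x : ℝ, (omegaFn a b J v x : ℂ) / rootFactor a b J v β z x *
      Complex.exp (-((2 * Real.pi * Complex.I)⁻¹ * hilbertT ℓ x)) = J * densityConj J hv hβ z x := by
  have hexpo : ∀ w, expo a b J v β z w = (2 * Real.pi * Complex.I)⁻¹ * cauchyT ℓ w := fun w => by
    rw [expo, cauchyT, cauchyT]
    congr 1
    refine integral_congr_ae ?_
    filter_upwards [hℓ] with t ht
    rw [ht]
  filter_upwards [ae_tendsto_cauchyT ℓ, ae_tendsto_cauchyT (densityConj J hv hβ z), hℓ,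
    ae_sym_ne_zero hv hβ hz, ae_dCoef_mem_slitPlane hJ hv hβ hz] with x e1 e2 e3 e4 e5
  set c : ℂ := (2 * Real.pi * Complex.I)⁻¹ with hc
  have hup : hilbertT (densityConj J hv hβ z) x + Real.pi * Complex.I * densityConj J hv hβ z x +
      Complex.I * J =
      Complex.I * J * Complex.exp (-(c * (hilbertT ℓ x + Real.pi * Complex.I * ℓ x))) := by
    refine tendsto_nhds_unique (e2.1.add_const _)
      (((e1.1.const_mul c).neg.cexp.const_mul (Complex.I * J)).congr' ?_)
    filter_upwards [self_mem_nhdsWithin] with ε (hε : 0 < ε)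
    rw [solutionConj_eq_exp hJ hv hβ hz (by simpa using hε.ne'), hexpo]
  have hdown : hilbertT (densityConj J hv hβ z) x - Real.pi * Complex.I * densityConj J hv hβ z x +
      Complex.I * J =
      Complex.I * J * Complex.exp (-(c * (hilbertT ℓ x - Real.pi * Complex.I * ℓ x))) := by
    refine tendsto_nhds_unique (e2.2.add_const _)
      (((e1.2.const_mul c).neg.cexp.const_mul (Complex.I * J)).congr' ?_)
    filter_upwards [self_mem_nhdsWithin] with ε (hε : 0 < ε)
    rw [solutionConj_eq_exp hJ hv hβ hz (by simpa using hε.ne'), hexpo]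
  have hpi : (Real.pi : ℂ) ≠ 0 := by exact_mod_cast Real.pi_ne_zero
  have hI := Complex.I_ne_zero
  set u := Complex.exp (ℓ x / 2) with hu
  set y := Complex.exp (-(c * hilbertT ℓ x)) with hy
  have hu0 : u ≠ 0 := Complex.exp_ne_zero _
  have r1 : Complex.exp (-(c * (hilbertT ℓ x + Real.pi * Complex.I * ℓ x))) = y * u⁻¹ := by
    rw [hy, hu, ← Complex.exp_neg, ← Complex.exp_add, hc]
    congr 1; field_simp; ring
  have r2 : Complex.exp (-(c * (hilbertT ℓ x - Real.pi * Complex.I * ℓ x))) = y * u := by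
    rw [hy, hu, ← Complex.exp_add, hc]
    congr 1; field_simp; ring
  rw [r1] at hup
  rw [r2] at hdown
  have hu2 : u * u = symM a b J v β z x / symP a b J v β z x := by
    rw [hu, ← Complex.exp_add, add_halves, e3, Complex.exp_log (Complex.slitPlane_ne_zero e5),
      dCoef_eq]
  have hroot : rootFactor a b J v β z x = symP a b J v β z x * u := by
    rw [hu, e3]; rfl
  have hω : (2 * Real.pi * omegaFn a b J v x : ℂ) =
      symP a b J v β z x * (1 - u * u) := by
    rw [hu2, mul_sub, mul_one, mul_div_cancel₀ _ e4.1]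
    simp only [symP, symM]; ring
  have hJ2 : (J : ℂ) ^ 2 = 1 := by rcases hJ with h | h <;> simp [h]
  have hdiff : 2 * Real.pi * densityConj J hv hβ z x = J * y * (u⁻¹ - u) := by
    have : Complex.I * (2 * Real.pi * densityConj J hv hβ z x) = Complex.I * (J * y * (u⁻¹ - u)) := by
      linear_combination hup - hdown
    exact mul_left_cancel₀ hI this
  have h2pi : (2 * Real.pi : ℂ) ≠ 0 := by simp [hpi]
  refine mul_left_cancel₀ h2pi ?_
  rw [hroot]
  have e6 := e4.1
  have e7 : 2 * Real.pi * (J * densityConj J hv hβ z x) = y * (u⁻¹ - u) := by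
    linear_combination J * hdiff + y * (u⁻¹ - u) * hJ2
  rw [e7]
  have e8 : (2 * Real.pi : ℂ) * ((omegaFn a b J v x : ℂ) / (symP a b J v β z x * u) * y) =
      (2 * Real.pi * omegaFn a b J v x : ℂ) / (symP a b J v β z x * u) * y := by ring
  rw [e8, hω]
  field_simp

include hJ in
theorem hasClosedForm_exp {z : ℂ} (hz : z ∈ resolventSet ℂ (modelY J v hv β hβ))
    (hzI : ∀ t ∈ Set.Icc a b, (t : ℂ) ≠ z) :
    HasClosedForm a b J v β z (Complex.exp (expo a b J v β z z)) := by
  refine ⟨?_, ?_⟩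
  · filter_upwards [ae_sym_ne_zero hv hβ hz, ae_dCoef_mem_slitPlane hJ hv hβ hz] with t h1 h2
    exact ⟨h1.1, h2⟩
  obtain ⟨hl2, hl1⟩ := memLp_log_dCoef hJ hv hβ hz
  set ℓ : L2R := hl2.toLp _ with hℓdef
  have hℓ : ∀ᵐ t : ℝ, ℓ t = Complex.log (dCoef a b J v β z t) := hl2.coeFn_toLp
  set E := expo a b J v β z z with hE
  have hEℓ : E = (2 * Real.pi * Complex.I)⁻¹ * cauchyT ℓ z := by
    rw [hE, expo, cauchyT, cauchyT]
    congr 1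
    refine integral_congr_ae ?_
    filter_upwards [hℓ] with t ht
    rw [ht]
  have hℓint : Integrable fun t => ℓ t * cauchyKer z t :=
    (integrable_mul_cauchyKer_of_support hl1 (ae_of_all _ fun t ht => log_dCoef_of_notMem z ht)
      hzI).congr (by filter_upwards [hℓ] with t ht; rw [ht])
  let P : ℝ → ℂ := fun x => cauchyKer z x * (hilbertT ℓ x - cauchyT ℓ z)
  have hval : ∀ᵐ x ∂(lebIcc a b), closedIntegrand a b J v β P z x =
      Complex.exp E * J * (densityConj J hv hβ z x * cauchyKer z x) := by
    filter_upwards [ae_restrict_of_ae (ae_densityConj_eq hJ hv hβ hz ℓ hℓ),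
      ae_restrict_mem measurableSet_Icc] with x h1 hx
    have hxz : (x : ℂ) - z ≠ 0 := sub_ne_zero.mpr (hzI x hx)
    have h2 : (z - (x : ℂ)) / (2 * (Real.pi : ℂ) * Complex.I) * P x =
        E + -((2 * Real.pi * Complex.I)⁻¹ * hilbertT ℓ x) := by
      have : (z - (x : ℂ)) * cauchyKer z x = -1 := by
        rw [cauchyKer, ← neg_sub, neg_mul, mul_inv_cancel₀ hxz]
      rw [hEℓ, div_eq_mul_inv]
      linear_combination (2 * Real.pi * Complex.I)⁻¹ * (hilbertT ℓ x - cauchyT ℓ z) * this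
    rw [closedIntegrand, h2, Complex.exp_add, div_eq_mul_inv _ ((x : ℂ) - z)]
    change _ * cauchyKer z x = _
    linear_combination (Complex.exp E * cauchyKer z x) * h1
  have hint : Integrable (fun x => Complex.exp E * J * (densityConj J hv hβ z x * cauchyKer z x))
      volume :=
    (integrable_mul_cauchyKer_of_support (densityConj_support hv hβ z).1
      (densityConj_support hv hβ z).2 hzI).const_mul _
  refine ⟨P, ?_, hint.integrableOn.congr (hval.mono fun x hx => hx.symm), ?_⟩
  · filter_upwards [ae_restrict_of_ae (s := Set.Icc a b) (ae_hasPV_hilbertT ℓ),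
      ae_restrict_mem measurableSet_Icc] with x h1 hx
    refine (h1.mul_cauchyKer hℓint (hzI x hx)).congr_ae ?_
    filter_upwards [hℓ] with t ht
    rw [ht, cauchyKer, div_eq_mul_inv, div_eq_mul_inv, mul_inv, mul_assoc]
  · have h1 : ∫ x, closedIntegrand a b J v β P z x ∂(lebIcc a b) =
        Complex.exp E * J * cauchyT (densityConj J hv hβ z) z := by
      rw [integral_congr_ae hval, integral_const_mul, cauchyT]
      congr 1
      refine setIntegral_eq_integral_of_ae_compl_eq_zero ?_
      filter_upwards [(densityConj_support hv hβ z).2] with t ht hI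
      rw [ht hI, zero_mul]
    have h2 := (solution_eq_exp_self hJ hv hβ hz hzI).2
    have h3 : Complex.exp E * Complex.exp (-E) = 1 := by
      rw [← Complex.exp_add, add_neg_cancel, Complex.exp_zero]
    have hJ2 : (J : ℂ) ^ 2 = 1 := by rcases hJ with h | h <;> simp [h]
    rw [h1]
    linear_combination (-Complex.I * J * Complex.exp E) * h2 - (Complex.I ^ 2 * J ^ 2) * h3 +
      (-(J : ℂ) ^ 2 + J ^ 2 * Complex.exp E) * Complex.I_sq + (1 - Complex.exp E) * hJ2

/-- If the pencil of the model pair is invertible at `z`, then `z` lies off `[a, b]` and in the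
resolvent set of the second operator. -/
lemma regular_of_isUnit (hab : a < b) {z : ℂ}
    (h : IsUnit ((z • (1 : L2Icc a b →L[ℂ] L2Icc a b) - modelY J v hv β hβ) *
      (z • (1 : L2Icc a b →L[ℂ] L2Icc a b) - modelX a b))) :
    (∀ t ∈ Set.Icc a b, (t : ℂ) ≠ z) ∧ z ∈ resolventSet ℂ (modelY J v hv β hβ) := by
  set S : L2Icc a b →L[ℂ] L2Icc a b := z • 1 - modelX a b with hS
  set R : L2Icc a b →L[ℂ] L2Icc a b := z • 1 - modelY J v hv β hβ with hR
  have hm : MemLp (fun t : ℝ => z - (t : ℂ)) ⊤ (lebIcc a b) :=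
    (memLp_const z).sub memLp_top_ofReal_id
  have hSm : S = mulOp _ hm := by
    ext1 f
    ext1
    have e : S f = z • f - modelX a b f := rfl
    rw [e]
    filter_upwards [Lp.coeFn_sub (z • f) (modelX a b f), Lp.coeFn_smul z f,
      coeFn_mulOp memLp_top_ofReal_id f, coeFn_mulOp hm f] with t e1 e2 e3 e4
    rw [e1, Pi.sub_apply, e2, Pi.smul_apply, modelX, e3, e4, smul_eq_mul]; ring
  have hI : ∀ t ∈ Set.Icc a b, (t : ℂ) ≠ z := by
    obtain ⟨u, hu⟩ := h
    set G : L2Icc a b →L[ℂ] L2Icc a b := (↑u⁻¹ : L2Icc a b →L[ℂ] L2Icc a b) * R with hG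
    have hGS : G * S = 1 := by rw [hG, mul_assoc, ← hu]; simp
    have h1 : ∀ᵐ t : ℝ, t ∈ Set.Icc a b → 1 ≤ ‖G‖ * ‖z - (t : ℂ)‖ := by
      refine (ae_restrict_iff' measurableSet_Icc).mp (one_le_mul_norm_symbol (s := 1) hv hm (fun f => S f)
        0 (Or.inl rfl) (norm_nonneg G) (fun f => ?_) fun f => ?_)
      · rw [hSm]; simp
      · have h2 := G.le_opNorm (S f)
        have h3 : G (S f) = f := DFunLike.congr_fun hGS f
        rwa [h3] at h2
    intro x hx hxz
    -- near `x = z` the lower bound fails on a nonempty open subset of `[a, b]`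
    have hopen : IsOpen (Set.Ioo a b ∩ {t : ℝ | ‖G‖ * ‖z - (t : ℂ)‖ < 1}) :=
      isOpen_Ioo.inter (isOpen_lt (by fun_prop) continuous_const)
    have hne : (Set.Ioo a b ∩ {t : ℝ | ‖G‖ * ‖z - (t : ℂ)‖ < 1}).Nonempty := by
      have hcl : x ∈ closure (Set.Ioo a b) := by rwa [closure_Ioo hab.ne]
      have hU : IsOpen {t : ℝ | ‖G‖ * ‖z - (t : ℂ)‖ < 1} := isOpen_lt (by fun_prop) continuous_const
      rw [Set.inter_comm]
      exact mem_closure_iff.mp hcl _ hU (by simp [hxz])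
    have hpos := hopen.measure_pos volume hne
    refine hpos.ne' (measure_mono_null (fun t ht => ?_) h1)
    simp only [Set.mem_compl_iff, Set.mem_ofPred_eq, Classical.not_imp, not_le]
    exact ⟨Set.Ioo_subset_Icc_self ht.1, ht.2⟩
  refine ⟨hI, ?_⟩
  obtain ⟨δ, hδ, hb⟩ := exists_pos_le_norm_sub hI
  have hk : MemLp (fun t => -cauchyKer z t) ⊤ (lebIcc a b) := by
    refine memLp_top_of_bound (measurable_cauchyKer z).neg.aestronglyMeasurable δ⁻¹ ?_
    filter_upwards [ae_restrict_mem measurableSet_Icc] with t ht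
    rw [norm_neg]; exact norm_cauchyKer_le_inv hδ (hb t ht)
  have hinv : S * mulOp _ hk = 1 ∧ mulOp _ hk * S = 1 := by
    rw [hSm]
    constructor
    · ext1 f
      ext1
      change (mulOp _ hm (mulOp _ hk f)) =ᵐ[lebIcc a b] f
      filter_upwards [coeFn_mulOp hm (mulOp _ hk f), coeFn_mulOp hk f,
        ae_restrict_mem measurableSet_Icc] with t e1 e2 ht
      have := sub_ne_zero.mpr (hI t ht)
      rw [e1, e2, cauchyKer]
      field_simp; ring
    · ext1 f
      ext1
      change (mulOp _ hk (mulOp _ hm f)) =ᵐ[lebIcc a b] f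
      filter_upwards [coeFn_mulOp hk (mulOp _ hm f), coeFn_mulOp hm f,
        ae_restrict_mem measurableSet_Icc] with t e1 e2 ht
      have := sub_ne_zero.mpr (hI t ht)
      rw [e1, e2, cauchyKer]
      field_simp; ring
  rw [spectrum.mem_resolventSet_iff, Algebra.algebraMap_eq_smul_one]
  have := (Units.isUnit_mul_units R ⟨S, mulOp _ hk, hinv.1, hinv.2⟩).mp h
  exact this

include hJ in
/-- The characteristic function of the model pencil, expressed by a solution `k` of `L(z) k = v`. -/
theorem exists_hasClosedForm (hab : a < b) {z : ℂ}
    (h : IsUnit ((z • (1 : L2Icc a b →L[ℂ] L2Icc a b) - modelY J v hv β hβ) *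
      (z • (1 : L2Icc a b →L[ℂ] L2Icc a b) - modelX a b))) :
    ∃ s : ℂ, HasClosedForm a b J v β z s ∧ ∀ k : L2Icc a b,
      ((z • (1 : L2Icc a b →L[ℂ] L2Icc a b) - modelY J v hv β hβ) *
        (z • (1 : L2Icc a b →L[ℂ] L2Icc a b) - modelX a b)) k = v →
      1 - Complex.I * J * inner ℂ v k = s := by
  obtain ⟨hI, hz⟩ := regular_of_isUnit hv hβ hab h
  refine ⟨_, hasClosedForm_exp hJ hv hβ hz hI, fun k hk => ?_⟩
  -- `(z - X) k` is the resolvent applied to `v`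
  have hg : z • k - modelX a b k = resolvent (modelY J v hv β hβ) z v := by
    rw [← (resolvent_apply_spec hz (z • k - modelX a b k)).2]
    congr 1
  have hkt : ∀ᵐ t : ℝ, t ∈ Set.Icc a b →
      (z - t) * k t = resolvent (modelY J v hv β hβ) z v t := by
    rw [← ae_restrict_iff' measurableSet_Icc]
    filter_upwards [Lp.coeFn_sub (z • k) (modelX a b k), Lp.coeFn_smul z k,
      coeFn_mulOp memLp_top_ofReal_id k] with t e1 e2 e3
    rw [← hg, e1, Pi.sub_apply, e2, Pi.smul_apply, modelX, e3, smul_eq_mul]; ring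
  have hinner : inner ℂ v k = -cauchyT (density J hv hβ z) z := by
    rw [← integral_weightOp hv, cauchyT, ← integral_neg]
    refine integral_congr_ae ?_
    filter_upwards [hkt, coeFn_weightOp hv k,
      coeFn_weightOp hv (resolvent (modelY J v hv β hβ) z v)] with t e1 e2 e3
    rw [e2, density, e3]
    by_cases ht : t ∈ Set.Icc a b
    · rw [Set.indicator_of_mem ht, Set.indicator_of_mem ht, ← e1 ht, cauchyKer]
      have := sub_ne_zero.mpr (hI t ht)
      field_simp; ring
    · simp [ht]
  have h2 := (solution_eq_exp_self hJ hv hβ hz hI).1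
  have hJ2 : (J : ℂ) ^ 2 = 1 := by rcases hJ with h | h <;> simp [h]
  rw [hinner]
  linear_combination Complex.I * J * h2 +
    (J ^ 2 - J ^ 2 * Complex.exp (expo a b J v β z z)) * Complex.I_sq +
    (-1 + Complex.exp (expo a b J v β z z)) * hJ2

end ClosedForm

/-! ### Characteristic functions of pencils with a rank-one defect -/

lemma quadPencil_eq_mul {H : Type*} [NormedAddCommGroup H] [InnerProductSpace ℂ H]
    (X Y : H →L[ℂ] H) (z : ℂ) :
    quadPencil (Y * X) (-X - Y) z = (z • (1 : H →L[ℂ] H) - Y) * (z • 1 - X) := by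
  simp only [quadPencil, sub_mul, mul_sub, smul_mul_assoc, mul_smul_comm, one_mul, mul_one]
  module

/-- With a scalar channel the characteristic function is multiplication by a number, which is read
off from a solution of `L(z) k = φ* 1`. -/
lemma charFunction_eq_smul_one {H : Type*} [NormedAddCommGroup H] [InnerProductSpace ℂ H]
    [CompleteSpace H] {A B : H →L[ℂ] H} (φ : H →L[ℂ] ℂ) (J : ℝ) {z : ℂ}
    (h : IsUnit (quadPencil A B z)) {k : H}
    (hk : quadPencil A B z k = ContinuousLinearMap.adjoint φ 1) :
    charFunction A B φ ((J : ℂ) • (1 : ℂ →L[ℂ] ℂ)) z =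
      (1 - Complex.I * J * φ k) • (1 : ℂ →L[ℂ] ℂ) := by
  have h1 : Ring.inverse (quadPencil A B z) (ContinuousLinearMap.adjoint φ 1) = k := by
    rw [← hk]
    exact DFunLike.congr_fun (Ring.inverse_mul_cancel _ h) k
  have h2 : ContinuousLinearMap.adjoint φ (J : ℂ) = (J : ℂ) • ContinuousLinearMap.adjoint φ 1 := by
    rw [← map_smul, smul_eq_mul, mul_one]
  ext
  simp only [charFunction, sub_apply, smul_apply, ContinuousLinearMap.comp_apply,
    one_apply_eq_self, smul_eq_mul, mul_one, h2, map_smul, h1]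
  ring

lemma exists_quadPencil_apply_eq {H : Type*} [NormedAddCommGroup H] [InnerProductSpace ℂ H]
    {A B : H →L[ℂ] H} {z : ℂ} (h : IsUnit (quadPencil A B z)) (y : H) :
    ∃ k, quadPencil A B z k = y :=
  ⟨Ring.inverse (quadPencil A B z) y, DFunLike.congr_fun (Ring.mul_inverse_cancel _ h) y⟩

/-! ### Pencils whose right root is multiplication by the independent variable -/

/-- A self-adjoint operator whose commutator with multiplication by the independent variable is the
rank-one operator of a model pair is the second operator of a model pair: subtracting the singular
integral leaves an operator that commutes with multiplication by the independent variable. -/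
theorem exists_eq_modelY {a b : ℝ} (J : ℝ) {v : L2Icc a b} (hv : MemLp v ⊤ (lebIcc a b))
    {Y : L2Icc a b →L[ℂ] L2Icc a b} (hY : IsSelfAdjoint Y)
    (hc : ∀ f, Y (modelX a b f) - modelX a b (Y f) = (Complex.I * J * inner ℂ v f) • v) :
    ∃ β : ℝ → ℝ, ∃ hβ : MemLp β ⊤ (lebIcc a b), Y = modelY J v hv β hβ := by
  have h0 : MemLp (fun _ : ℝ => (0 : ℝ)) ⊤ (lebIcc a b) := MemLp.zero
  obtain ⟨u, hu, hD⟩ := exists_eq_mulOp_of_commute (Y - modelY J v hv _ h0) fun f => by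
    have h1 := (hc f).trans (modelY_mul_modelX_sub J hv h0 f).symm
    rw [sub_apply, sub_apply, map_sub, sub_eq_sub_iff_add_eq_add]
    rw [sub_eq_sub_iff_add_eq_add] at h1
    rw [h1, add_comm]
  have hreal := ae_conj_eq_of_isSelfAdjoint_mulOp (u := u) (hu := hu)
    (hD ▸ hY.sub (isSelfAdjoint_modelY J hv h0))
  have hβ : MemLp (fun t => -(u t).re) ⊤ (lebIcc a b) := hu.re.neg
  refine ⟨_, hβ, ?_⟩
  ext1 f
  ext1
  have e : Y f = mulOp u hu f + modelY J v hv _ h0 f := by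
    rw [← hD, sub_apply, sub_add_cancel]
  rw [e]
  filter_upwards [Lp.coeFn_add (mulOp u hu f) (modelY J v hv _ h0 f), coeFn_mulOp hu f,
    coeFn_modelY J hv h0 f, coeFn_modelY J hv hβ f, hreal] with t e1 e2 e3 e4 e5
  rw [e1, Pi.add_apply, e2, e3, e4]
  rw [Complex.conj_eq_iff_re] at e5
  rw [← e5]
  push_cast
  simp only [Complex.ofReal_re]
  ring

/-- The operator `V⁻¹ T V`, as a monoid homomorphism in `T`. -/
def unitaryConj {E H : Type*} [NormedAddCommGroup E] [InnerProductSpace ℂ E]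
    [NormedAddCommGroup H] [InnerProductSpace ℂ H] (V : E ≃ₗᵢ[ℂ] H) :
    (H →L[ℂ] H) →* (E →L[ℂ] E) where
  toFun T := (V.symm.toContinuousLinearEquiv : H →L[ℂ] E).comp
    (T.comp (V.toContinuousLinearEquiv : E →L[ℂ] H))
  map_one' := by ext f; simp
  map_mul' S T := by ext f; simp

lemma unitaryConj_apply {E H : Type*} [NormedAddCommGroup E] [InnerProductSpace ℂ E]
    [NormedAddCommGroup H] [InnerProductSpace ℂ H] (V : E ≃ₗᵢ[ℂ] H) (T : H →L[ℂ] H) (f : E) :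
    unitaryConj V T f = V.symm (T (V f)) := rfl

lemma inner_symm_apply_left {E H : Type*} [NormedAddCommGroup E] [InnerProductSpace ℂ E]
    [NormedAddCommGroup H] [InnerProductSpace ℂ H] (V : E ≃ₗᵢ[ℂ] H) (y : H) (f : E) :
    inner ℂ (V.symm y) f = inner ℂ y (V f) := by
  rw [← V.inner_map_map, V.apply_symm_apply]

lemma isSelfAdjoint_unitaryConj_iff {E H : Type*} [NormedAddCommGroup E] [InnerProductSpace ℂ E]
    [CompleteSpace E] [NormedAddCommGroup H] [InnerProductSpace ℂ H] [CompleteSpace H]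
    (V : E ≃ₗᵢ[ℂ] H) (T : H →L[ℂ] H) : IsSelfAdjoint (unitaryConj V T) ↔ IsSelfAdjoint T := by
  have hr : ∀ (y : H) (f : E), inner ℂ f (V.symm y) = inner ℂ (V f) y := fun y f => by
    rw [← V.inner_map_map, V.apply_symm_apply]
  rw [ContinuousLinearMap.isSelfAdjoint_iff_isSymmetric,
    ContinuousLinearMap.isSelfAdjoint_iff_isSymmetric]
  constructor
  · intro h x y
    have h1 := h (V.symm x) (V.symm y)
    simpa [unitaryConj_apply, inner_symm_apply_left, hr] using h1
  · intro h f g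
    have h1 := h (V f) (V g)
    simpa [unitaryConj_apply, inner_symm_apply_left, hr] using h1

lemma inner_adjoint_one {H : Type*} [NormedAddCommGroup H] [InnerProductSpace ℂ H]
    [CompleteSpace H] (φ : H →L[ℂ] ℂ) (x : H) :
    inner ℂ (ContinuousLinearMap.adjoint φ 1) x = φ x := by
  rw [ContinuousLinearMap.adjoint_inner_left, RCLike.inner_apply, map_one, mul_one]

/-- If `L(z) = (z - Y)(z - X)` with `X` and `B` self-adjoint, then `Y` is self-adjoint and the
colligation condition says that the commutator of `Y` and `X` is `i φ* J φ`. -/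
lemma commutator_of_factorization {H : Type*} [NormedAddCommGroup H] [InnerProductSpace ℂ H]
    [CompleteSpace H] {A B X Y : H →L[ℂ] H} {φ : H →L[ℂ] ℂ} {J : ℝ}
    (hA : IsLocalColligation A φ ((J : ℂ) • (1 : ℂ →L[ℂ] ℂ))) (hB : IsSelfAdjoint B)
    (hL : ∀ z : ℂ, quadPencil A B z = (z • (1 : H →L[ℂ] H) - Y) * (z • (1 : H →L[ℂ] H) - X))
    (hX : IsSelfAdjoint X) :
    IsSelfAdjoint Y ∧ ∀ f, Y (X f) - X (Y f) =
      (Complex.I * J * φ f) • ContinuousLinearMap.adjoint φ 1 := by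
  have hAeq : A = Y * X := by simpa [quadPencil] using hL 0
  have hBeq : B = -X - Y := by
    have h1 := hL 1
    simp only [quadPencil, one_pow, one_smul, hAeq, sub_mul, mul_sub, one_mul, mul_one] at h1
    have h2 : B = (1 + B + Y * X) - 1 - Y * X := by abel
    rw [h2, h1]; abel
  have hY : IsSelfAdjoint Y := by
    have : Y = -B - X := by rw [hBeq]; abel
    rw [this]
    exact hB.neg.sub hX
  refine ⟨hY, fun f => ?_⟩
  have h1 := DFunLike.congr_fun hA.2 f
  rw [hAeq, ← ContinuousLinearMap.star_eq_adjoint, star_mul, hX.star_eq, hY.star_eq] at h1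
  refine h1.trans ?_
  simp only [smul_apply, ContinuousLinearMap.comp_apply, one_apply_eq_self]
  rw [← mul_one ((J : ℂ) • φ f), ← smul_eq_mul ((J : ℂ) • φ f) 1, map_smul, smul_smul,
    smul_eq_mul, mul_assoc]

end

theorem theorem4p1 (a b : ℝ) (hab : a < b) (J : ℝ) (hJ : J = 1 ∨ J = -1) :
    -- the model pair: it exists for all admissible data and has the stated characteristic function
    (∀ (v : L2Icc a b) (β : ℝ → ℝ), MemLp v ⊤ (lebIcc a b) → MemLp β ⊤ (lebIcc a b) →
      (∃ X Y : L2Icc a b →L[ℂ] L2Icc a b, IsModelPair a b J v β X Y) ∧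
      ∀ X Y : L2Icc a b →L[ℂ] L2Icc a b, IsModelPair a b J v β X Y →
        IsSelfAdjoint X ∧ IsSelfAdjoint Y ∧
        IsLocalColligation (Y * X) (innerSL ℂ v) ((J : ℂ) • (1 : ℂ →L[ℂ] ℂ)) ∧
        ∀ z : ℂ, IsUnit (quadPencil (Y * X) (-X - Y) z) →
          ∃ s : ℂ, HasClosedForm a b J v β z s ∧
            charFunction (Y * X) (-X - Y) (innerSL ℂ v) ((J : ℂ) • (1 : ℂ →L[ℂ] ℂ)) z
              = s • (1 : ℂ →L[ℂ] ℂ)) ∧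
    -- an arbitrary pencil whose right root is unitarily equivalent to multiplication by `x`
    (∀ (H : Type*) [NormedAddCommGroup H] [InnerProductSpace ℂ H] [CompleteSpace H]
      (A B X Y : H →L[ℂ] H) (φ : H →L[ℂ] ℂ) (V : L2Icc a b ≃ₗᵢ[ℂ] H),
      IsLocalColligation A φ ((J : ℂ) • (1 : ℂ →L[ℂ] ℂ)) →
      IsSelfAdjoint B →
      (∀ z : ℂ, quadPencil A B z
        = (z • (1 : H →L[ℂ] H) - Y) * (z • (1 : H →L[ℂ] H) - X)) →
      (∀ f : L2Icc a b, ∀ᵐ x : ℝ ∂(lebIcc a b), V.symm (X (V f)) x = (x : ℂ) * f x) →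
      MemLp (V.symm (ContinuousLinearMap.adjoint φ 1)) ⊤ (lebIcc a b) →
      ∃ β : ℝ → ℝ, MemLp β ⊤ (lebIcc a b) ∧
        (∃ X' Y' : L2Icc a b →L[ℂ] L2Icc a b,
          (∀ f, V (X' f) = X (V f)) ∧ (∀ f, V (Y' f) = Y (V f)) ∧
          IsModelPair a b J (V.symm (ContinuousLinearMap.adjoint φ 1)) β X' Y') ∧
        ∀ z : ℂ, IsUnit (quadPencil A B z) →
          ∃ s : ℂ,
            HasClosedForm a b J (V.symm (ContinuousLinearMap.adjoint φ 1)) β z s ∧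
            charFunction A B φ ((J : ℂ) • (1 : ℂ →L[ℂ] ℂ)) z = s • (1 : ℂ →L[ℂ] ℂ)) := by
  refine ⟨fun v β hv hβ => ⟨⟨_, _, isModelPair_model J hv hβ⟩, fun X Y hXY => ?_⟩, ?_⟩
  · obtain ⟨rfl, rfl⟩ := hXY.unique (isModelPair_model J hv hβ)
    refine ⟨isSelfAdjoint_modelX a b, isSelfAdjoint_modelY J hv hβ,
      isLocalColligation_model J hv hβ, fun z hz => ?_⟩
    obtain ⟨k, hk⟩ := exists_quadPencil_apply_eq hz v
    have hz' := hz
    rw [quadPencil_eq_mul] at hz'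
    obtain ⟨s, hs, hsk⟩ := exists_hasClosedForm hJ hv hβ hab hz'
    refine ⟨s, hs, ?_⟩
    rw [charFunction_eq_smul_one _ J hz (k := k) (by rw [hk, adjoint_innerSL_apply, one_smul]),
      innerSL_apply_apply, hsk k (by rw [← quadPencil_eq_mul, hk])]
  · intro H _ _ _ A B X Y φ V hA hB hL hX hv
    have hXm : unitaryConj V X = modelX a b := by
      ext1 f
      ext1
      filter_upwards [hX f, coeFn_mulOp memLp_top_ofReal_id f] with t e1 e2
      rw [unitaryConj_apply, e1, modelX, e2]
    obtain ⟨hY, hYX⟩ := commutator_of_factorization hA hB hL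
      ((isSelfAdjoint_unitaryConj_iff V X).mp (hXm ▸ isSelfAdjoint_modelX a b))
    obtain ⟨β, hβ, hYm⟩ := exists_eq_modelY J hv ((isSelfAdjoint_unitaryConj_iff V Y).mpr hY)
      fun f => by
        rw [← hXm, inner_symm_apply_left, inner_adjoint_one, ← map_smul, ← hYX]
        simp [unitaryConj_apply]
    refine ⟨β, hβ, ⟨unitaryConj V X, unitaryConj V Y, fun f => by simp [unitaryConj_apply],
      fun f => by simp [unitaryConj_apply], ?_⟩, fun z hz => ?_⟩
    · rw [hXm, hYm]
      exact isModelPair_model J hv hβ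
    · have hconj : unitaryConj V (quadPencil A B z) =
          (z • 1 - modelY J _ hv β hβ) * (z • 1 - modelX a b) := by
        rw [hL, map_mul, ← hXm, ← hYm]
        congr 1 <;> · ext1 f; simp [unitaryConj_apply]
      have hz' := hz.map (unitaryConj V)
      rw [hconj] at hz'
      obtain ⟨k, hk⟩ := exists_quadPencil_apply_eq hz (ContinuousLinearMap.adjoint φ 1)
      obtain ⟨s, hs, hsk⟩ := exists_hasClosedForm hJ hv hβ hab hz'
      refine ⟨s, hs, ?_⟩
      rw [charFunction_eq_smul_one φ J hz hk, ← hsk (V.symm k), inner_symm_apply_left,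
        V.apply_symm_apply, inner_adjoint_one]
      rw [← hconj, unitaryConj_apply, V.apply_symm_apply, hk]
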